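/- **Setting.** Let $m,n\ge 0$ be integers. Let $E_{ab}$ be the matrix units of $\mathfrak{gl}_m=\mathfrak{gl}_m(\mathbb C)$, let $\mathfrak n=\mathrm{span}\{E_{ba}:a<b\}$ and $\mathfrak h=\mathrm{span}\{E_{aa}\}$, and identify a weight $\mu\in\mathfrak h^*$ with $(\mu_1,\dots,\mu_m)$, $\mu_a=\mu(E_{aa})$. Put $\rho=(0,-1,\dots,1-m)$. For $\sigma\in\mathfrak S_m$ let $(\sigma\mu)_a=\mu_{\sigma^{-1}(a)}$ and $\sigma\circ\mu=\sigma(\mu+\rho)-\rho$. Let $\sigma_c$ be the transposition of $c,c+1$ and $\varepsilon_c$ the simple root with $\varepsilon_c(E_{aa})=\delta_{ac}-\delta_{a,c+1}$. Let $M_\mu$ be the Verma module, i.e. $\mathrm U(\mathfrak{gl}_m)$ modulo the left ideal generated by $E_{ab}$ ($a<b$) and $E_{aa}-\mu_a$; let $1_\mu$ be the image of $1$. Let $\Lambda=\Lambda(\mathbb C^m\otimes\mathbb C^n)$ be the exterior algebra with anticommuting generators $x_{ai}$, let $\partial_{ai}$ be the left derivations, $\mathcal{GD}=\mathrm{End}\,\Lambda$,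 and ${\rm A}=\mathrm U(\mathfrak{gl}_m)\otimes\mathcal{GD}$. Here $\mathfrak{gl}_m$ is embedded in $\rm A$ by $E_{ab}\mapsto E_{ab}\otimes1+1\otimes\sum_k x_{ak}\partial_{bk}$, and $\mathfrak S_m$ acts on $\rm A$ by $E_{ab}\otimes 1\mapsto E_{\sigma(a)\sigma(b)}\otimes 1$, $x_{ak}\mapsto x_{\sigma(a)k}$, $\partial_{bk}\mapsto\partial_{\sigma(b)k}$. Let $\overline{\mathrm U(\mathfrak h)}$ and $\bar{\rm A}$ be the rings of fractions of $\mathrm U(\mathfrak h)$ and $\rm A$ relative to the denominators $E_{aa}-E_{bb}+z$ ($a\ne b$, $z\in\mathbb Z$); elements of $\overline{\mathrm U(\mathfrak h)}$ are regarded as rational functions on $\mathfrak h^*$. Let $\rm J$ be the right ideal of $\rm A$ generated by $\mathfrak n$, ${\rm I}_\mu$ the left ideal generated by $E_{ab}$ ($a<b$), $E_{aa}-\mu_a$ and all $\partial_{bk}$, and $\bar{\rm J}=\overline{\mathrm U(\mathfrak h)}\,{\rm J}$, $\bar{\rm I}_\mu=\overline{\mathrm U(\mathfrak h)}\,{\rm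 I}_\mu$. For $1\le c<m$ put $E=E_{c,c+1}$, $F=E_{c+1,c}$, $H=E_{cc}-E_{c+1,c+1}$ in ${\rm A}$ and, for $Y\in{\rm A}$, $$\xi_c(Y)=\sum_{s\ge0}\bigl(s!\,H(H-1)\cdots(H-s+1)\bigr)^{-1}E^s\,(\mathrm{ad}\,F)^s(Y)\in\bar{\rm A}.$$ The Zhelobenko operator $\check\xi_c$ is the map $\bar{\rm J}\backslash\bar{\rm A}\to\bar{\rm J}\backslash\bar{\rm A}$ sending the class of $XY$ ($X\in\overline{\mathrm U(\mathfrak h)}$, $Y\in{\rm A}$) to the class of $Z\,\xi_c(\sigma_c(Y))$, where $Z(\kappa)=X(\sigma_c^{-1}(\kappa+\varepsilon_c))$. For a $\mathfrak{gl}_m$-module $W$ put $W_{\mathfrak n}=W/\mathfrak nW$, and let $W_{\mathfrak n}^\lambda$ be the subspace of vectors of weight $\lambda$. The Yangian $\mathrm Y(\mathfrak{gl}_n)$ is the unital algebra with generators $T^{(1)}_{ij},T^{(2)}_{ij},\dots$ $(1\le i,j\le n)$ and, for $T_{ij}(u)=\delta_{ij}+\sum_{s\ge 1}T^{(s)}_{ij}u^{-s}$,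 relations $(u-v)[T_{ij}(u),T_{kl}(v)]=T_{kj}(u)T_{il}(v)-T_{kj}(v)T_{il}(u)$. **Proposition 3.7.** Let $\mu\in\mathfrak h^*$ satisfy $\mu_a-\mu_b\notin\mathbb Z$ for all $a\ne b$, and let $\sigma\in\mathfrak S_m$. The weight $\sigma\circ\mu$ satisfies the same condition. (i) The operators $\check\xi_c$ are well defined. For every $\kappa\in\mathfrak h^*$ with $\kappa_a-\kappa_b\notin\mathbb Z$ for $a\neq b$, the map $Y\mapsto Y(1_\kappa\otimes1)$, $Y\in{\rm A}$, induces an identification $\bar{\rm J}\backslash\bar{\rm A}/\bar{\rm I}_\kappa=(M_\kappa\otimes\Lambda)_{\mathfrak n}$. For every $\kappa\in\mathfrak h^*$ the algebra $\mathrm Y(\mathfrak{gl}_n)$ acts on $(M_\kappa\otimes\Lambda)_{\mathfrak n}$, preserving its weight subspaces, so that for $s\ge0$ the generator $T_{ij}^{(s+1)}$ acts as $\sum_{c_0,\dots,c_s=1}^m E_{c_1c_0}E_{c_2c_1}\cdots E_{c_sc_{s-1}}\otimes x_{c_0i}\,\partial_{c_sj}$. (ii) For every reduced decomposition $\sigma=\sigma_{c_1}\cdots\sigma_{c_K}$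 the composition $\check\xi_{c_1}\cdots\check\xi_{c_K}$ induces, through these identifications, a linear map $I_\sigma:(M_\mu\otimes\Lambda)_{\mathfrak n}\to(M_{\sigma\circ\mu}\otimes\Lambda)_{\mathfrak n}$. It maps $(M_\mu\otimes\Lambda)_{\mathfrak n}^\lambda$ to $(M_{\sigma\circ\mu}\otimes\Lambda)_{\mathfrak n}^{\sigma\circ\lambda}$ for every $\lambda\in\mathfrak h^*$ and is $\mathrm Y(\mathfrak{gl}_n)$-intertwining. (iii) Let $\lambda\in\mathfrak h^*$ be such that all labels $\nu_a$ of $\nu=\lambda-\mu$ lie in $\{0,1,\dots,n\}$. Let $w_\nu=(x_{11}\cdots x_{1\nu_1})\cdots(x_{m1}\cdots x_{m\nu_m})$, and let $v_\mu^\lambda$ be the image of $1_\mu\otimes w_\nu$ in $(M_\mu\otimes\Lambda)_{\mathfrak n}$; it has weight $\lambda$. Define $v_{\sigma\circ\mu}^{\sigma\circ\lambda}$ likewise, as the image of $1_{\sigma\circ\mu}\otimes w_{\sigma\nu}$ (note that $\sigma\circ\lambda-\sigma\circ\mu=\sigma\nu$). Then, for the operator $I_\sigma$ obtained from any reduced decomposition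 of $\sigma$, $$I_\sigma(v_\mu^\lambda)=\prod_{\substack{1\le a<b\le m\\ \sigma(a)>\sigma(b)}}(-1)^{\nu_a\nu_b}\left\{\begin{array}{ll}\dfrac{\lambda_a-\lambda_b-a+b}{\mu_a-\mu_b-a+b}&\text{if }\nu_a<\nu_b\\[8pt]1&\text{if }\nu_a\ge\nu_b\end{array}\right\}\cdot v_{\sigma\circ\mu}^{\sigma\circ\lambda}.$$ -/

import Mathlib

namespace KNYang

open scoped TensorProduct

noncomputable section

attribute [local instance 100] LieRing.ofAssociativeRing

/-! ## The Lie algebra, the Grassmann algebra and the algebra of operators on it -/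

/-- The universal enveloping algebra of the complex Lie algebra `gl_m`. -/
abbrev Ugl (m : ℕ) : Type := UniversalEnvelopingAlgebra ℂ (Matrix (Fin m) (Fin m) ℂ)

/-- The matrix unit `E_{ab}`, as an element of `U(gl_m)`. -/
def unitU {m : ℕ} (a b : Fin m) : Ugl m :=
  UniversalEnvelopingAlgebra.ι ℂ (Matrix.single a b (1 : ℂ))

/-- The Grassmann algebra on `m n` anticommuting variables, that is the exterior algebra of
`ℂ^m ⊗ ℂ^n`. -/
abbrev Grass (m n : ℕ) : Type := ExteriorAlgebra ℂ (Fin m × Fin n → ℂ)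

/-- The ring of all endomorphisms of the Grassmann algebra. -/
abbrev GD (m n : ℕ) : Type := Module.End ℂ (Grass m n)

/-- The variable `x_{ai}`. -/
def gvar {m n : ℕ} (a : Fin m) (i : Fin n) : Grass m n :=
  ExteriorAlgebra.ι ℂ (Pi.single (a, i) (1 : ℂ))

/-- Left multiplication by `x_{ai}`. -/
def opX {m n : ℕ} (a : Fin m) (i : Fin n) : GD m n :=
  LinearMap.mulLeft ℂ (gvar a i)

/-- The left derivation `∂_{ai}` (inner multiplication by the coordinate dual to `x_{ai}`). -/
def opD {m n : ℕ} (a : Fin m) (i : Fin n) : GD m n :=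
  CliffordAlgebra.contractLeft (Q := (0 : QuadraticForm ℂ (Fin m × Fin n → ℂ)))
    (LinearMap.proj (a, i))

/-- The action `γ(E_{ab}) = ∑_k x_{ak} ∂_{bk}` of a matrix unit on the Grassmann algebra. -/
def gammaE (n : ℕ) {m : ℕ} (a b : Fin m) : GD m n :=
  ∑ k : Fin n, opX a k * opD b k

theorem opD_mul_opX {m n : ℕ} (a b : Fin m) (i j : Fin n) :
    opD b j * opX a i + opX a i * opD b j
      = if a = b ∧ i = j then (1 : GD m n) else 0 := by
  refine LinearMap.ext fun v => ?_
  have h := CliffordAlgebra.contractLeft_ι_mul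
    (Q := (0 : QuadraticForm ℂ (Fin m × Fin n → ℂ)))
    (LinearMap.proj (R := ℂ) (φ := fun _ => ℂ) (b, j)) (Pi.single (a, i) (1 : ℂ)) v
  have h' : opD b j (gvar a i * v)
      = (Pi.single (a, i) (1 : ℂ) : Fin m × Fin n → ℂ) (b, j) • v - gvar a i * opD b j v := h
  simp only [LinearMap.add_apply, Module.End.mul_apply]
  change opD b j (gvar a i * v) + gvar a i * opD b j v = _
  rw [h', sub_add_cancel, Pi.single_apply]
  by_cases hab : a = b ∧ i = j
  · simp [hab]
  · have : ¬ ((b, j) = (a, i)) := by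
      rintro h; simp at h; exact hab ⟨h.1.symm, h.2.symm⟩
    simp [hab, this]

theorem opX_mul_opX {m n : ℕ} (a b : Fin m) (i j : Fin n) :
    (opX a i * opX b j : GD m n) = - (opX b j * opX a i) := by
  refine LinearMap.ext fun v => ?_
  have h := ExteriorAlgebra.ι_add_mul_swap (R := ℂ)
    (Pi.single (a, i) (1 : ℂ) : Fin m × Fin n → ℂ) (Pi.single (b, j) (1 : ℂ))
  change gvar a i * (gvar b j * v) = - (gvar b j * (gvar a i * v))
  have h' : gvar a i * gvar b j = - (gvar b j * gvar a i : Grass m n) :=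
    eq_neg_of_add_eq_zero_left h
  rw [← mul_assoc, h', neg_mul, mul_assoc]

theorem opD_mul_opD {m n : ℕ} (a b : Fin m) (i j : Fin n) :
    (opD a i * opD b j : GD m n) = - (opD b j * opD a i) := by
  refine LinearMap.ext fun v => ?_
  exact CliffordAlgebra.contractLeft_comm _ _ _

theorem quad_comm {m n : ℕ} (a b c d : Fin m) (k l : Fin n) :
    (opX a k * opD b k) * (opX c l * opD d l) - (opX c l * opD d l) * (opX a k * opD b k)
      = (if c = b ∧ l = k then opX a k * opD d l else 0)
        - (if a = d ∧ k = l then (opX c l * opD b k : GD m n) else 0) := by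
  have h1 := opD_mul_opX (m := m) (n := n) c b l k
  have h2 := opD_mul_opX (m := m) (n := n) a d k l
  have h1' : opD b k * opX c l
      = (if c = b ∧ l = k then (1 : GD m n) else 0) - opX c l * opD b k := eq_sub_of_add_eq h1
  have h2' : opD d l * opX a k
      = (if a = d ∧ k = l then (1 : GD m n) else 0) - opX a k * opD d l := eq_sub_of_add_eq h2
  have e1 : (opX a k * opD b k) * (opX c l * opD d l)
      = opX a k * (opD b k * opX c l) * opD d l := by simp only [mul_assoc]
  have e2 : (opX c l * opD d l) * (opX a k * opD b k)
      = opX c l * (opD d l * opX a k) * opD b k := by simp only [mul_assoc]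
  have e3 : opX a k * (opX c l * opD b k) * opD d l
      = (opX c l * (opX a k * opD d l) * opD b k : GD m n) := by
    calc opX a k * (opX c l * opD b k) * opD d l
        = (opX a k * opX c l) * (opD b k * opD d l) := by simp only [mul_assoc]
      _ = (opX c l * opX a k) * (opD d l * opD b k) := by
          rw [opX_mul_opX a c, opD_mul_opD b d, neg_mul_neg]
      _ = _ := by simp only [mul_assoc]
  rw [e1, e2, h1', h2', mul_sub, sub_mul, mul_sub, sub_mul, e3, sub_sub_sub_cancel_right]
  congr 1 <;> split_ifs <;> simp

theorem gammaE_comm (n : ℕ) {m : ℕ} (a b c d : Fin m) :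
    gammaE n a b * gammaE n c d - gammaE n c d * gammaE n a b
      = (if b = c then gammaE n a d else 0) - (if a = d then gammaE n c b else 0) := by
  have h : gammaE n a b * gammaE n c d - gammaE n c d * gammaE n a b
      = ∑ k : Fin n, ∑ l : Fin n, ((opX a k * opD b k) * (opX c l * opD d l)
          - (opX c l * opD d l) * (opX a k * opD b k)) := by
    simp only [gammaE, Finset.sum_sub_distrib, Finset.sum_mul_sum]
    congr 1
    exact Finset.sum_comm
  rw [h]
  simp only [quad_comm, Finset.sum_sub_distrib]
  congr 1
  · by_cases hbc : b = c
    · subst hbc; simp [gammaE]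
    · have : ¬ c = b := fun h => hbc h.symm
      simp [hbc, this]
  · by_cases had : a = d
    · subst had; simp [gammaE]
    · simp [had]

theorem unitU_comm {m : ℕ} (a b c d : Fin m) :
    unitU a b * unitU c d - unitU c d * unitU a b
      = (if b = c then unitU a d else 0) - (if a = d then unitU c b else 0) := by
  have h := (UniversalEnvelopingAlgebra.ι ℂ (L := Matrix (Fin m) (Fin m) ℂ)).map_lie
    (Matrix.single a b (1 : ℂ)) (Matrix.single c d (1 : ℂ))
  rw [LieRing.of_associative_ring_bracket, LieRing.of_associative_ring_bracket] at h
  unfold unitU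
  rw [← h, map_sub]
  congr 1
  · by_cases hbc : b = c
    · subst hbc; simp
    · simp [hbc]
  · by_cases had : a = d
    · subst had; simp
    · have : ¬ d = a := fun h => had h.symm
      simp [had, this]

/-! ## The algebra `A` -/

/-- The associative algebra `A = U(gl_m) ⊗ GD(ℂ^m ⊗ ℂ^n)`, into which `gl_m` is embedded
diagonally, see `diagE`. -/
def AlgA (m n : ℕ) : Type := Ugl m ⊗[ℂ] GD m n

instance (m n : ℕ) : Ring (AlgA m n) := inferInstanceAs (Ring (Ugl m ⊗[ℂ] GD m n))
instance (m n : ℕ) : Algebra ℂ (AlgA m n) := inferInstanceAs (Algebra ℂ (Ugl m ⊗[ℂ] GD m n))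

/-- A decomposable tensor, as an element of `A`. -/
def tmulA {m n : ℕ} (u : Ugl m) (T : GD m n) : AlgA m n := u ⊗ₜ[ℂ] T

/-- The diagonally embedded matrix unit `E_{ab} ⊗ 1 + 1 ⊗ γ(E_{ab})`. -/
def diagE (n : ℕ) {m : ℕ} (a b : Fin m) : AlgA m n :=
  tmulA (unitU a b) 1 + tmulA 1 (gammaE n a b)

theorem diagE_comm (n : ℕ) {m : ℕ} (a b c d : Fin m) :
    diagE n a b * diagE n c d - diagE n c d * diagE n a b
      = (if b = c then diagE n a d else 0) - (if a = d then diagE n c b else 0) := by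
  have hm : ∀ (u u' : Ugl m) (T T' : GD m n),
      tmulA u T * tmulA u' T' = tmulA (u * u') (T * T') :=
    fun u u' T T' => Algebra.TensorProduct.tmul_mul_tmul u u' T T'
  have hU : tmulA (unitU a b * unitU c d) (1 : GD m n)
        - tmulA (unitU c d * unitU a b) (1 : GD m n)
      = (if b = c then tmulA (unitU a d) (1 : GD m n) else 0)
        - (if a = d then tmulA (unitU c b) (1 : GD m n) else 0) := by
    have : tmulA (unitU a b * unitU c d) (1 : GD m n)
        - tmulA (unitU c d * unitU a b) (1 : GD m n)
        = tmulA (unitU a b * unitU c d - unitU c d * unitU a b) (1 : GD m n) :=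
      (TensorProduct.sub_tmul _ _ _).symm
    rw [this, unitU_comm]
    refine (TensorProduct.sub_tmul _ _ _).trans (congrArg₂ (fun x y : AlgA m n => x - y) ?_ ?_)
    all_goals split_ifs <;> first | rfl | exact TensorProduct.zero_tmul _ _
  have hG : tmulA (1 : Ugl m) (gammaE n a b * gammaE n c d)
        - tmulA (1 : Ugl m) (gammaE n c d * gammaE n a b)
      = (if b = c then tmulA (1 : Ugl m) (gammaE n a d) else 0)
        - (if a = d then tmulA (1 : Ugl m) (gammaE n c b) else 0) := by
    have : tmulA (1 : Ugl m) (gammaE n a b * gammaE n c d)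
        - tmulA (1 : Ugl m) (gammaE n c d * gammaE n a b)
        = tmulA (1 : Ugl m) (gammaE n a b * gammaE n c d - gammaE n c d * gammaE n a b) :=
      (TensorProduct.tmul_sub _ _ _).symm
    rw [this, gammaE_comm]
    refine (TensorProduct.tmul_sub _ _ _).trans (congrArg₂ (fun x y : AlgA m n => x - y) ?_ ?_)
    all_goals split_ifs <;> first | rfl | exact TensorProduct.tmul_zero _ _
  have key : diagE n a b * diagE n c d - diagE n c d * diagE n a b
      = (tmulA (unitU a b * unitU c d) (1 : GD m n)
          - tmulA (unitU c d * unitU a b) (1 : GD m n))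
        + (tmulA (1 : Ugl m) (gammaE n a b * gammaE n c d)
          - tmulA (1 : Ugl m) (gammaE n c d * gammaE n a b)) := by
    simp only [diagE, add_mul, mul_add, hm, mul_one, one_mul]
    abel
  rw [key, hU, hG]
  simp only [diagE]
  split_ifs <;> abel

/-- The permutation action on `U(gl_m)`: `σ : E_{ab} ↦ E_{σ(a)σ(b)}`. -/
def permU {m : ℕ} (σ : Equiv.Perm (Fin m)) : Ugl m →ₐ[ℂ] Ugl m :=
  UniversalEnvelopingAlgebra.lift ℂ
    ((UniversalEnvelopingAlgebra.ι ℂ).comp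
      (Matrix.reindexLieEquiv (R := ℂ) σ).toLieHom)

/-- The automorphism `x_{ai} ↦ x_{σ(a)i}` of the Grassmann algebra. -/
def permGrass (n : ℕ) {m : ℕ} (σ : Equiv.Perm (Fin m)) : Grass m n →ₐ[ℂ] Grass m n :=
  ExteriorAlgebra.map
    (LinearMap.funLeft ℂ ℂ (fun p : Fin m × Fin n => (σ.symm p.1, p.2)))

/-- The permutation action on `GD`, by conjugation; it sends `x_{ai}` to `x_{σ(a)i}` and
`∂_{bj}` to `∂_{σ(b)j}`. -/
def permGD (n : ℕ) {m : ℕ} (σ : Equiv.Perm (Fin m)) : GD m n →ₗ[ℂ] GD m n :=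
  LinearMap.mulLeft ℂ ((permGrass n σ).toLinearMap : GD m n) ∘ₗ
    LinearMap.mulRight ℂ ((permGrass n σ.symm).toLinearMap : GD m n)

/-- The permutation action on `A`. -/
def permA (n : ℕ) {m : ℕ} (σ : Equiv.Perm (Fin m)) : AlgA m n →ₗ[ℂ] AlgA m n :=
  TensorProduct.map (permU σ).toLinearMap (permGD n σ)

/-! ## Fractions -/

/-- The polynomial ring `U(h) = S(h)`; the variable `X a` is the element `E_{aa}`. The value of
a polynomial at a weight `μ` is its evaluation at the labels of `μ`. -/
abbrev Uh (m : ℕ) : Type := MvPolynomial (Fin m) ℂ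

theorem diagE_diag_comm (n : ℕ) {m : ℕ} (a b : Fin m) :
    diagE n a a * diagE n b b = diagE n b b * diagE n a a := by
  have h := diagE_comm n a a b b
  rw [← sub_eq_zero, h]
  by_cases hab : a = b
  · subst hab; simp
  · simp [hab]

/-- The embedding `U(h) → A` with `X a ↦ E_{aa}` (diagonally embedded). -/
def cartanHom (m n : ℕ) : Uh m →ₐ[ℂ] AlgA m n :=
  let s : Set (AlgA m n) := Set.range fun a : Fin m => diagE n a a
  have hs : IsMulCommutative (Algebra.adjoin ℂ s) :=
    Algebra.isMulCommutative_adjoin ℂ (by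
      rintro _ ⟨a, rfl⟩ _ ⟨b, rfl⟩
      exact diagE_diag_comm n a b)
  letI : CommRing (Algebra.adjoin ℂ s) :=
    { (inferInstance : Ring (Algebra.adjoin ℂ s)) with mul_comm := fun x y => mul_comm' x y }
  (Algebra.adjoin ℂ s).val.comp
    (MvPolynomial.aeval fun a : Fin m =>
      (⟨diagE n a a, Algebra.subset_adjoin ⟨a, rfl⟩⟩ : Algebra.adjoin ℂ s))

/-- `A` as a left `U(h)`-module, through left multiplication. -/
instance (m n : ℕ) : Module (Uh m) (AlgA m n) :=
  Module.compHom (AlgA m n) (cartanHom m n).toRingHom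

theorem uh_smul_def {m n : ℕ} (p : Uh m) (Y : AlgA m n) : p • Y = cartanHom m n p * Y := rfl

instance (m n : ℕ) : IsScalarTower ℂ (Uh m) (AlgA m n) where
  smul_assoc z p Y := by
    rw [uh_smul_def, uh_smul_def, map_smul, smul_mul_assoc]

/-- The multiplicative set generated by the denominators `E_{aa} - E_{bb} + z`, `a ≠ b`,
`z ∈ ℤ`. -/
def denoms (m : ℕ) : Submonoid (Uh m) :=
  Submonoid.closure {p | ∃ (a b : Fin m) (z : ℤ), a ≠ b ∧
    p = MvPolynomial.X a - MvPolynomial.X b + MvPolynomial.C (z : ℂ)}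

/-- The ring of fractions of `U(h)`. -/
abbrev UhBar (m : ℕ) : Type := Localization (denoms m)

/-- The fractions `s⁻¹ Y` with `Y` in `A` and `s` a denominator. Since `A` satisfies the Ore
condition, these are the elements of the ring of fractions of `A`; only the left module structure
over the ring of fractions of `U(h)` and the map `toBar` from `A` are needed. -/
abbrev ABar (m n : ℕ) : Type := LocalizedModule (denoms m) (AlgA m n)

/-- The natural map from `A` to its fractions. -/
def toBar {m n : ℕ} (Y : AlgA m n) : ABar m n := LocalizedModule.mk Y 1

/-- The right ideal `J` of `A` generated by `n = span {E_{ba} | a < b}`. -/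
def idealJ (m n : ℕ) : Submodule (AlgA m n)ᵐᵒᵖ (AlgA m n) :=
  Submodule.span (AlgA m n)ᵐᵒᵖ {Y | ∃ a b : Fin m, a < b ∧ Y = diagE n b a}

/-- `J̄`, generated by `J` over the ring of fractions of `U(h)`. -/
def idealJBar (m n : ℕ) : Submodule (UhBar m) (ABar m n) :=
  Submodule.span (UhBar m) (toBar '' (idealJ m n : Set (AlgA m n)))

/-- The left ideal `I_κ` of `A` generated by `E_{ab}` with `a < b`, by `E_{aa} - κ_a`, and by all
`∂_{bk}`. -/
def idealI (n : ℕ) {m : ℕ} (κ : Fin m → ℂ) : Submodule (AlgA m n) (AlgA m n) :=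
  Submodule.span (AlgA m n)
    ({Y | ∃ a b : Fin m, a < b ∧ Y = diagE n a b} ∪
      {Y | ∃ a : Fin m, Y = diagE n a a - algebraMap ℂ (AlgA m n) (κ a)} ∪
      {Y | ∃ (b : Fin m) (k : Fin n), Y = tmulA 1 (opD b k)})

/-- `Ī_κ`, generated by `I_κ` over the ring of fractions of `U(h)`. -/
def idealIBar (n : ℕ) {m : ℕ} (κ : Fin m → ℂ) : Submodule (UhBar m) (ABar m n) :=
  Submodule.span (UhBar m) (toBar '' (idealI n κ : Set (AlgA m n)))

/-- The quotient `J̄ \ Ā`. -/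
abbrev JBarQuot (m n : ℕ) : Type := ABar m n ⧸ idealJBar m n

/-- The quotient `J̄ \ Ā / Ī_κ`. -/
abbrev DoubleQuot (n : ℕ) {m : ℕ} (κ : Fin m → ℂ) : Type :=
  ABar m n ⧸ (idealJBar m n ⊔ idealIBar n κ)

/-- The projection from `J̄ \ Ā` to `J̄ \ Ā / Ī_κ`. -/
def toDouble (n : ℕ) {m : ℕ} (κ : Fin m → ℂ) : JBarQuot m n →ₗ[UhBar m] DoubleQuot n κ :=
  Submodule.factor le_sup_left

/-! ## Zhelobenko operators -/

/-- The indices of the simple root number `c`. -/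
def lo {m : ℕ} (c : Fin (m - 1)) : Fin m := ⟨c, by omega⟩
/-- The indices of the simple root number `c`. -/
def hi {m : ℕ} (c : Fin (m - 1)) : Fin m := ⟨c + 1, by omega⟩

/-- The transposition `σ_c` of `c` and `c + 1`. -/
def simpleRefl {m : ℕ} (c : Fin (m - 1)) : Equiv.Perm (Fin m) := Equiv.swap (lo c) (hi c)

/-- The label number `a` of the simple root `ε_c`. -/
def simpleRoot {m : ℕ} (c : Fin (m - 1)) (a : Fin m) : ℤ :=
  (if a = lo c then 1 else 0) - (if a = hi c then 1 else 0)

/-- `H_c^{(s)} = H_c (H_c - 1) ⋯ (H_c - s + 1)`, where `H_c = E_{cc} - E_{c+1,c+1}`. -/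
def fallH {m : ℕ} (c : Fin (m - 1)) (s : ℕ) : denoms m :=
  ∏ r ∈ Finset.range s,
    ⟨MvPolynomial.X (lo c) - MvPolynomial.X (hi c) + MvPolynomial.C (((-(r : ℤ)) : ℤ) : ℂ),
      Submonoid.subset_closure ⟨lo c, hi c, -(r : ℤ), by simp [lo, hi, Fin.ext_iff], rfl⟩⟩

/-- The adjoint action of `F_c = E_{c+1,c}` on `A`. -/
def adF {m n : ℕ} (c : Fin (m - 1)) (Y : AlgA m n) : AlgA m n :=
  diagE n (hi c) (lo c) * Y - Y * diagE n (hi c) (lo c)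

/-- The map `ξ_c : A → Ā`, `Y ↦ ∑_s (s! H_c^{(s)})⁻¹ E_c^s F̂_c^s(Y)`. Only finitely many terms of
the sum are not zero. -/
def xi {m n : ℕ} (c : Fin (m - 1)) (Y : AlgA m n) : ABar m n :=
  ∑ᶠ s : ℕ, LocalizedModule.mk
    (((s.factorial : ℂ)⁻¹) • (diagE n (lo c) (hi c) ^ s * (adF c)^[s] Y)) (fallH c s)

/-- The action of a permutation on `U(h)`: `(σX)(μ) = X(σ⁻¹ μ)`. -/
def permUh {m : ℕ} (σ : Equiv.Perm (Fin m)) : Uh m →ₐ[ℂ] Uh m := MvPolynomial.rename σ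

/-- The substitution `X ↦ Z` on `U(h)`, where `Z(μ) = X(μ + ε_c)`. -/
def shiftUh {m : ℕ} (c : Fin (m - 1)) : Uh m →ₐ[ℂ] Uh m :=
  MvPolynomial.aeval fun a => MvPolynomial.X a + MvPolynomial.C (simpleRoot c a : ℂ)

theorem permUh_denoms {m : ℕ} (σ : Equiv.Perm (Fin m)) :
    denoms m ≤ (denoms m).comap (permUh σ).toRingHom := by
  refine Submonoid.closure_le.2 ?_
  rintro _ ⟨a, b, z, hab, rfl⟩
  refine Submonoid.subset_closure ⟨σ a, σ b, z, fun h => hab (σ.injective h), ?_⟩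
  simp [permUh]

theorem shiftUh_denoms {m : ℕ} (c : Fin (m - 1)) :
    denoms m ≤ (denoms m).comap (shiftUh c).toRingHom := by
  refine Submonoid.closure_le.2 ?_
  rintro _ ⟨a, b, z, hab, rfl⟩
  refine Submonoid.subset_closure
    ⟨a, b, z + simpleRoot c a - simpleRoot c b, hab, ?_⟩
  simp only [shiftUh, AlgHom.toRingHom_eq_coe, RingHom.coe_coe, map_add, map_sub,
    MvPolynomial.aeval_X, MvPolynomial.algHom_C, MvPolynomial.algebraMap_eq]
  push_cast
  simp only [map_add, map_sub]
  ring

/-- The ring endomorphism `X ↦ Z` of the ring of fractions of `U(h)`, where `Z(μ) = X'(μ + ε_c)`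
with `X' = σ_c X`. -/
def twist {m : ℕ} (c : Fin (m - 1)) : UhBar m →+* UhBar m :=
  (IsLocalization.map (UhBar m) (shiftUh c).toRingHom (shiftUh_denoms c)).comp
    (IsLocalization.map (UhBar m) (permUh (simpleRefl c)).toRingHom
      (permUh_denoms (simpleRefl c)))

/-- `f` is the Zhelobenko operator `ξ̌_c` on `J̄ \ Ā`: it sends the class of `X Y` to the class of
`Z ξ_c(σ_c(Y))` for every `Y` in `A` and every fraction `X` of elements of `U(h)`, where
`Z(μ) = (σ_c X)(μ + ε_c)`. -/
def IsZhelobenko {m : ℕ} (n : ℕ) (c : Fin (m - 1))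
    (f : JBarQuot m n →ₛₗ[twist c] JBarQuot m n) : Prop :=
  ∀ Y : AlgA m n,
    f ((idealJBar m n).mkQ (toBar Y))
      = (idealJBar m n).mkQ (xi c (permA n (simpleRefl c) Y))

/-- The composition `ξ̌_{c_1} ⋯ ξ̌_{c_K}` along a word `c_1, …, c_K`. -/
def zhelWord {m n : ℕ}
    (ξ : (c : Fin (m - 1)) → (JBarQuot m n →ₛₗ[twist c] JBarQuot m n)) :
    List (Fin (m - 1)) → JBarQuot m n → JBarQuot m n
  | [], y => y
  | c :: w, y => ξ c (zhelWord ξ w y)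

/-- The word `c_1, …, c_K` is a reduced decomposition `σ = σ_{c_1} ⋯ σ_{c_K}`. -/
def IsReducedWord {m : ℕ} (w : List (Fin (m - 1))) (σ : Equiv.Perm (Fin m)) : Prop :=
  (w.map simpleRefl).prod = σ ∧
    ∀ w' : List (Fin (m - 1)), (w'.map simpleRefl).prod = σ → w.length ≤ w'.length

/-! ## Verma modules and coinvariants -/

/-- The left ideal of `U(gl_m)` generated by `E_{ab}` with `a < b` and by `E_{aa} - κ_a`. -/
def vermaIdeal {m : ℕ} (κ : Fin m → ℂ) : Submodule (Ugl m) (Ugl m) :=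
  Submodule.span (Ugl m)
    ({u | ∃ a b : Fin m, a < b ∧ u = unitU a b} ∪
      {u | ∃ a : Fin m, u = unitU a a - algebraMap ℂ (Ugl m) (κ a)})

/-- The Verma module `M_κ`. -/
abbrev Verma {m : ℕ} (κ : Fin m → ℂ) : Type := Ugl m ⧸ vermaIdeal κ

/-- The space `M_κ ⊗ Λ(ℂ^m ⊗ ℂ^n)`. -/
abbrev VermaGrass (n : ℕ) {m : ℕ} (κ : Fin m → ℂ) : Type := Verma κ ⊗[ℂ] Grass m n

/-- The action of `A` on `M_κ ⊗ Λ(ℂ^m ⊗ ℂ^n)`. -/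
def act (n : ℕ) {m : ℕ} (κ : Fin m → ℂ) : AlgA m n →ₐ[ℂ] Module.End ℂ (VermaGrass n κ) :=
  (Module.endTensorEndAlgHom (R := ℂ) (S := ℂ) (A := ℂ) (M := Verma κ) (N := Grass m n)).comp
    (Algebra.TensorProduct.map (Algebra.lsmul ℂ ℂ (Verma κ)) (AlgHom.id ℂ (GD m n)))

/-- The subspace `n · (M_κ ⊗ Λ)`. -/
def nSub (n : ℕ) {m : ℕ} (κ : Fin m → ℂ) : Submodule ℂ (VermaGrass n κ) :=
  Submodule.span ℂ {v | ∃ (a b : Fin m) (w : VermaGrass n κ),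
    a < b ∧ v = act n κ (diagE n b a) w}

/-- The space `(M_κ ⊗ Λ)_n` of `n`-coinvariants. -/
abbrev Coinv (n : ℕ) {m : ℕ} (κ : Fin m → ℂ) : Type := VermaGrass n κ ⧸ nSub n κ

theorem span_le_comap_aux {m : ℕ} {A V : Type*} [Ring A] [Algebra ℂ A] [AddCommGroup V]
    [Module ℂ V] (f : A →ₐ[ℂ] Module.End ℂ V) (E : Fin m → Fin m → A)
    (hE : ∀ a b c d, E a b * E c d - E c d * E a b
      = (if b = c then E a d else 0) - (if a = d then E c b else 0)) (c : Fin m) :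
    Submodule.span ℂ {v : V | ∃ (a b : Fin m) (w : V), a < b ∧ v = f (E b a) w}
      ≤ (Submodule.span ℂ {v : V | ∃ (a b : Fin m) (w : V), a < b ∧ v = f (E b a) w}).comap
        (f (E c c)) := by
  set S := Submodule.span ℂ {v : V | ∃ (a b : Fin m) (w : V), a < b ∧ v = f (E b a) w} with hS
  rw [hS, Submodule.span_le]
  rintro _ ⟨a, b, w, hab, rfl⟩
  have h' : E c c * E b a = E b a * E c c
      + ((if c = b then E c a else 0) - (if c = a then E b c else 0)) := by
    rw [← hE]; abel
  change f (E c c) (f (E b a) w) ∈ S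
  rw [← Module.End.mul_apply, ← map_mul, h', map_add, map_sub, map_mul]
  have key : ∀ w' : V, f (E b a) w' ∈ S :=
    fun w' => Submodule.subset_span ⟨a, b, w', hab, rfl⟩
  refine Submodule.add_mem _ (key _) (Submodule.sub_mem _ ?_ ?_)
  · by_cases hcb : c = b
    · rw [if_pos hcb, hcb]; exact key w
    · rw [if_neg hcb, map_zero]; exact Submodule.zero_mem _
  · by_cases hca : c = a
    · rw [if_pos hca, hca]; exact key w
    · rw [if_neg hca, map_zero]; exact Submodule.zero_mem _

theorem nSub_le_comap (n : ℕ) {m : ℕ} (κ : Fin m → ℂ) (c : Fin m) :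
    nSub n κ ≤ (nSub n κ).comap (act n κ (diagE n c c)) :=
  span_le_comap_aux (act n κ) (fun a b => diagE n a b) (diagE_comm n) c

/-- The action of `E_{aa}` on the coinvariants. -/
def cartanAct (n : ℕ) {m : ℕ} (κ : Fin m → ℂ) (a : Fin m) : Module.End ℂ (Coinv n κ) :=
  (nSub n κ).mapQ (nSub n κ) (act n κ (diagE n a a)) (nSub_le_comap n κ a)

/-- The subspace `(M_κ ⊗ Λ)_n^λ` of vectors of weight `λ`. -/
def weightSub (n : ℕ) {m : ℕ} (κ lam : Fin m → ℂ) : Submodule ℂ (Coinv n κ) :=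
  ⨅ a : Fin m, Module.End.eigenspace (cartanAct n κ a) (lam a)

/-- The vector `1_κ ⊗ w`. -/
def hwTensor {n m : ℕ} (κ : Fin m → ℂ) (w : Grass m n) : VermaGrass n κ :=
  (vermaIdeal κ).mkQ 1 ⊗ₜ[ℂ] w

/-- The element `w_ν = (x_{11} ⋯ x_{1ν_1}) ⋯ (x_{m1} ⋯ x_{mν_m})`. -/
def wVec {m n : ℕ} (ν : Fin m → Fin (n + 1)) : Grass m n :=
  (List.ofFn fun a : Fin m =>
    (List.ofFn fun k : Fin (ν a : ℕ) =>
      gvar a (Fin.castLE (Nat.le_of_lt_succ (ν a).isLt) k)).prod).prod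

/-- The vector `v_κ^{κ+ν}`, that is the class of `1_κ ⊗ w_ν` in the coinvariants. -/
def vVec {m n : ℕ} (κ : Fin m → ℂ) (ν : Fin m → Fin (n + 1)) : Coinv n κ :=
  (nSub n κ).mkQ (hwTensor κ (wVec ν))

/-- `Φ` is the identification of `J̄ \ Ā / Ī_κ` with the coinvariants of `M_κ ⊗ Λ`: the class of
`Y` in `A` goes to the class of `Y (1_κ ⊗ 1)`. -/
def IsIdentification (n : ℕ) {m : ℕ} (κ : Fin m → ℂ)
    (Φ : DoubleQuot n κ ≃ₗ[ℂ] Coinv n κ) : Prop :=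
  ∀ Y : AlgA m n,
    Φ ((idealJBar m n ⊔ idealIBar n κ).mkQ (toBar Y))
      = (nSub n κ).mkQ (act n κ Y (hwTensor κ 1))

/-! ## The Yangian -/

/-- The generator `T_{ij}^{(r)}` in the free algebra, with `T_{ij}^{(0)} = δ_{ij}`; the free
generator `(s, i, j)` is `T_{ij}^{(s+1)}`. -/
def freeT {n : ℕ} (r : ℕ) (i j : Fin n) : FreeAlgebra ℂ (ℕ × Fin n × Fin n) :=
  match r with
  | 0 => if i = j then 1 else 0
  | s + 1 => FreeAlgebra.ι ℂ (s, i, j)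

/-- The coefficients at `u^{-r} v^{-s}` of the defining relations
`(u - v) [T_{ij}(u), T_{kl}(v)] = T_{kj}(u) T_{il}(v) - T_{kj}(v) T_{il}(u)`. -/
inductive YangRel (n : ℕ) :
    FreeAlgebra ℂ (ℕ × Fin n × Fin n) → FreeAlgebra ℂ (ℕ × Fin n × Fin n) → Prop
  | rel (r s : ℕ) (i j k l : Fin n) :
    YangRel n
      ((freeT (r + 1) i j * freeT s k l - freeT s k l * freeT (r + 1) i j)
        - (freeT r i j * freeT (s + 1) k l - freeT (s + 1) k l * freeT r i j))
      (freeT r k j * freeT s i l - freeT s k j * freeT r i l)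

/-- The Yangian `Y(gl_n)`. -/
abbrev Yangian (n : ℕ) : Type := RingQuot (YangRel n)

/-- The generator `T_{ij}^{(r)}` of the Yangian. -/
def yangT {n : ℕ} (r : ℕ) (i j : Fin n) : Yangian n :=
  RingQuot.mkAlgHom ℂ (YangRel n) (freeT r i j)

/-- The element
`∑_{c_0, …, c_s} E_{c_1 c_0} E_{c_2 c_1} ⋯ E_{c_s c_{s-1}} ⊗ x_{c_0 i} ∂_{c_s j}` of `A`, by which
`T_{ij}^{(s+1)}` acts. -/
def yangElt (m : ℕ) {n : ℕ} (s : ℕ) (i j : Fin n) : AlgA m n :=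
  ∑ c : Fin (s + 1) → Fin m,
    tmulA (List.ofFn fun t : Fin s => unitU (c t.succ) (c t.castSucc)).prod
      (opX (c 0) i * opD (c (Fin.last s)) j)

/-- `ρ` is the action of the Yangian on the coinvariants of `M_κ ⊗ Λ`. -/
def IsYangianAction (n : ℕ) {m : ℕ} (κ : Fin m → ℂ)
    (ρ : Yangian n →ₐ[ℂ] Module.End ℂ (Coinv n κ)) : Prop :=
  ∀ (s : ℕ) (i j : Fin n) (w : VermaGrass n κ),
    ρ (yangT (s + 1) i j) ((nSub n κ).mkQ w) = (nSub n κ).mkQ (act n κ (yangElt m s i j) w)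

/-! ## Weights -/

/-- `κ_a - κ_b ∉ ℤ` whenever `a ≠ b`. -/
def IsGeneric {m : ℕ} (κ : Fin m → ℂ) : Prop :=
  ∀ a b : Fin m, a ≠ b → ∀ z : ℤ, κ a - κ b ≠ (z : ℂ)

/-- The weight `ρ = (0, -1, …, 1 - m)`. -/
def rhoWt {m : ℕ} (a : Fin m) : ℂ := -((a : ℕ) : ℂ)

/-- The shifted action `σ ∘ κ = σ(κ + ρ) - ρ`. -/
def dot {m : ℕ} (σ : Equiv.Perm (Fin m)) (κ : Fin m → ℂ) : Fin m → ℂ :=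
  fun a => κ (σ.symm a) + rhoWt (σ.symm a) - rhoWt a

/-- The product over the inversions of `σ` of the factors `(-1)^{ν_a ν_b}` times
`(λ_a - λ_b - a + b) / (μ_a - μ_b - a + b)` if `ν_a < ν_b`, and times `1` otherwise. -/
def isimProd {m n : ℕ} (σ : Equiv.Perm (Fin m)) (μ lam : Fin m → ℂ) (ν : Fin m → Fin (n + 1)) :
    ℂ :=
  ∏ p ∈ (Finset.univ : Finset (Fin m × Fin m)).filter
      (fun p => p.1 < p.2 ∧ σ p.2 < σ p.1),
    (-1 : ℂ) ^ ((ν p.1 : ℕ) * (ν p.2 : ℕ)) *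
      (if ν p.1 < ν p.2 then
        (lam p.1 - lam p.2 - ((p.1 : ℕ) : ℂ) + ((p.2 : ℕ) : ℂ)) /
          (μ p.1 - μ p.2 - ((p.1 : ℕ) : ℂ) + ((p.2 : ℕ) : ℂ))
      else 1)

/-- `I` is the linear map between the coinvariants of `M_μ ⊗ Λ` and of `M_κ ⊗ Λ` which is induced
by the operator `g` on `J̄ \ Ā`, through the identifications `Φ` and `Ψ`. -/
def IsInducedBy {n m : ℕ} {μ κ : Fin m → ℂ} (g : JBarQuot m n → JBarQuot m n)
    (Φ : DoubleQuot n μ ≃ₗ[ℂ] Coinv n μ) (Ψ : DoubleQuot n κ ≃ₗ[ℂ] Coinv n κ)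
    (I : Coinv n μ →ₗ[ℂ] Coinv n κ) : Prop :=
  ∀ y : JBarQuot m n, I (Φ (toDouble n μ y)) = Ψ (toDouble n κ (g y))

end

end KNYang

namespace KNYang

open scoped TensorProduct

noncomputable section

attribute [local instance 100] LieRing.ofAssociativeRing

section

/-! ## The rank one series -/

/-! Each Zhelobenko operator is built from a single `sl_2`-triple E, F, H, so the core is a calculus
for the series ∑ c_s E^s (ad F)^s Y in a quotient where F·A vanishes and left multiplication by H is
a scalar h. There E^(s+1) F Y reduces to (s+1)(h-s) E^s Y (`π_E_pow_F`), and this scalar is exactly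
the ratio of consecutive denominators. Hence the series of EY and of YF telescope to zero, while a
Cartan factor on the left or on the right comes out with its value shifted by that of ε_c
(`series_E`, `series_mul_F`, `series_left`, `series_right`). Local nilpotency of ad F makes all the
sums finite.

The reflection σ_c turns F into E and permutes the other negative root vectors, whose right ideal is
stable under E and ad F; so ξ_c σ_c kills J modulo J̄ and the operator exists
(`existsUnique_zhelobenko`). Dually σ_c turns E into F, and the shift by ε_c is the ρ-correction in
the dot action, so I_κ is killed modulo J̄ + Ī for the weight σ_c ∘ κ (`series_permA_idealI`). The
operator therefore descends to the double quotients.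

These are the coinvariants: I_κ is the annihilator of the cyclic vector 1_κ ⊗ 1
(`mem_idealI_of_actOne_eq_zero`, `actOne_mem_idealI`), and for generic κ every denominator acts
invertibly on coinvariants because E_aa - E_bb is diagonalisable there with eigenvalues in κ_a - κ_b
+ ℤ (`isUnit_denom_smul`).

The Yangian maps to A through powers of the matrix of generators of `gl_m`, which obey an RTT-type
relation (`genMat_relation`); the image commutes with the diagonal `gl_m` and is fixed by
permutations, so it passes through every ξ_c (`step_yangAct`).

On w_ν the series is either its zeroth term, when F kills w_ν, or the series of an `sl_2` highest
weight vector, summed in closed form to (h+1)/(h+1-d) (`series_highest`). This yields one factor of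
the product per letter. Along a reduced word each letter adds exactly one inversion
(`isimProd_simpleRefl_mul`, resting on the exchange condition), so the factors multiply to the
product over the inversions of σ. -/

/-- An `sl_2`-triple in a ring `A`, a map `π` from `A` to a module killing `F A` and sending
left multiplication by `H` to the scalar `h`, and inverses `c s` of `s! h (h - 1) ⋯ (h - s + 1)`. -/
structure RankOne (R A Q : Type*) [CommRing R] [Ring A] [AddCommGroup Q] [Module R Q] where
  E : A
  F : A
  H : A
  π : A →+ Q
  h : R
  c : ℕ → R
  EF : E * F - F * E = H
  HE : H * E - E * H = (2 : ℤ) • E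
  HF : H * F - F * H = (-2 : ℤ) • F
  π_F : ∀ Y, π (F * Y) = 0
  π_H : ∀ Y, π (H * Y) = h • π Y
  c_zero : c 0 = 1
  c_succ : ∀ s : ℕ, ((s : R) + 1) * (h - s) * c (s + 1) = c s

namespace RankOne

variable {R A Q : Type*} [CommRing R] [Ring A] [AddCommGroup Q] [Module R Q]
  (D : RankOne R A Q)

/-- The derivation `ad F`. -/
def δ : A →+ A where
  toFun Y := D.F * Y - Y * D.F
  map_zero' := by simp
  map_add' X Y := by rw [mul_add, add_mul]; abel

theorem δ_apply (Y : A) : D.δ Y = D.F * Y - Y * D.F := rfl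

theorem δ_mul (X Y : A) : D.δ (X * Y) = D.δ X * Y + X * D.δ Y := by
  simp only [δ_apply, mul_sub, sub_mul, mul_assoc]; abel

/-- The terms of the series. -/
def term (Y : A) (s : ℕ) : Q := D.c s • D.π (D.E ^ s * D.δ^[s] Y)

/-- The partial sums of the series. -/
def psum (N : ℕ) (Y : A) : Q := ∑ s ∈ Finset.range N, D.term Y s

/-- The series `∑_s c_s π(E^s (ad F)^s Y)`. -/
def series (Y : A) : Q := ∑ᶠ s : ℕ, D.term Y s

variable {D}

theorem iterate_δ_eq_zero {Y : A} {N M : ℕ} (h : D.δ^[N] Y = 0) (hM : N ≤ M) :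
    D.δ^[M] Y = 0 := by
  obtain ⟨k, rfl⟩ := Nat.exists_eq_add_of_le hM
  rw [add_comm, Function.iterate_add_apply, h, iterate_map_zero]

theorem series_eq_psum {Y : A} {N M : ℕ} (h : D.δ^[N] Y = 0) (hM : N ≤ M) :
    D.series Y = D.psum M Y := by
  refine finsum_eq_sum_of_support_subset _ fun s hs => ?_
  simp only [Finset.coe_range, Set.mem_Iio]
  by_contra hle
  refine hs ?_
  change D.term Y s = 0
  rw [term, iterate_δ_eq_zero h (hM.trans (not_lt.1 hle)), mul_zero, map_zero, smul_zero]

/-- By the Leibniz rule each of the p + q derivations falls on one of the two factors, so one of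
them is exhausted. The induction is on p + q. -/
theorem exists_iterate_δ_mul (X Y : A) (hX : ∃ N, D.δ^[N] X = 0) (hY : ∃ N, D.δ^[N] Y = 0) :
    ∃ N, D.δ^[N] (X * Y) = 0 := by
  obtain ⟨p, hp⟩ := hX
  obtain ⟨q, hq⟩ := hY
  suffices ∀ k (X Y : A) p q, D.δ^[p] X = 0 → D.δ^[q] Y = 0 → p + q = k →
      D.δ^[k] (X * Y) = 0 from ⟨p + q, this _ X Y p q hp hq rfl⟩
  intro k
  induction k with
  | zero =>
    intro X Y p q hp hq h
    obtain rfl : p = 0 := by omega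
    simp only [Function.iterate_zero, id_eq] at hp ⊢
    rw [hp, zero_mul]
  | succ k ih =>
    intro X Y p q hp hq h
    rcases Nat.eq_zero_or_pos p with rfl | hp0
    · rw [Function.iterate_zero, id_eq] at hp
      rw [hp, zero_mul, iterate_map_zero]
    rcases Nat.eq_zero_or_pos q with rfl | hq0
    · rw [Function.iterate_zero, id_eq] at hq
      rw [hq, mul_zero, iterate_map_zero]
    obtain ⟨p, rfl⟩ := Nat.exists_eq_succ_of_ne_zero hp0.ne'
    obtain ⟨q, rfl⟩ := Nat.exists_eq_succ_of_ne_zero hq0.ne'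
    rw [Function.iterate_succ_apply, δ_mul, iterate_map_add,
      ih (D.δ X) Y p (q + 1) hp hq (by omega), ih X (D.δ Y) (p + 1) q hp hq (by omega), add_zero]

/-! ### Commutation rules for powers of E and iterates of ad F -/

theorem E_mul_F : D.E * D.F = D.F * D.E + D.H := by rw [← D.EF]; abel

theorem mul_E_pow {G : A} {e : ℤ} (hE : G * D.E - D.E * G = e • D.E) (s : ℕ) :
    D.E ^ s * G = G * D.E ^ s - (s * e : ℤ) • D.E ^ s := by
  have h1 : D.E * G = G * D.E - e • D.E := by rw [← hE]; abel
  induction s with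
  | zero => simp
  | succ s ih =>
    rw [pow_succ, mul_assoc, h1, mul_sub, ← mul_assoc, ih, sub_mul, mul_assoc, ← pow_succ]
    simp only [smul_mul_assoc, mul_smul_comm, ← pow_succ]
    push_cast
    module

/-- The usual `sl_2` formula, ordered with F and H on the left, since `π` kills left multiples of F
and reads a leading H as the scalar h. -/
theorem E_pow_mul_F (s : ℕ) :
    D.E ^ (s + 1) * D.F = D.F * D.E ^ (s + 1) + ((s : ℤ) + 1) • (D.H * D.E ^ s)
      - ((s + 1) * s : ℤ) • D.E ^ s := by
  induction s with
  | zero => simp [E_mul_F]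
  | succ s ih =>
    rw [pow_succ, mul_assoc, E_mul_F, mul_add, ← mul_assoc, ih, mul_E_pow D.HE, sub_mul, add_mul]
    simp only [smul_mul_assoc, mul_assoc, ← pow_succ]
    push_cast
    module

/-- The scalar is the factor by which `c (s + 1)` is multiplied to give `c s`. Every telescoping
below comes from this coincidence. -/
theorem π_E_pow_F (s : ℕ) (Y : A) :
    D.π (D.E ^ (s + 1) * (D.F * Y)) = (((s : R) + 1) * (D.h - s)) • D.π (D.E ^ s * Y) := by
  rw [← mul_assoc, E_pow_mul_F, sub_mul, add_mul]
  simp only [map_sub, map_add, smul_mul_assoc, map_zsmul, mul_assoc, D.π_F, D.π_H]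
  module

theorem π_E_pow {G : A} {e : ℤ} {g : R} (hE : G * D.E - D.E * G = e • D.E)
    (hG : ∀ Y, D.π (G * Y) = g • D.π Y) (s : ℕ) (Y : A) :
    D.π (D.E ^ s * (G * Y)) = (g - s * e) • D.π (D.E ^ s * Y) := by
  rw [← mul_assoc, mul_E_pow hE, sub_mul]
  simp only [map_sub, smul_mul_assoc, map_zsmul, mul_assoc, hG]
  module

theorem c_succ_smul (s : ℕ) (q : Q) :
    D.c (s + 1) • (((s : R) + 1) * (D.h - s)) • q = D.c s • q := by
  rw [smul_smul, mul_comm, D.c_succ]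

theorem δ_F : D.δ D.F = 0 := sub_self _

theorem iterate_δ_mul_F (s : ℕ) (Y : A) : D.δ^[s] (Y * D.F) = D.δ^[s] Y * D.F := by
  induction s with
  | zero => rfl
  | succ s ih =>
    rw [Function.iterate_succ_apply', ih, δ_mul, δ_F, mul_zero, add_zero,
      ← Function.iterate_succ_apply' D.δ]

theorem mul_F_eq (Y : A) : Y * D.F = D.F * Y - D.δ Y := by rw [δ_apply]; abel

/-- Here G has ad F-image a multiple of F, and ad F kills F, so only two terms of the Leibniz
expansion survive. -/
theorem iterate_δ_left {G : A} {e : ℤ} (hF : D.F * G - G * D.F = e • D.F) (s : ℕ) (Y : A) :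
    D.δ^[s + 1] (G * Y)
      = G * D.δ^[s + 1] Y + ((s + 1) * e : ℤ) • (D.F * D.δ^[s] Y) := by
  induction s with
  | zero =>
    simp only [Function.iterate_one, zero_add, Function.iterate_zero, id_eq, δ_mul]
    rw [δ_apply, hF, smul_mul_assoc, add_comm]
    simp
  | succ s ih =>
    rw [Function.iterate_succ_apply', ih]
    simp only [map_add, map_zsmul, δ_mul, δ_F, zero_mul, zero_add,
      ← Function.iterate_succ_apply' D.δ]
    rw [δ_apply, hF, smul_mul_assoc]
    push_cast
    module

theorem iterate_δ_right {G : A} {e : ℤ} (hF : D.F * G - G * D.F = e • D.F) (s : ℕ) (Y : A) :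
    D.δ^[s + 1] (Y * G)
      = D.δ^[s + 1] Y * G + ((s + 1) * e : ℤ) • (D.δ^[s] Y * D.F) := by
  induction s with
  | zero =>
    simp only [Function.iterate_one, zero_add, Function.iterate_zero, id_eq, δ_mul]
    rw [D.δ_apply G, hF, mul_smul_comm]
    simp
  | succ s ih =>
    rw [Function.iterate_succ_apply', ih]
    simp only [map_add, map_zsmul, δ_mul, δ_F, mul_zero, add_zero,
      ← Function.iterate_succ_apply' D.δ]
    rw [D.δ_apply G, hF, mul_smul_comm]
    push_cast
    module

/-- Leibniz with δE = -H, δ²E = -2F and δ³E = 0: three terms remain. The index starts at 2 so that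
all of them are present. -/
theorem iterate_δ_E (s : ℕ) (Y : A) :
    D.δ^[s + 2] (D.E * Y) = D.E * D.δ^[s + 2] Y - ((s : ℤ) + 2) • (D.H * D.δ^[s + 1] Y)
      - ((s + 2) * (s + 1) : ℤ) • (D.F * D.δ^[s] Y) := by
  have hE : D.δ D.E = - D.H := by rw [δ_apply, ← D.EF]; abel
  have hH : D.F * D.H - D.H * D.F = (2 : ℤ) • D.F := by
    rw [← neg_sub, D.HF, neg_smul, neg_neg]
  induction s with
  | zero =>
    simp only [Function.iterate_succ_apply, Function.iterate_zero, id_eq, δ_mul, map_add,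
      hE, map_neg, neg_mul]
    rw [D.δ_apply D.H, hH, smul_mul_assoc]
    push_cast
    module
  | succ s ih =>
    rw [Function.iterate_succ_apply', ih]
    simp only [map_sub, map_zsmul, δ_mul, δ_F, zero_mul, zero_add, hE, neg_mul,
      ← Function.iterate_succ_apply' D.δ]
    rw [D.δ_apply D.H, hH, smul_mul_assoc]
    push_cast
    module

/-! ### Telescoping of the partial sums -/

theorem psum_succ (N : ℕ) (Y : A) : D.psum (N + 1) Y = D.psum N Y + D.term Y N :=
  Finset.sum_range_succ _ _

theorem psum_zero (Y : A) : D.psum 0 Y = 0 := rfl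

/-- Consecutive terms cancel and only boundary terms containing δ^N Y or δ^(N+1) Y are left. These
vanish for large N, which is how an exact finite identity yields the vanishing of the series. -/
theorem psum_E (N : ℕ) (Y : A) :
    D.psum (N + 2) (D.E * Y) = D.c (N + 1) • D.π (D.E ^ (N + 2) * D.δ^[N + 1] Y)
      + (((N : R) + 1) * (N + 2) * D.c (N + 1)) • D.π (D.E ^ (N + 1) * D.δ^[N] Y) := by
  have hp : ∀ s Z, D.π (D.E ^ s * (D.E * Z)) = D.π (D.E ^ (s + 1) * Z) := fun s Z => by
    rw [← mul_assoc, ← pow_succ]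
  have hH := D.π_E_pow D.HE D.π_H
  induction N with
  | zero =>
    have hE : D.δ D.E = - D.H := by rw [δ_apply, ← D.EF]; abel
    have h1 := D.c_succ 0
    rw [D.c_zero] at h1
    rw [zero_add, psum_succ, psum_succ, psum_zero, term, term]
    simp only [Function.iterate_one, Function.iterate_zero, id_eq, δ_mul, hE, neg_mul, mul_add,
      mul_neg, map_add, map_neg, zero_add, D.c_zero, pow_zero, one_mul]
    rw [hH, hp]
    simp only [Nat.cast_zero, zero_add, one_mul, sub_zero, pow_one, Nat.cast_one, Int.cast_ofNat]
      at h1 ⊢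
    nth_rewrite 1 [← h1]
    module
  | succ N ih =>
    rw [psum_succ, ih, term, iterate_δ_E]
    simp only [mul_sub, mul_smul_comm, map_sub, map_zsmul, hp, hH, π_E_pow_F]
    have h1 := D.c_succ (N + 1)
    rw [← h1]
    push_cast
    module

/-- Moving G past E^s costs -s·e on the s-th term, while the F-term of δ^(s+1)(GY) collapses onto
the s-th term and returns (s+1)·e. The net shift is e, except for the last term, whose return has
been cut off. -/
theorem psum_left {G : A} {e : ℤ} {g : R} (hE : G * D.E - D.E * G = e • D.E)
    (hF : D.F * G - G * D.F = e • D.F) (hG : ∀ Y, D.π (G * Y) = g • D.π Y) (N : ℕ) (Y : A) :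
    D.psum (N + 1) (G * Y) = (g + e) • D.psum (N + 1) Y
      - (e * ((N : R) + 1) * D.c N) • D.π (D.E ^ N * D.δ^[N] Y) := by
  induction N with
  | zero =>
    simp only [psum_succ, psum_zero, term, D.c_zero, pow_zero, one_mul, Function.iterate_zero,
      id_eq, hG]
    push_cast
    module
  | succ N ih =>
    rw [psum_succ, ih, D.psum_succ (N + 1) Y, term, term, iterate_δ_left hF]
    simp only [mul_add, mul_smul_comm, map_add, map_zsmul, π_E_pow hE hG, π_E_pow_F]
    rw [← D.c_succ N]
    push_cast
    module

/-- Writing Z F = F Z - δZ makes each term a difference of two consecutive quantities. -/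
theorem psum_mul_F (N : ℕ) (Y : A) :
    D.psum (N + 1) (Y * D.F) = - D.c N • D.π (D.E ^ N * D.δ^[N + 1] Y) := by
  induction N with
  | zero =>
    simp only [psum_succ, psum_zero, term, D.c_zero, pow_zero, one_mul, Function.iterate_zero,
      id_eq, mul_F_eq, map_sub, D.π_F, zero_add, Function.iterate_one]
    module
  | succ N ih =>
    rw [psum_succ, ih, term, iterate_δ_mul_F, mul_F_eq, mul_sub, map_sub, π_E_pow_F, smul_sub,
      c_succ_smul, ← Function.iterate_succ_apply' D.δ]
    module

/-- Same bookkeeping as for `psum_left`, but the F produced by Leibniz stands on the right.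
Replacing it by F Z - δZ supplies both the loss -s·e and the return from the next term. -/
theorem psum_right {G : A} {e : ℤ} {k : R} (hF : D.F * G - G * D.F = e • D.F)
    (hG : ∀ Y, D.π (Y * G) = k • D.π Y) (N : ℕ) (Y : A) :
    D.psum (N + 1) (Y * G) = (k + e) • D.psum (N + 1) Y
      - (e * ((N : R) + 1) * D.c N) • D.π (D.E ^ N * D.δ^[N] Y) := by
  induction N with
  | zero =>
    simp only [psum_succ, psum_zero, term, D.c_zero, pow_zero, one_mul, Function.iterate_zero,
      id_eq, hG]
    push_cast
    module
  | succ N ih =>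
    rw [psum_succ, ih, D.psum_succ (N + 1) Y, term, term, iterate_δ_right hF]
    simp only [mul_add, mul_smul_comm, map_add, map_zsmul, mul_F_eq, mul_sub, map_sub, π_E_pow_F]
    rw [← mul_assoc, hG, ← D.c_succ N, ← Function.iterate_succ_apply' D.δ]
    push_cast
    module

/-- A common cutoff N: it kills δ^N Y, hence the boundary terms, and both cutoffs N + 1 and N + 2
used by the closed forms compute the series. -/
theorem series_eq_psum_two (hnil : ∀ Y, ∃ N, D.δ^[N] Y = 0) (X Y : A) :
    ∃ N, D.δ^[N] Y = 0 ∧ D.series X = D.psum (N + 2) X ∧ D.series Y = D.psum (N + 2) Y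
      ∧ D.series X = D.psum (N + 1) X ∧ D.series Y = D.psum (N + 1) Y := by
  obtain ⟨p, hp⟩ := hnil X
  obtain ⟨q, hq⟩ := hnil Y
  exact ⟨p + q, iterate_δ_eq_zero hq (by omega), series_eq_psum hp (by omega),
    series_eq_psum hq (by omega), series_eq_psum hp (by omega), series_eq_psum hq (by omega)⟩

theorem series_E (hnil : ∀ Y, ∃ N, D.δ^[N] Y = 0) (Y : A) : D.series (D.E * Y) = 0 := by
  obtain ⟨N, h0, h1, -, -, -⟩ := series_eq_psum_two hnil (D.E * Y) Y
  rw [h1, psum_E, h0, iterate_δ_eq_zero h0 (Nat.le_succ N)]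
  simp

theorem series_left (hnil : ∀ Y, ∃ N, D.δ^[N] Y = 0) {G : A} {e : ℤ} {g : R}
    (hE : G * D.E - D.E * G = e • D.E) (hF : D.F * G - G * D.F = e • D.F)
    (hG : ∀ Y, D.π (G * Y) = g • D.π Y) (Y : A) :
    D.series (G * Y) = (g + e) • D.series Y := by
  obtain ⟨N, h0, -, -, h1, h2⟩ := series_eq_psum_two hnil (G * Y) Y
  rw [h1, h2, psum_left hE hF hG, h0]
  simp

theorem series_mul_F (hnil : ∀ Y, ∃ N, D.δ^[N] Y = 0) (Y : A) : D.series (Y * D.F) = 0 := by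
  obtain ⟨N, h0, -, -, h1, -⟩ := series_eq_psum_two hnil (Y * D.F) Y
  rw [h1, psum_mul_F, iterate_δ_eq_zero h0 (Nat.le_succ N)]
  simp

theorem series_right (hnil : ∀ Y, ∃ N, D.δ^[N] Y = 0) {G : A} {e : ℤ} {k : R}
    (hF : D.F * G - G * D.F = e • D.F) (hG : ∀ Y, D.π (Y * G) = k • D.π Y) (Y : A) :
    D.series (Y * G) = (k + e) • D.series Y := by
  obtain ⟨N, h0, -, -, h1, h2⟩ := series_eq_psum_two hnil (Y * G) Y
  rw [h1, h2, psum_right hF hG, h0]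
  simp

theorem term_add (X Y : A) (s : ℕ) : D.term (X + Y) s = D.term X s + D.term Y s := by
  simp only [term, iterate_map_add, mul_add, map_add, smul_add]

theorem series_add (hnil : ∀ Y, ∃ N, D.δ^[N] Y = 0) (X Y : A) :
    D.series (X + Y) = D.series X + D.series Y := by
  obtain ⟨p, hp⟩ := hnil X
  obtain ⟨q, hq⟩ := hnil Y
  have h : D.δ^[p + q] (X + Y) = 0 := by
    rw [iterate_map_add, iterate_δ_eq_zero hp (by omega), iterate_δ_eq_zero hq (by omega), add_zero]
  rw [series_eq_psum h le_rfl, series_eq_psum hp (Nat.le_add_right p q),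
    series_eq_psum hq (Nat.le_add_left q p), psum, psum, psum, ← Finset.sum_add_distrib]
  exact Finset.sum_congr rfl fun s _ => term_add X Y s

/-- The series vanishes on a subset stable under `ad F` and under left multiplication by `E` and
killed by `π`. -/
theorem series_eq_zero {K : Set A} (hδ : ∀ Y ∈ K, D.δ Y ∈ K) (hE : ∀ Y ∈ K, D.E * Y ∈ K)
    (hπ : ∀ Y ∈ K, D.π Y = 0) {Y : A} (hY : Y ∈ K) : D.series Y = 0 := by
  have h1 : ∀ s, D.δ^[s] Y ∈ K := fun s => by
    induction s with
    | zero => exact hY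
    | succ s ih => rw [Function.iterate_succ_apply']; exact hδ _ ih
  have h2 : ∀ s, ∀ Z ∈ K, D.E ^ s * Z ∈ K := fun s => by
    induction s with
    | zero => intro Z hZ; rwa [pow_zero, one_mul]
    | succ s ih => intro Z hZ; rw [pow_succ, mul_assoc]; exact ih _ (hE _ hZ)
  refine (finsum_congr fun s => ?_).trans finsum_zero
  rw [term, hπ _ (h2 s _ (h1 s)), smul_zero]

/-! ### Summation of the series on highest weight vectors -/

/-- The product `s! d (d - 1) ⋯ (d - s + 1)`. -/
def weightProd (R : Type*) [CommRing R] (d s : ℕ) : R :=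
  ∏ r ∈ Finset.range s, ((r : R) + 1) * ((d : R) - r)

theorem weightProd_succ (d s : ℕ) :
    weightProd R d (s + 1) = weightProd R d s * (((s : R) + 1) * ((d : R) - s)) :=
  Finset.prod_range_succ _ _

theorem weightProd_eq_zero {d s : ℕ} (h : d < s) : weightProd R d s = 0 :=
  Finset.prod_eq_zero (Finset.mem_range.2 h) (by rw [sub_self, mul_zero])

/-- A Chu–Vandermonde summation with the denominator cleared and with an explicit remainder, which
makes it a one-line induction valid over any commutative ring. The remainder dies once N exceeds d.
-/
theorem mul_sum_weightProd (d N : ℕ) :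
    (D.h + 1 - d) * ∑ s ∈ Finset.range N, weightProd R d s * D.c s
      = D.h + 1 - (D.h + 1 - N) * (weightProd R d N * D.c N) := by
  induction N with
  | zero => simp [weightProd, D.c_zero]
  | succ N ih =>
    rw [Finset.sum_range_succ, mul_add, ih, weightProd_succ, ← D.c_succ N]
    push_cast
    ring

/-- If `Y` behaves as a highest weight vector of weight `d` then the series is
`(h + 1) / (h + 1 - d)`. -/
theorem series_highest (hnil : ∀ Y, ∃ N, D.δ^[N] Y = 0) (d : ℕ) {Y : A}
    (hY : ∀ s, D.π (D.E ^ s * D.δ^[s] Y) = weightProd R d s • D.π Y) :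
    ∃ r : R, D.series Y = r • D.π Y ∧ (D.h + 1 - d) * r = D.h + 1 := by
  obtain ⟨p, hp⟩ := hnil Y
  -- The cutoff is at least p, so the omitted terms of the series are zero, and exceeds d, so the
  -- remainder in `mul_sum_weightProd` is zero.
  refine ⟨∑ s ∈ Finset.range (p + (d + 1)), weightProd R d s * D.c s, ?_, ?_⟩
  · rw [series_eq_psum hp (Nat.le_add_right p (d + 1)), psum, Finset.sum_smul]
    exact Finset.sum_congr rfl fun s _ => by rw [term, hY, smul_smul, mul_comm]
  · rw [mul_sum_weightProd, weightProd_eq_zero (show d < p + (d + 1) by omega)]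
    simp

end RankOne

end

section

/-! ## Semilinear maps out of a localized module -/

/-- Semilinear universal property of localisation: the value on x/s is forced to be φ(1/s) times the
value on x, and the hypothesis on `g` makes this independent of the fraction. The semilinear form is
needed because Zhelobenko operators twist scalars. -/
theorem existsUnique_localizedModule_lift {R : Type*} [CommRing R] (S : Submonoid R)
    {M Q : Type*} [AddCommGroup M] [Module R M] [AddCommGroup Q] [Module (Localization S) Q]
    (φ : Localization S →+* Localization S) (g : M →+ Q)
    (hg : ∀ (r : R) (x : M), g (r • x) = φ (algebraMap R (Localization S) r) • g x) :
    ∃! f : LocalizedModule S M →ₛₗ[φ] Q, ∀ x, f (LocalizedModule.mk x 1) = g x := by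
  have hmk : ∀ (x : M) (s : S), LocalizedModule.mk x s
      = (Localization.mk 1 s : Localization S) • LocalizedModule.mk x 1 := fun x s => by
    rw [LocalizedModule.mk_smul_mk, one_smul, mul_one]
  have hone : ∀ s : S, (Localization.mk 1 s : Localization S)
      * algebraMap R (Localization S) s = 1 := fun s => by
    rw [← Localization.mk_one_eq_algebraMap, Localization.mk_mul, one_mul, mul_one]
    exact Localization.mk_self s
  have hwd : ∀ p p' : M × S, p ≈ p' →
      φ (Localization.mk 1 p.2) • g p.1 = φ (Localization.mk 1 p'.2) • g p'.1 := by
    rintro ⟨x, s⟩ ⟨x', s'⟩ h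
    obtain ⟨u, hu⟩ := h
    -- Equality of fractions holds only after multiplication by some u. Multiplying by
    -- φ(1/u)·φ(1/s)·φ(1/s') removes u and both denominators.
    have h1 := congrArg (fun z => (φ (Localization.mk 1 u) * φ (Localization.mk 1 s)
      * φ (Localization.mk 1 s')) • g z) hu
    simp only [Submonoid.smul_def, hg, smul_smul, ← map_mul] at h1
    have e1 : (Localization.mk 1 u * Localization.mk 1 s * Localization.mk 1 s'
        * algebraMap R (Localization S) u * algebraMap R (Localization S) s' : Localization S)
        = Localization.mk 1 s := by
      linear_combination
          Localization.mk 1 s * (Localization.mk 1 s' * algebraMap R (Localization S) s') * hone u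
            + Localization.mk 1 s * hone s'
    have e2 : (Localization.mk 1 u * Localization.mk 1 s * Localization.mk 1 s'
        * algebraMap R (Localization S) u * algebraMap R (Localization S) s : Localization S)
        = Localization.mk 1 s' := by
      linear_combination
          Localization.mk 1 s' * (Localization.mk 1 s * algebraMap R (Localization S) s) * hone u
            + Localization.mk 1 s' * hone s
    rw [map_mul (algebraMap R (Localization S)), map_mul (algebraMap R (Localization S)),
      ← mul_assoc, ← mul_assoc, e1, e2] at h1
    exact h1
  let F : LocalizedModule S M → Q := fun x =>
    LocalizedModule.liftOn x (fun p => φ (Localization.mk 1 p.2) • g p.1) hwd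
  have hF : ∀ x s, F (LocalizedModule.mk x s) = φ (Localization.mk 1 s) • g x :=
    fun x s => LocalizedModule.liftOn_mk hwd x s
  refine ⟨{ toFun := F, map_add' := ?_, map_smul' := ?_ }, fun x => ?_, fun f hf => ?_⟩
  · intro x y
    induction x, y using LocalizedModule.induction_on₂ with
    | h m m' s s' =>
      rw [LocalizedModule.mk_add_mk, hF, hF, hF, map_add, Submonoid.smul_def,
        Submonoid.smul_def, hg, hg, smul_add, smul_smul, smul_smul, ← map_mul, ← map_mul]
      have e : (Localization.mk 1 (s * s') : Localization S)
          = Localization.mk 1 s * Localization.mk 1 s' := by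
        rw [Localization.mk_mul, one_mul]
      congr 3
      · rw [e]; linear_combination Localization.mk 1 s * hone s'
      · rw [e]; linear_combination Localization.mk 1 s' * hone s
  · intro z x
    induction x using LocalizedModule.induction_on with
    | h m s =>
      induction z using Localization.induction_on with
      | H p =>
        obtain ⟨r, t⟩ := p
        rw [LocalizedModule.mk_smul_mk, hF, hF, hg, smul_smul, smul_smul, ← map_mul, ← map_mul,
          ← Localization.mk_one_eq_algebraMap, Localization.mk_mul, Localization.mk_mul, one_mul,
          mul_one, mul_one]
  · change F (LocalizedModule.mk x 1) = g x
    rw [hF, Localization.mk_one, map_one, one_smul]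
  · ext x
    induction x using LocalizedModule.induction_on with
    | h m s =>
      refine Eq.trans ?_ (hF m s).symm
      rw [hmk, map_smulₛₗ, hf]

/-! ## Words in the adjacent transpositions -/

/-- The exchange condition. -/
theorem exists_shorter_word {m : ℕ} (w : List (Fin (m - 1))) :
    ∀ i j : Fin m, i < j →
      (w.map simpleRefl).prod.symm j < (w.map simpleRefl).prod.symm i →
      ∃ w' : List (Fin (m - 1)), w'.length + 1 = w.length ∧
        (w'.map simpleRefl).prod = Equiv.swap i j * (w.map simpleRefl).prod := by
  induction w with
  | nil => intro i j hij h; exact absurd h (not_lt.2 hij.le)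
  | cons d w ih =>
    intro i j hij h
    set τ := (w.map simpleRefl).prod with hτ
    have hs : ((d :: w).map simpleRefl).prod = simpleRefl d * τ := by simp [hτ]
    rw [hs] at h ⊢
    have hlh : lo d < hi d := by simp [lo, hi, Fin.lt_def]
    change τ.symm ((simpleRefl d).symm j) < τ.symm ((simpleRefl d).symm i) at h
    rw [simpleRefl, Equiv.symm_swap] at h
    -- Either the first letter keeps i, j in order, and the letter to delete lies deeper in the
    -- word, or (i, j) is the pair of that letter and deleting the letter itself works.
    rcases lt_or_ge (Equiv.swap (lo d) (hi d) i) (Equiv.swap (lo d) (hi d) j) with hlt | hge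
    · obtain ⟨w', hw', hp⟩ := ih _ _ hlt h
      refine ⟨d :: w', by simp [hw'], ?_⟩
      simp only [List.map_cons, List.prod_cons, hp, ← mul_assoc]
      congr 1
      rw [simpleRefl, Equiv.mul_swap_eq_swap_mul, Equiv.swap_apply_self, Equiv.swap_apply_self]
    · have hi' : i = lo d ∧ j = hi d := by
        have hne : Equiv.swap (lo d) (hi d) i ≠ Equiv.swap (lo d) (hi d) j :=
          fun e => hij.ne (Equiv.injective _ e)
        have hlt := lt_of_le_of_ne hge hne.symm
        simp only [Equiv.swap_apply_def] at hlt
        simp only [lo, hi, Fin.ext_iff, Fin.lt_def] at *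
        split_ifs at hlt <;> simp_all <;> omega
      obtain ⟨rfl, rfl⟩ := hi'
      refine ⟨w, by simp, ?_⟩
      rw [simpleRefl, ← mul_assoc, Equiv.swap_mul_self, one_mul]

theorem IsReducedWord.tail {m : ℕ} {c : Fin (m - 1)} {w : List (Fin (m - 1))}
    {σ : Equiv.Perm (Fin m)} (h : IsReducedWord (c :: w) σ) :
    IsReducedWord w (w.map simpleRefl).prod := by
  refine ⟨rfl, fun w' hw' => ?_⟩
  have := h.2 (c :: w') (by rw [← h.1, List.map_cons, List.prod_cons, hw']; rfl)
  simpa using this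

/-- In the opposite case the exchange condition would rewrite σ with two letters fewer than the
given word. This is how reducedness enters the product formula: each letter creates a new inversion.
-/
theorem IsReducedWord.symm_lo_lt {m : ℕ} {c : Fin (m - 1)} {w : List (Fin (m - 1))}
    {σ : Equiv.Perm (Fin m)} (h : IsReducedWord (c :: w) σ) :
    (w.map simpleRefl).prod.symm (lo c) < (w.map simpleRefl).prod.symm (hi c) := by
  have hlh : lo c < hi c := by simp [lo, hi, Fin.lt_def]
  by_contra hlt
  have hne : (w.map simpleRefl).prod.symm (lo c) ≠ (w.map simpleRefl).prod.symm (hi c) :=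
    fun e => hlh.ne (Equiv.injective _ e)
  obtain ⟨w', hw', hp⟩ := exists_shorter_word w _ _ hlh (lt_of_le_of_ne (not_lt.1 hlt) hne.symm)
  have := h.2 w' (by rw [hp, ← h.1]; rfl)
  simp only [List.length_cons] at this
  omega

/-! ## Signs of the products of anticommuting elements -/

theorem prod_mul_anticomm {A : Type*} [Ring A] (l : List A) (y : A)
    (h : ∀ x ∈ l, x * y = - (y * x)) : l.prod * y = (-1) ^ l.length * (y * l.prod) := by
  induction l with
  | nil => simp
  | cons x l ih =>
    have h1 := ih fun z hz => h z (List.mem_cons_of_mem _ hz)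
    have h2 : (-1 : A) ^ l.length * x = x * (-1) ^ l.length :=
      (((Commute.neg_one_left x).pow_left _)).eq
    rw [List.prod_cons, mul_assoc, h1, ← mul_assoc, ← h2, mul_assoc, ← mul_assoc x,
      h x List.mem_cons_self, List.length_cons, pow_succ]
    simp [mul_assoc]

theorem prod_mul_prod_anticomm {A : Type*} [Ring A] (l l' : List A)
    (h : ∀ x ∈ l, ∀ y ∈ l', x * y = - (y * x)) :
    l.prod * l'.prod = (-1) ^ (l.length * l'.length) * (l'.prod * l.prod) := by
  induction l' with
  | nil => simp
  | cons y l' ih =>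
    rw [List.prod_cons, ← mul_assoc,
      prod_mul_anticomm l y fun x hx => h x hx y List.mem_cons_self, mul_assoc, mul_assoc,
      ih fun x hx z hz => h x hx z (List.mem_cons_of_mem _ hz), List.length_cons, mul_add, mul_one,
      pow_add]
    have h2 : y * (-1 : A) ^ (l.length * l'.length) = (-1) ^ (l.length * l'.length) * y :=
      ((Commute.neg_one_right y).pow_right _).eq
    rw [← mul_assoc y, h2]
    have h3 : (-1 : A) ^ l.length * (-1) ^ (l.length * l'.length)
      = (-1) ^ (l.length * l'.length) * (-1) ^ l.length := by rw [← pow_add, ← pow_add, add_comm]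
    simp only [← mul_assoc, h3]

/-- Exchanging two adjacent factors of a product. -/
theorem ofFn_swap_prod {A : Type*} [Ring A] (k : ℕ) : ∀ (m : ℕ) (i j : Fin m) (g : Fin m → A)
    (z : A), (i : ℕ) = k → (j : ℕ) = k + 1 → (∀ x, Commute z x) → g j * g i = z * (g i * g j) →
    (List.ofFn fun a => g (Equiv.swap i j a)).prod = z * (List.ofFn g).prod := by
  induction k with
  | zero =>
    rintro (_ | _ | m) i j g z hi hj hz h
    · exact i.elim0
    · omega
    obtain rfl : i = 0 := Fin.ext hi
    obtain rfl : j = (0 : Fin (m + 1)).succ := Fin.ext hj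
    have hsw : ∀ a : Fin m, Equiv.swap (0 : Fin (m + 2)) (0 : Fin (m + 1)).succ a.succ.succ
        = a.succ.succ := fun a =>
      Equiv.swap_apply_of_ne_of_ne (Fin.succ_ne_zero _) (fun e => by simp [Fin.ext_iff] at e)
    simp only [List.ofFn_succ, List.prod_cons, hsw, Equiv.swap_apply_left, Equiv.swap_apply_right,
      ← mul_assoc]
    rw [h, ← mul_assoc]
  | succ k ih =>
    rintro (_ | m) i j g z hi hj hz h
    · exact i.elim0
    obtain ⟨i, rfl⟩ := Fin.exists_succ_eq.2 (show i ≠ 0 by rintro rfl; simp at hi)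
    obtain ⟨j, rfl⟩ := Fin.exists_succ_eq.2 (show j ≠ 0 by rintro rfl; simp at hj)
    have hsw : ∀ a : Fin m, Equiv.swap i.succ j.succ a.succ = (Equiv.swap i j a).succ := fun a =>
      ((Fin.succ_injective m).swap_apply i j a).symm ▸ rfl
    have h0 : Equiv.swap i.succ j.succ 0 = 0 := Equiv.swap_apply_of_ne_of_ne
      (Fin.succ_ne_zero _).symm (Fin.succ_ne_zero _).symm
    rw [List.ofFn_succ, List.ofFn_succ, List.prod_cons, List.prod_cons, h0]
    simp only [hsw]
    rw [ih m i j (fun a => g a.succ) z (by simpa using hi) (by simpa using hj) hz h, ← mul_assoc,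
      ← (hz _).eq, mul_assoc]

end

section

/-! ## The Grassmann algebra -/

variable {m n : ℕ}

theorem opD_one (a : Fin m) (i : Fin n) : opD a i (1 : Grass m n) = 0 :=
  CliffordAlgebra.contractLeft_one _ _

theorem opX_mul_self (a : Fin m) (i : Fin n) : (opX a i * opX a i : GD m n) = 0 := by
  refine LinearMap.ext fun v => ?_
  change gvar a i * (gvar a i * v) = 0
  rw [← mul_assoc, gvar, ExteriorAlgebra.ι_sq_zero, zero_mul]

theorem gvar_mul_gvar (a b : Fin m) (i j : Fin n) :
    (gvar a i * gvar b j : Grass m n) = - (gvar b j * gvar a i) :=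
  eq_neg_of_add_eq_zero_left (ExteriorAlgebra.ι_add_mul_swap (R := ℂ) _ _)

theorem ι_eq_sum_gvar (x : Fin m × Fin n → ℂ) :
    ExteriorAlgebra.ι ℂ x = ∑ p, x p • (gvar p.1 p.2 : Grass m n) := by
  simp only [gvar, ← map_smul, ← map_sum]
  congr 1
  ext p
  simp [Finset.sum_apply, Pi.single_apply]

theorem grass_induction {P : Grass m n → Prop} (zero : P 0) (one : P 1)
    (add : ∀ v w, P v → P w → P (v + w)) (smul : ∀ (z : ℂ) v, P v → P (z • v))
    (mul : ∀ a i v, P v → P (gvar a i * v)) (v : Grass m n) : P v := by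
  induction v using CliffordAlgebra.left_induction with
  | algebraMap r => rw [Algebra.algebraMap_eq_smul_one]; exact smul _ _ one
  | add x y hx hy => exact add _ _ hx hy
  | ι_mul v x hv =>
    change P (ExteriorAlgebra.ι ℂ x * v)
    rw [ι_eq_sum_gvar, Finset.sum_mul]
    refine Finset.sum_induction _ P add zero fun p _ => ?_
    rw [smul_mul_assoc]
    exact smul _ _ (mul _ _ _ hv)

theorem grass_linearMap_ext {W : Type*} [AddCommGroup W] [Module ℂ W] {f g : Grass m n →ₗ[ℂ] W}
    (one : f 1 = g 1) (mul : ∀ a i v, f v = g v → f (gvar a i * v) = g (gvar a i * v)) : f = g := by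
  refine LinearMap.ext fun v => grass_induction (P := fun v => f v = g v) ?_ one ?_ ?_ mul v
  · rw [map_zero, map_zero]
  · intro v w hv hw; rw [map_add, map_add, hv, hw]
  · intro z v hv; rw [map_smul, map_smul, hv]

theorem opD_gvar_mul (a b : Fin m) (i j : Fin n) (v : Grass m n) :
    opD b j (gvar a i * v) = (if a = b ∧ i = j then v else 0) - gvar a i * opD b j v := by
  have h := LinearMap.congr_fun (opD_mul_opX (m := m) (n := n) a b i j) v
  rw [eq_sub_iff_add_eq]
  refine Eq.trans h ?_
  split_ifs <;> rfl

/-- The projection onto the constants in the variables of a list. -/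
def constProj : List (Fin m × Fin n) → GD m n
  | [] => 1
  | p :: L => opD p.1 p.2 * opX p.1 p.2 * constProj L

theorem constProj_eq_self {v : Grass m n} (h : ∀ b k, opD b k v = 0)
    (L : List (Fin m × Fin n)) : constProj L v = v := by
  induction L with
  | nil => rfl
  | cons p L ih =>
    change opD p.1 p.2 (gvar p.1 p.2 * constProj L v) = v
    rw [ih, opD_gvar_mul, h, if_pos ⟨rfl, rfl⟩, mul_zero, sub_zero]

/-- A variable passes the factors ∂x of the other variables with two sign changes, and is killed by
its own because its square is zero. -/
theorem constProj_gvar_mul (a : Fin m) (i : Fin n) (v : Grass m n) (L : List (Fin m × Fin n)) :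
    constProj L (gvar a i * v) = if (a, i) ∈ L then 0 else gvar a i * constProj L v := by
  induction L with
  | nil => rfl
  | cons p L ih =>
    obtain ⟨b, j⟩ := p
    have e : ∀ u, constProj ((b, j) :: L) u = opD b j (gvar b j * constProj L u) := fun u => rfl
    rw [e, e, ih]
    by_cases hL : (a, i) ∈ L
    · simp [hL]
    by_cases hp : (a, i) = (b, j)
    · simp only [Prod.mk.injEq] at hp
      obtain ⟨rfl, rfl⟩ := hp
      rw [if_neg hL, if_pos List.mem_cons_self, ← mul_assoc, gvar, ExteriorAlgebra.ι_sq_zero,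
        zero_mul, map_zero]
    · rw [if_neg hL, if_neg (by simp [hp, hL]), ← mul_assoc, gvar_mul_gvar, neg_mul, map_neg,
        mul_assoc, opD_gvar_mul, if_neg (by simpa using hp), zero_sub, neg_neg]

/-- A vector killed by all ∂ is fixed by `constProj` over all variables, and that projection sends
every monomial of positive degree to zero. -/
theorem exists_eq_smul_one {v : Grass m n} (h : ∀ b k, opD b k v = 0) :
    ∃ z : ℂ, v = z • (1 : Grass m n) := by
  rw [← constProj_eq_self h (Finset.univ : Finset (Fin m × Fin n)).toList]
  set L := (Finset.univ : Finset (Fin m × Fin n)).toList with hL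
  refine grass_induction (P := fun v => ∃ z : ℂ, constProj L v = z • (1 : Grass m n))
    ⟨0, by simp⟩ ⟨1, by rw [constProj_eq_self opD_one, one_smul]⟩ ?_ ?_ ?_ v
  · rintro v w ⟨z, hz⟩ ⟨z', hz'⟩
    exact ⟨z + z', by rw [map_add, hz, hz', add_smul]⟩
  · rintro z v ⟨z', hz'⟩
    exact ⟨z * z', by rw [map_smul, hz', mul_smul]⟩
  · rintro a i v -
    exact ⟨0, by rw [constProj_gvar_mul, if_pos (by simp [hL]), zero_smul]⟩

/-- The annihilator of `1` in the ring of endomorphisms of the Grassmann algebra is generated by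
the derivations. -/
theorem exists_eq_sum_mul_opD {T : GD m n} (hT : T 1 = 0) :
    ∃ S : Fin m × Fin n → GD m n, T = ∑ p, S p * opD p.1 p.2 := by
  let D : Grass m n →ₗ[ℂ] (Fin m × Fin n → Grass m n) := LinearMap.pi fun p => opD p.1 p.2
  have hker : LinearMap.ker D ≤ LinearMap.ker T := fun v hv => by
    obtain ⟨z, rfl⟩ := exists_eq_smul_one fun b k => congrFun (LinearMap.mem_ker.1 hv) (b, k)
    rw [LinearMap.mem_ker, map_smul, hT, smul_zero]
  -- The joint kernel of the derivations is the constants, on which T vanishes. So T factors through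
  -- v ↦ (∂_p v)_p, and a linear left inverse extends the factor to all tuples; its components are
  -- the coefficients S.
  obtain ⟨g, hg⟩ := LinearMap.exists_leftInverse_of_injective
    ((LinearMap.ker D).liftQ D le_rfl) (Submodule.ker_liftQ_eq_bot _ _ _ le_rfl)
  let S : (Fin m × Fin n → Grass m n) →ₗ[ℂ] Grass m n := (LinearMap.ker D).liftQ T hker ∘ₗ g
  refine ⟨fun p => S ∘ₗ LinearMap.single ℂ (fun _ => Grass m n) p, LinearMap.ext fun v => ?_⟩
  have h1 : S (D v) = T v := by
    have := LinearMap.congr_fun hg (Submodule.Quotient.mk v)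
    simp only [LinearMap.comp_apply, Submodule.liftQ_apply, LinearMap.id_apply] at this
    simp only [S, LinearMap.comp_apply, this, Submodule.liftQ_apply]
  rw [LinearMap.sum_apply, ← h1]
  simp only [Module.End.mul_apply, LinearMap.comp_apply, ← map_sum]
  congr 1
  ext1 p
  simp [D, Finset.sum_apply, Pi.single_apply]

theorem gammaE_comm_opX (a b c : Fin m) (k : Fin n) :
    gammaE n a b * opX c k - opX c k * gammaE n a b = if b = c then opX a k else 0 := by
  have h : ∀ j : Fin n, opX a j * opD b j * opX c k - opX c k * (opX a j * opD b j)
      = if c = b ∧ k = j then (opX a j : GD m n) else 0 := fun j => by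
    rw [mul_assoc, eq_sub_of_add_eq (opD_mul_opX c b k j), ← mul_assoc (opX c k),
      opX_mul_opX c a, mul_sub, ← mul_assoc, neg_mul, sub_neg_eq_add, sub_add_cancel]
    split_ifs <;> simp
  rw [gammaE, Finset.sum_mul, Finset.mul_sum, ← Finset.sum_sub_distrib]
  simp only [h]
  by_cases hbc : b = c
  · subst hbc; simp
  · simp [hbc, Ne.symm hbc]

theorem gammaE_comm_opD (a b c : Fin m) (k : Fin n) :
    gammaE n a b * opD c k - opD c k * gammaE n a b = if a = c then - opD b k else 0 := by
  have h : ∀ j : Fin n, opX a j * opD b j * opD c k - opD c k * (opX a j * opD b j)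
      = if a = c ∧ j = k then - (opD b j : GD m n) else 0 := fun j => by
    rw [mul_assoc, opD_mul_opD b c, ← mul_assoc (opD c k),
      eq_sub_of_add_eq (opD_mul_opX a c j k), sub_mul, mul_neg, ← mul_assoc, ite_mul, one_mul, zero_mul]
    split_ifs <;> abel
  rw [gammaE, Finset.sum_mul, Finset.mul_sum, ← Finset.sum_sub_distrib]
  simp only [h]
  by_cases hac : a = c
  · subst hac; simp
  · simp [hac]

theorem gammaE_one (a b : Fin m) : gammaE n a b (1 : Grass m n) = 0 := by
  simp [gammaE, LinearMap.sum_apply, opD_one]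

theorem gammaE_gvar_mul (a b c : Fin m) (k : Fin n) (v : Grass m n) :
    gammaE n a b (gvar c k * v)
      = (if b = c then gvar a k * v else 0) + gvar c k * gammaE n a b v := by
  rw [← sub_eq_iff_eq_add]
  refine (LinearMap.congr_fun (gammaE_comm_opX (n := n) a b c k) v).trans ?_
  split_ifs <;> rfl

theorem gammaE_mul (a b : Fin m) (u v : Grass m n) :
    gammaE n a b (u * v) = gammaE n a b u * v + u * gammaE n a b v := by
  refine grass_induction
    (P := fun u => gammaE n a b (u * v) = gammaE n a b u * v + u * gammaE n a b v)
    ?_ ?_ ?_ ?_ ?_ u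
  · simp
  · rw [gammaE_one, one_mul, one_mul, zero_mul, zero_add]
  · intro x y hx hy
    simp only [add_mul, map_add, hx, hy]; abel
  · intro z x hx
    simp only [smul_mul_assoc, map_smul, hx, smul_add]
  · intro c k x hx
    rw [mul_assoc, gammaE_gvar_mul, hx, gammaE_gvar_mul, add_mul, mul_add]
    split_ifs <;> simp only [mul_assoc, zero_mul, zero_add, add_assoc]

theorem gammaE_comm_mulLeft (a b : Fin m) (u : Grass m n) :
    gammaE n a b * LinearMap.mulLeft ℂ u - LinearMap.mulLeft ℂ u * gammaE n a b
      = LinearMap.mulLeft ℂ (gammaE n a b u) := by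
  refine LinearMap.ext fun v => ?_
  change gammaE n a b (u * v) - u * gammaE n a b v = gammaE n a b u * v
  rw [gammaE_mul, add_sub_cancel_right]

/-- A sum of commuting operators x_ak ∂_bk, each of square zero since x_ak anticommutes with ∂_bk
when a ≠ b. -/
theorem isNilpotent_gammaE {a b : Fin m} (hab : a ≠ b) : IsNilpotent (gammaE n a b) := by
  refine Commute.isNilpotent_sum (fun k _ => ⟨2, ?_⟩) fun k l _ _ => ?_
  · have h : opD b k * opX a k = - (opX a k * opD b k : GD m n) := by
      rw [eq_neg_iff_add_eq_zero, opD_mul_opX, if_neg fun h => hab h.1]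
    have h2 : (opX a k * opD b k) * (opX a k * opD b k)
        = opX a k * (opD b k * opX a k) * (opD b k : GD m n) := by simp only [mul_assoc]
    rw [pow_two, h2, h, mul_neg, ← mul_assoc, opX_mul_self, zero_mul, neg_zero, zero_mul]
  · have h := quad_comm (n := n) a b a b k l
    rw [if_neg fun h => hab h.1, if_neg fun h => hab h.1, sub_zero] at h
    exact sub_eq_zero.1 h

/-! ## The vectors `w_ν` -/

/-- The list of the indices of the factors of `w_ν`. -/
def wBlock (a : Fin m) (k : Fin (n + 1)) : List (Grass m n) :=
  List.ofFn fun j : Fin (k : ℕ) => gvar a (Fin.castLE (Nat.le_of_lt_succ k.isLt) j)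

theorem length_wBlock (a : Fin m) (k : Fin (n + 1)) : (wBlock a k).length = (k : ℕ) :=
  List.length_ofFn

theorem wVec_eq (ν : Fin m → Fin (n + 1)) :
    wVec ν = (List.ofFn fun a => (wBlock a (ν a)).prod).prod := rfl

theorem mem_wBlock {a : Fin m} {k : Fin (n + 1)} {x : Grass m n} :
    x ∈ wBlock a k ↔ ∃ j : Fin n, (j : ℕ) < k ∧ x = gvar a j := by
  simp only [wBlock, List.mem_ofFn]
  constructor
  · rintro ⟨j, rfl⟩
    exact ⟨_, j.isLt, rfl⟩
  · rintro ⟨j, hj, rfl⟩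
    exact ⟨⟨j, hj⟩, rfl⟩

theorem wVec_eq_flatten (ν : Fin m → Fin (n + 1)) :
    wVec ν = (List.ofFn fun a => wBlock a (ν a)).flatten.prod := by
  rw [wVec_eq, List.prod_flatten, List.map_ofFn]; rfl

theorem mem_flatten_wBlock {ν : Fin m → Fin (n + 1)} {x : Grass m n} :
    x ∈ (List.ofFn fun a => wBlock a (ν a)).flatten
      ↔ ∃ a, ∃ j : Fin n, (j : ℕ) < ν a ∧ x = gvar a j := by
  simp only [List.mem_flatten, List.mem_ofFn]
  constructor
  · rintro ⟨_, ⟨a, rfl⟩, hx⟩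
    exact ⟨a, mem_wBlock.1 hx⟩
  · rintro ⟨a, hx⟩
    exact ⟨_, ⟨a, rfl⟩, mem_wBlock.2 hx⟩

theorem gvar_mul_prod_eq_zero {a : Fin m} {i : Fin n} {l : List (Grass m n)}
    (hl : ∀ x ∈ l, ∃ b j, x = gvar b j) (h : gvar a i ∈ l) : gvar a i * l.prod = 0 := by
  induction l with
  | nil => simp at h
  | cons x l ih =>
    rw [List.prod_cons, ← mul_assoc]
    rcases List.mem_cons.1 h with rfl | hm
    · rw [gvar, ExteriorAlgebra.ι_sq_zero, zero_mul]
    · obtain ⟨b, j, rfl⟩ := hl x List.mem_cons_self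
      rw [gvar_mul_gvar, neg_mul, mul_assoc,
        ih (fun y hy => hl y (List.mem_cons_of_mem _ hy)) hm, mul_zero, neg_zero]

theorem opD_prod_eq_zero {a : Fin m} {i : Fin n} {l : List (Grass m n)}
    (hl : ∀ x ∈ l, ∃ b j, x = gvar b j ∧ ¬ (b = a ∧ j = i)) : opD a i l.prod = 0 := by
  induction l with
  | nil => exact opD_one a i
  | cons x l ih =>
    obtain ⟨b, j, rfl, hne⟩ := hl x List.mem_cons_self
    rw [List.prod_cons, opD_gvar_mul, if_neg hne,
      ih fun y hy => hl y (List.mem_cons_of_mem _ hy), mul_zero, sub_zero]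

theorem gvar_mul_wVec {ν : Fin m → Fin (n + 1)} {a : Fin m} {k : Fin n} (h : (k : ℕ) < ν a) :
    gvar a k * wVec ν = 0 := by
  rw [wVec_eq_flatten]
  refine gvar_mul_prod_eq_zero (fun x hx => ?_) (mem_flatten_wBlock.2 ⟨a, k, h, rfl⟩)
  obtain ⟨b, j, -, rfl⟩ := mem_flatten_wBlock.1 hx
  exact ⟨b, j, rfl⟩

theorem opD_wVec {ν : Fin m → Fin (n + 1)} {a : Fin m} {k : Fin n} (h : (ν a : ℕ) ≤ k) :
    opD a k (wVec ν) = 0 := by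
  rw [wVec_eq_flatten]
  refine opD_prod_eq_zero fun x hx => ?_
  obtain ⟨b, j, hj, rfl⟩ := mem_flatten_wBlock.1 hx
  refine ⟨b, j, rfl, ?_⟩
  rintro ⟨rfl, rfl⟩
  omega

/-- For k < ν_a the variable x_ak already occurs in w_ν, and for k ≥ ν_a ≥ ν_b the variable x_bk
does not. Either way x_ak ∂_bk kills w_ν. -/
theorem gammaE_wVec_eq_zero {ν : Fin m → Fin (n + 1)} {a b : Fin m} (hab : a ≠ b)
    (h : ν b ≤ ν a) : gammaE n a b (wVec ν) = 0 := by
  rw [gammaE, LinearMap.sum_apply]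
  refine Finset.sum_eq_zero fun k _ => ?_
  change gvar a k * opD b k (wVec ν) = 0
  rcases lt_or_ge (k : ℕ) (ν a) with hk | hk
  · have h1 := opD_gvar_mul a b k k (wVec ν)
    rw [gvar_mul_wVec hk, map_zero, if_neg fun e => hab e.1, zero_sub] at h1
    exact neg_eq_zero.1 h1.symm
  · rw [opD_wVec ((Fin.le_def.1 h).trans hk), mul_zero]

theorem gammaE_wVec_self (ν : Fin m → Fin (n + 1)) (a : Fin m) :
    gammaE n a a (wVec ν) = ((ν a : ℕ) : ℂ) • wVec ν := by
  have h1 : ∀ k : Fin n, (opX a k * opD a k : GD m n) (wVec ν)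
      = if (k : ℕ) < ν a then wVec ν else 0 := fun k => by
    change gvar a k * opD a k (wVec ν) = _
    split_ifs with hk
    · have h1 := opD_gvar_mul a a k k (wVec ν)
      rw [gvar_mul_wVec hk, map_zero, if_pos ⟨rfl, rfl⟩] at h1
      exact (sub_eq_zero.1 h1.symm).symm
    · rw [opD_wVec (not_lt.1 hk), mul_zero]
  rw [gammaE, LinearMap.sum_apply]
  simp only [h1]
  rw [← Finset.sum_filter, Finset.sum_const, Nat.cast_smul_eq_nsmul]
  congr 1
  have hle : (ν a : ℕ) ≤ n := Nat.le_of_lt_succ (ν a).isLt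
  rw [← Fintype.card_subtype, Fintype.card_congr
    (⟨fun x => ⟨x.1, x.2⟩, fun x => ⟨Fin.castLE hle x, x.2⟩, fun x => rfl, fun x => rfl⟩ :
      {x : Fin n // (x : ℕ) < ν a} ≃ Fin (ν a : ℕ)), Fintype.card_fin]

/-! ## The permutation action on the Grassmann algebra -/

theorem permGrass_gvar (σ : Equiv.Perm (Fin m)) (a : Fin m) (i : Fin n) :
    permGrass n σ (gvar a i) = gvar (σ a) i := by
  rw [permGrass, gvar, ExteriorAlgebra.map_apply_ι, gvar]
  congr 1
  ext ⟨b, j⟩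
  simp only [LinearMap.funLeft_apply, Pi.single_apply, Prod.mk.injEq, Equiv.symm_apply_eq]

theorem permGrass_symm_apply (σ : Equiv.Perm (Fin m)) (v : Grass m n) :
    permGrass n σ.symm (permGrass n σ v) = v := by
  have : (permGrass n σ.symm).toLinearMap ∘ₗ (permGrass n σ).toLinearMap = LinearMap.id := by
    refine grass_linearMap_ext (by simp) fun a i v hv => ?_
    simp only [LinearMap.comp_apply, AlgHom.toLinearMap_apply, map_mul, permGrass_gvar,
      Equiv.symm_apply_apply, LinearMap.id_apply] at hv ⊢
    rw [hv]
  exact LinearMap.congr_fun this v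

theorem permGD_apply (σ : Equiv.Perm (Fin m)) (T : GD m n) (v : Grass m n) :
    permGD n σ T v = permGrass n σ (T (permGrass n σ.symm v)) := rfl

theorem permGrass_apply_symm (σ : Equiv.Perm (Fin m)) (v : Grass m n) :
    permGrass n σ (permGrass n σ.symm v) = v := permGrass_symm_apply σ.symm v

theorem permGD_mul (σ : Equiv.Perm (Fin m)) (S T : GD m n) :
    permGD n σ (S * T) = permGD n σ S * permGD n σ T := by
  refine LinearMap.ext fun v => ?_
  simp only [permGD_apply, Module.End.mul_apply, permGrass_symm_apply]

theorem permGD_one (σ : Equiv.Perm (Fin m)) : permGD n σ 1 = 1 :=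
  LinearMap.ext fun v => permGrass_apply_symm σ v

theorem permGD_mulLeft (σ : Equiv.Perm (Fin m)) (u : Grass m n) :
    permGD n σ (LinearMap.mulLeft ℂ u) = LinearMap.mulLeft ℂ (permGrass n σ u) := by
  refine LinearMap.ext fun v => ?_
  simp only [permGD_apply, LinearMap.mulLeft_apply, map_mul, permGrass_apply_symm]

theorem permGD_opX (σ : Equiv.Perm (Fin m)) (a : Fin m) (i : Fin n) :
    permGD n σ (opX a i) = opX (σ a) i := by
  rw [opX, permGD_mulLeft, permGrass_gvar]; rfl

theorem permGD_opD (σ : Equiv.Perm (Fin m)) (a : Fin m) (i : Fin n) :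
    permGD n σ (opD a i) = opD (σ a) i := by
  refine grass_linearMap_ext ?_ fun b j v hv => ?_
  · rw [permGD_apply, map_one, opD_one, opD_one, map_zero]
  · rw [permGD_apply] at hv ⊢
    rw [map_mul, permGrass_gvar, opD_gvar_mul, opD_gvar_mul, map_sub, map_mul, permGrass_gvar, hv,
      Equiv.apply_symm_apply]
    congr 1
    simp only [Equiv.symm_apply_eq]
    split_ifs
    · rw [permGrass_apply_symm]
    · rw [map_zero]

theorem permGD_gammaE (σ : Equiv.Perm (Fin m)) (a b : Fin m) :
    permGD n σ (gammaE n a b) = gammaE n (σ a) (σ b) := by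
  simp only [gammaE, map_sum, permGD_mul, permGD_opX, permGD_opD]

/-- The reflection exchanges two adjacent blocks of ν_c and ν_(c+1) odd variables; restoring their
order costs the sign. This is the source of the signs in the final product. -/
theorem permGrass_wVec (c : Fin (m - 1)) (ν : Fin m → Fin (n + 1)) :
    permGrass n (simpleRefl c) (wVec ν)
      = (-1 : ℂ) ^ ((ν (lo c) : ℕ) * (ν (hi c) : ℕ)) • wVec fun a => ν ((simpleRefl c).symm a) := by
  have h1 : ∀ a k, permGrass n (simpleRefl c) (wBlock a k).prod
      = (wBlock (simpleRefl c a) k).prod := fun a k => by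
    rw [map_list_prod, wBlock, List.map_ofFn, wBlock]
    congr 2
    ext1 j
    exact permGrass_gvar _ _ _
  have hs : (simpleRefl c).symm = simpleRefl c := Equiv.symm_swap _ _
  rw [wVec_eq, map_list_prod, List.map_ofFn, wVec_eq, hs]
  have h2 := ofFn_swap_prod (c : ℕ) m (lo c) (hi c)
    (fun a => (wBlock a (ν (simpleRefl c a)) : List (Grass m n)).prod)
    ((-1) ^ ((ν (lo c) : ℕ) * (ν (hi c) : ℕ))) rfl rfl
    (fun x => (Commute.neg_one_left x).pow_left _) (by
      have := prod_mul_prod_anticomm (wBlock (hi c) (ν (lo c))) (wBlock (lo c) (ν (hi c)) :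
        List (Grass m n)) (by
          intro x hx y hy
          obtain ⟨j, -, rfl⟩ := mem_wBlock.1 hx
          obtain ⟨k, -, rfl⟩ := mem_wBlock.1 hy
          exact gvar_mul_gvar _ _ _ _)
      simpa only [simpleRefl, Equiv.swap_apply_left, Equiv.swap_apply_right, length_wBlock]
        using this)
  rw [Algebra.smul_def, map_pow, map_neg, map_one, ← h2]
  congr 2
  ext1 a
  simp only [Function.comp_apply, h1]
  congr 2
  rw [simpleRefl, Equiv.swap_apply_self]

end

section

variable {m n : ℕ}

/-! ## The algebra `A` -/

theorem tmulA_mul (u u' : Ugl m) (T T' : GD m n) :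
    tmulA u T * tmulA u' T' = tmulA (u * u') (T * T') :=
  Algebra.TensorProduct.tmul_mul_tmul u u' T T'

theorem tmulA_add_left (u u' : Ugl m) (T : GD m n) :
    tmulA (u + u') T = tmulA u T + tmulA u' T := TensorProduct.add_tmul _ _ _

theorem tmulA_add_right (u : Ugl m) (T T' : GD m n) :
    tmulA u (T + T') = tmulA u T + tmulA u T' := TensorProduct.tmul_add _ _ _

/-- The embedding of `U(gl_m)` into `A`. -/
def inclU (m n : ℕ) : Ugl m →ₐ[ℂ] AlgA m n := Algebra.TensorProduct.includeLeft

/-- The embedding of `GD` into `A`. -/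
def inclGD (m n : ℕ) : GD m n →ₐ[ℂ] AlgA m n := Algebra.TensorProduct.includeRight

theorem inclU_apply (u : Ugl m) : inclU m n u = tmulA u 1 := rfl

theorem inclGD_apply (T : GD m n) : inclGD m n T = tmulA 1 T := rfl

theorem tmulA_eq (u : Ugl m) (T : GD m n) : tmulA u T = inclU m n u * inclGD m n T := by
  rw [inclU_apply, inclGD_apply, tmulA_mul, mul_one, one_mul]

theorem inclU_commute_inclGD (u : Ugl m) (T : GD m n) :
    inclU m n u * inclGD m n T = inclGD m n T * inclU m n u := by
  rw [inclU_apply, inclGD_apply, tmulA_mul, tmulA_mul, mul_one, one_mul, mul_one, one_mul]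

theorem diagE_eq (a b : Fin m) :
    diagE n a b = inclU m n (unitU a b) + inclGD m n (gammaE n a b) := rfl

theorem tmulA_one_one : tmulA (1 : Ugl m) (1 : GD m n) = 1 := rfl

theorem algA_induction {P : AlgA m n → Prop} (zero : P 0) (tmul : ∀ u T, P (tmulA u T))
    (add : ∀ X Y, P X → P Y → P (X + Y)) (Y : AlgA m n) : P Y :=
  TensorProduct.induction_on (motive := P) Y zero tmul add

theorem ι_eq_sum_unitU (M : Matrix (Fin m) (Fin m) ℂ) :
    UniversalEnvelopingAlgebra.ι ℂ M = ∑ a, ∑ b, M a b • (unitU a b : Ugl m) := by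
  have h : M = ∑ a, ∑ b, M a b • Matrix.single a b (1 : ℂ) := by
    conv_lhs => rw [Matrix.matrix_eq_sum_single M]
    simp [Matrix.smul_single]
  have h2 : UniversalEnvelopingAlgebra.ι ℂ M
      = (UniversalEnvelopingAlgebra.ι ℂ : Matrix (Fin m) (Fin m) ℂ →ₗ⁅ℂ⁆ Ugl m).toLinearMap M := rfl
  rw [h2]
  conv_lhs => rw [h]
  simp only [map_sum, map_smul]
  rfl

/-- The embedding of `gl_m` lands in the subalgebra generated by the matrix units, so by the
universal property the identity of the enveloping algebra factors through it. -/
theorem adjoin_unitU :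
    Algebra.adjoin ℂ (Set.range fun p : Fin m × Fin m => (unitU p.1 p.2 : Ugl m)) = ⊤ := by
  set S := Algebra.adjoin ℂ (Set.range fun p : Fin m × Fin m => (unitU p.1 p.2 : Ugl m)) with hS
  have hmem : ∀ M : Matrix (Fin m) (Fin m) ℂ, UniversalEnvelopingAlgebra.ι ℂ M ∈ S := fun M => by
    rw [ι_eq_sum_unitU]
    exact sum_mem fun a _ => sum_mem fun b _ =>
      S.smul_mem (Algebra.subset_adjoin ⟨(a, b), rfl⟩) _
  let f : Matrix (Fin m) (Fin m) ℂ →ₗ⁅ℂ⁆ S :=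
    { toFun := fun M => ⟨UniversalEnvelopingAlgebra.ι ℂ M, hmem M⟩
      map_add' := fun M N => Subtype.ext (map_add _ M N)
      map_smul' := fun z M => Subtype.ext (map_smul _ z M)
      map_lie' := fun {M N} => Subtype.ext (LieHom.map_lie _ M N) }
  have h : S.val.comp (UniversalEnvelopingAlgebra.lift ℂ f) = AlgHom.id ℂ _ := by
    refine UniversalEnvelopingAlgebra.hom_ext ℂ (LieHom.ext fun M => ?_)
    change ((UniversalEnvelopingAlgebra.lift ℂ f (UniversalEnvelopingAlgebra.ι ℂ M) : S) : Ugl m)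
      = UniversalEnvelopingAlgebra.ι ℂ M
    rw [UniversalEnvelopingAlgebra.lift_ι_apply]
    rfl
  refine eq_top_iff.2 fun u _ => ?_
  have := AlgHom.congr_fun h u
  rw [AlgHom.id_apply] at this
  rw [← this]
  exact Subtype.property _

theorem ugl_induction {P : Ugl m → Prop} (gen : ∀ a b, P (unitU a b))
    (scalar : ∀ z : ℂ, P (algebraMap ℂ _ z)) (add : ∀ u v, P u → P v → P (u + v))
    (mul : ∀ u v, P u → P v → P (u * v)) (u : Ugl m) : P u := by
  have hu : u ∈ Algebra.adjoin ℂ (Set.range fun p : Fin m × Fin m => (unitU p.1 p.2 : Ugl m)) := by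
    rw [adjoin_unitU]; trivial
  induction hu using Algebra.adjoin_induction with
  | mem x hx => obtain ⟨p, rfl⟩ := hx; exact gen _ _
  | algebraMap z => exact scalar z
  | add x y _ _ hx hy => exact add _ _ hx hy
  | mul x y _ _ hx hy => exact mul _ _ hx hy

/-! ## The permutation action -/

theorem permU_unitU (σ : Equiv.Perm (Fin m)) (a b : Fin m) :
    permU σ (unitU a b) = unitU (σ a) (σ b) := by
  rw [permU, unitU, UniversalEnvelopingAlgebra.lift_ι_apply]
  change UniversalEnvelopingAlgebra.ι ℂ (Matrix.reindex σ σ (Matrix.single a b (1 : ℂ))) = _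
  rw [Matrix.reindex_apply, unitU]
  congr 1
  ext i j
  simp [Matrix.single_apply, Equiv.eq_symm_apply]

theorem permA_tmulA (σ : Equiv.Perm (Fin m)) (u : Ugl m) (T : GD m n) :
    permA n σ (tmulA u T) = tmulA (permU σ u) (permGD n σ T) := rfl

theorem permA_mul (σ : Equiv.Perm (Fin m)) (X Y : AlgA m n) :
    permA n σ (X * Y) = permA n σ X * permA n σ Y := by
  refine algA_induction (P := fun X => permA n σ (X * Y) = permA n σ X * permA n σ Y) ?_ ?_ ?_ X
  · simp
  · intro u T
    refine algA_induction
      (P := fun Y => permA n σ (tmulA u T * Y) = permA n σ (tmulA u T) * permA n σ Y) ?_ ?_ ?_ Y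
    · simp
    · intro u' T'
      rw [tmulA_mul, permA_tmulA, permA_tmulA, permA_tmulA, tmulA_mul, map_mul, permGD_mul]
    · intro X Y hX hY
      rw [mul_add, map_add, map_add, mul_add, hX, hY]
  · intro X X' hX hX'
    rw [add_mul, map_add, map_add, add_mul, hX, hX']

theorem permA_one (σ : Equiv.Perm (Fin m)) : permA n σ 1 = 1 := by
  rw [← tmulA_one_one, permA_tmulA, map_one, permGD_one]

theorem permA_algebraMap (σ : Equiv.Perm (Fin m)) (z : ℂ) :
    permA n σ (algebraMap ℂ _ z) = algebraMap ℂ _ z := by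
  rw [Algebra.algebraMap_eq_smul_one, map_smul, permA_one]

theorem permA_diagE (σ : Equiv.Perm (Fin m)) (a b : Fin m) :
    permA n σ (diagE n a b) = diagE n (σ a) (σ b) := by
  rw [diagE, map_add, permA_tmulA, permA_tmulA, permU_unitU, map_one (permU σ), permGD_one,
    permGD_gammaE, diagE]

theorem cartanHom_X (a : Fin m) : cartanHom m n (MvPolynomial.X a) = diagE n a a := by
  simp [cartanHom]

theorem permA_cartanHom (σ : Equiv.Perm (Fin m)) (p : Uh m) :
    permA n σ (cartanHom m n p) = cartanHom m n (permUh σ p) := by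
  induction p using MvPolynomial.induction_on with
  | C z =>
    rw [← MvPolynomial.algebraMap_eq, AlgHom.commutes, AlgHom.commutes, AlgHom.commutes,
      permA_algebraMap]
  | add p q hp hq => simp only [map_add, hp, hq]
  | mul_X p a hp =>
    rw [map_mul, permA_mul, hp, cartanHom_X, permA_diagE, map_mul, map_mul, permUh,
      MvPolynomial.rename_X, cartanHom_X]

/-! ## The rank one data attached to a simple root -/

/-- The quotient map from `A` to a quotient of its fractions. -/
def projBar (P : Submodule (UhBar m) (ABar m n)) : AlgA m n →+ ABar m n ⧸ P :=
  P.mkQ.toAddMonoidHom.comp (LocalizedModule.mkLinearMap (denoms m) (AlgA m n)).toAddMonoidHom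

theorem projBar_apply (P : Submodule (UhBar m) (ABar m n)) (Y : AlgA m n) :
    projBar P Y = P.mkQ (toBar Y) := rfl

theorem projBar_smul (P : Submodule (UhBar m) (ABar m n)) (p : Uh m) (Y : AlgA m n) :
    projBar P (p • Y) = algebraMap (Uh m) (UhBar m) p • projBar P Y := by
  rw [projBar_apply, projBar_apply, ← map_smul, toBar, toBar, ← Localization.mk_one_eq_algebraMap,
    LocalizedModule.mk_smul_mk, one_mul]

theorem projBar_diagE (P : Submodule (UhBar m) (ABar m n)) (a : Fin m) (Y : AlgA m n) :
    projBar P (diagE n a a * Y)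
      = algebraMap (Uh m) (UhBar m) (MvPolynomial.X a) • projBar P Y := by
  rw [← projBar_smul, uh_smul_def, cartanHom_X]

theorem mul_mem_idealJ {a b : Fin m} (hab : a < b) (Y : AlgA m n) :
    diagE n b a * Y ∈ idealJ m n :=
  (idealJ m n).smul_mem (MulOpposite.op Y) (Submodule.subset_span ⟨a, b, hab, rfl⟩)

theorem projBar_eq_zero {P : Submodule (UhBar m) (ABar m n)} (hP : idealJBar m n ≤ P)
    {Y : AlgA m n} (hY : Y ∈ idealJ m n) : projBar P Y = 0 :=
  (Submodule.Quotient.mk_eq_zero P).2 (hP (Submodule.subset_span ⟨Y, hY, rfl⟩))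

theorem lo_ne_hi (c : Fin (m - 1)) : lo c ≠ hi c := by simp [lo, hi, Fin.ext_iff]

theorem lo_lt_hi (c : Fin (m - 1)) : lo c < hi c := by simp [lo, hi, Fin.lt_def]

theorem diagE_F_comm (c : Fin (m - 1)) (a : Fin m) :
    diagE n (hi c) (lo c) * diagE n a a - diagE n a a * diagE n (hi c) (lo c)
      = simpleRoot c a • diagE n (hi c) (lo c) := by
  rw [diagE_comm, simpleRoot, sub_smul]
  congr 1
  · by_cases h : a = lo c
    · subst h; simp
    · simp [h, Ne.symm h]
  · by_cases h : a = hi c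
    · subst h; simp
    · simp [h, Ne.symm h]

theorem diagE_E_comm (c : Fin (m - 1)) (a : Fin m) :
    diagE n a a * diagE n (lo c) (hi c) - diagE n (lo c) (hi c) * diagE n a a
      = simpleRoot c a • diagE n (lo c) (hi c) := by
  rw [diagE_comm, simpleRoot, sub_smul]
  congr 1
  · by_cases h : a = lo c
    · subst h; simp
    · simp [h]
  · by_cases h : a = hi c
    · subst h; simp
    · simp [h]

theorem simpleRoot_lo (c : Fin (m - 1)) : simpleRoot c (lo c) = 1 := by
  simp [simpleRoot, lo_ne_hi]

theorem simpleRoot_hi (c : Fin (m - 1)) : simpleRoot c (hi c) = -1 := by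
  simp [simpleRoot, (lo_ne_hi c).symm]

/-- The rank one data attached to a simple root and to a quotient of `J̄ \ Ā`. -/
def rankOne (c : Fin (m - 1)) (P : Submodule (UhBar m) (ABar m n)) (hP : idealJBar m n ≤ P) :
    RankOne (UhBar m) (AlgA m n) (ABar m n ⧸ P) where
  E := diagE n (lo c) (hi c)
  F := diagE n (hi c) (lo c)
  H := diagE n (lo c) (lo c) - diagE n (hi c) (hi c)
  π := projBar P
  h := algebraMap (Uh m) (UhBar m) (MvPolynomial.X (lo c))
    - algebraMap (Uh m) (UhBar m) (MvPolynomial.X (hi c))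
  c s := Localization.mk (MvPolynomial.C ((s.factorial : ℂ)⁻¹)) (fallH c s)
  EF := by rw [diagE_comm, if_pos rfl, if_pos rfl]
  HE := by
    have h := congrArg₂ (· - ·) (diagE_E_comm (n := n) c (lo c)) (diagE_E_comm (n := n) c (hi c))
    simp only [simpleRoot_lo, simpleRoot_hi] at h
    rw [sub_mul, mul_sub]
    refine Eq.trans (by abel) (h.trans (by module))
  HF := by
    have h := congrArg₂ (· - ·) (diagE_F_comm (n := n) c (hi c)) (diagE_F_comm (n := n) c (lo c))
    simp only [simpleRoot_lo, simpleRoot_hi] at h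
    rw [sub_mul, mul_sub]
    refine Eq.trans (by abel) (h.trans (by module))
  π_F Y := projBar_eq_zero hP (mul_mem_idealJ (lo_lt_hi c) Y)
  π_H Y := by rw [sub_mul, map_sub, projBar_diagE, projBar_diagE, sub_smul]
  c_zero := by
    rw [Nat.factorial_zero, Nat.cast_one, inv_one, map_one, fallH, Finset.prod_range_zero,
      Localization.mk_one]
  c_succ s := by
    have hs : fallH c (s + 1) = fallH c s * ⟨MvPolynomial.X (lo c) - MvPolynomial.X (hi c)
        + MvPolynomial.C (((-(s : ℤ)) : ℤ) : ℂ), Submonoid.subset_closure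
          ⟨lo c, hi c, -(s : ℤ), lo_ne_hi c, rfl⟩⟩ := Finset.prod_range_succ _ _
    have h1 : ((s : UhBar m) + 1) * (algebraMap (Uh m) (UhBar m) (MvPolynomial.X (lo c))
        - algebraMap (Uh m) (UhBar m) (MvPolynomial.X (hi c)) - s)
        = algebraMap (Uh m) (UhBar m) (MvPolynomial.C ((s : ℂ) + 1)
          * (MvPolynomial.X (lo c) - MvPolynomial.X (hi c)
            + MvPolynomial.C (((-(s : ℤ)) : ℤ) : ℂ))) := by
      simp only [map_add, map_mul, map_sub, map_one, Int.cast_neg, map_neg, Int.cast_natCast,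
        map_natCast]
      ring
    rw [h1, hs, ← Localization.mk_one_eq_algebraMap, Localization.mk_mul, one_mul,
      Localization.mk_eq_mk_iff, Localization.r_iff_exists]
    refine ⟨1, ?_⟩
    have h2 : (MvPolynomial.C ((s : ℂ) + 1) * MvPolynomial.C (((s + 1).factorial : ℂ)⁻¹) : Uh m)
        = MvPolynomial.C ((s.factorial : ℂ)⁻¹) := by
      rw [← map_mul, Nat.factorial_succ]
      congr 1
      have h3 : (s : ℂ) + 1 ≠ 0 := Nat.cast_add_one_ne_zero s
      push_cast
      field_simp
    simp only [Submonoid.coe_mul, Submonoid.coe_one, one_mul]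
    rw [← h2]
    ring

theorem adF_mul (c : Fin (m - 1)) (X Y : AlgA m n) :
    adF c (X * Y) = adF c X * Y + X * adF c Y := by
  simp only [adF, mul_sub, sub_mul, mul_assoc]; abel

/-! ### Local nilpotency of ad F and the class of ξ_c as a rank one series -/

variable (c : Fin (m - 1)) (P : Submodule (UhBar m) (ABar m n)) (hP : idealJBar m n ≤ P)

theorem adF_inclGD (T : GD m n) : adF c (inclGD m n T)
    = inclGD m n (gammaE n (hi c) (lo c) * T - T * gammaE n (hi c) (lo c)) := by
  rw [adF, diagE_eq, add_mul, mul_add, inclU_commute_inclGD, map_sub, map_mul, map_mul]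
  abel

theorem adF_inclU (u : Ugl m) : adF c (inclU m n u)
    = inclU m n (unitU (hi c) (lo c) * u - u * unitU (hi c) (lo c)) := by
  rw [adF, diagE_eq, add_mul, mul_add, ← inclU_commute_inclGD, map_sub, map_mul, map_mul]
  abel

/-- On `GD` the operator ad F is the commutator with γ(F), which is nilpotent, hence ad-nilpotent.
-/
theorem exists_iterate_adF_inclGD (T : GD m n) : ∃ N, (adF c)^[N] (inclGD m n T) = 0 := by
  have hnil := isNilpotent_gammaE (n := n) (lo_ne_hi c).symm
  set f := gammaE n (hi c) (lo c) with hf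
  obtain ⟨N, hN⟩ := LieAlgebra.ad_nilpotent_of_nilpotent (R := ℂ) hnil
  refine ⟨N, ?_⟩
  have h : ∀ k, (adF c)^[k] (inclGD m n T) = inclGD m n (((LieAlgebra.ad ℂ (GD m n) f) ^ k) T) := by
    intro k
    induction k with
    | zero => rfl
    | succ k ih =>
      rw [Function.iterate_succ_apply', ih, adF_inclGD, pow_succ', Module.End.mul_apply,
        LieAlgebra.ad_apply, LieRing.of_associative_ring_bracket]
  rw [h, hN, LinearMap.zero_apply, map_zero]

theorem exists_iterate_adF_unitU (a b : Fin m) :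
    ∃ N, (adF c)^[N] (inclU m n (unitU a b)) = 0 := by
  let g : Ugl m →ₗ[ℂ] Ugl m := LinearMap.mulLeft ℂ (unitU (hi c) (lo c))
    - LinearMap.mulRight ℂ (unitU (hi c) (lo c))
  have hg : ∀ u, adF c (inclU m n u) = inclU m n (g u) := fun u => adF_inclU c u
  have h : ∀ a b, g (unitU a b)
      = (if lo c = a then unitU (hi c) b else 0) - (if hi c = b then unitU a (lo c) else 0) :=
    fun a b => unitU_comm _ _ _ _
  have hne := lo_ne_hi c
  -- Under the adjoint action of this `sl_2`, `gl_m` is a sum of strings of length at most three.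
  refine ⟨3, ?_⟩
  simp only [Function.iterate_succ_apply, Function.iterate_zero, id_eq, hg]
  rw [← map_zero (inclU m n)]
  congr 1
  by_cases h1 : lo c = a <;> by_cases h2 : hi c = b
  · subst h1 h2; simp [h, hne, hne.symm]
  · subst h1; simp [h, h2, hne]
  · subst h2; simp [h, h1, hne.symm]
  · simp [h, h1, h2]

theorem exists_iterate_adF (Y : AlgA m n) : ∃ N, (adF c)^[N] Y = 0 := by
  have hmul := fun X Y => RankOne.exists_iterate_δ_mul (D := rankOne (n := n) c _ le_rfl) X Y
  have hadd : ∀ X Y : AlgA m n, (∃ N, (adF c)^[N] X = 0) → (∃ N, (adF c)^[N] Y = 0) →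
      ∃ N, (adF c)^[N] (X + Y) = 0 := by
    rintro X Y ⟨p, hp⟩ ⟨q, hq⟩
    refine ⟨p + q, ?_⟩
    change ((rankOne (n := n) c _ le_rfl).δ)^[p + q] (X + Y) = 0
    rw [iterate_map_add, RankOne.iterate_δ_eq_zero (D := rankOne (n := n) c _ le_rfl) hp
      (Nat.le_add_right p q), RankOne.iterate_δ_eq_zero (D := rankOne (n := n) c _ le_rfl) hq
      (Nat.le_add_left q p), add_zero]
  refine algA_induction (P := fun Y => ∃ N, (adF c)^[N] Y = 0) ⟨0, rfl⟩ (fun u T => ?_) hadd Y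
  rw [tmulA_eq]
  refine hmul _ _ ?_ (exists_iterate_adF_inclGD c T)
  refine ugl_induction (P := fun u => ∃ N, (adF c)^[N] (inclU m n u) = 0)
    (exists_iterate_adF_unitU c) (fun z => ⟨1, ?_⟩) (fun u v hu hv => ?_) (fun u v hu hv => ?_) u
  · rw [Function.iterate_one, adF_inclU, ← Algebra.commutes, sub_self, map_zero]
  · rw [map_add]; exact hadd _ _ hu hv
  · rw [map_mul]; exact hmul _ _ hu hv

theorem rankOne_nil (Y : AlgA m n) : ∃ N, (rankOne c P hP).δ^[N] Y = 0 := exists_iterate_adF c Y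

/-- The bridge to the rank one calculus. It is kept for every P containing J̄, so that it serves
both J̄ \ Ā and the double quotients. -/
theorem mkQ_xi (Y : AlgA m n) : P.mkQ (xi c Y) = (rankOne c P hP).series Y := by
  obtain ⟨N, hN⟩ := exists_iterate_adF c Y
  have hfin : (Function.support fun s : ℕ => (LocalizedModule.mk
      (((s.factorial : ℂ)⁻¹) • (diagE n (lo c) (hi c) ^ s * (adF c)^[s] Y)) (fallH c s) :
        ABar m n)).Finite := by
    refine (Set.finite_lt_nat N).subset fun s hs => ?_
    by_contra hlt
    refine hs ?_
    have h0 : (adF c)^[s] Y = 0 :=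
      RankOne.iterate_δ_eq_zero (D := rankOne (n := n) c _ le_rfl) hN (not_lt.1 hlt)
    change LocalizedModule.mk _ _ = _
    rw [h0, mul_zero, smul_zero, LocalizedModule.zero_mk]
  rw [xi, RankOne.series, ← LinearMap.toAddMonoidHom_coe, AddMonoidHom.map_finsum _ hfin]
  refine finsum_congr fun s => ?_
  change P.mkQ _ = (Localization.mk (MvPolynomial.C ((s.factorial : ℂ)⁻¹)) (fallH c s) : UhBar m)
    • P.mkQ (toBar _)
  rw [← map_smul, toBar, LocalizedModule.mk_smul_mk, mul_one, ← MvPolynomial.algebraMap_eq,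
    algebraMap_smul]
  rfl

end

section

variable {m n : ℕ} (c : Fin (m - 1))

/-! ## The operators `ξ_c` and the ideals -/

theorem projBar_smul_complex (P : Submodule (UhBar m) (ABar m n)) (z : ℂ) (Y : AlgA m n) :
    projBar P (z • Y) = algebraMap ℂ (UhBar m) z • projBar P Y := by
  rw [← algebraMap_smul (Uh m) z Y, projBar_smul, ← IsScalarTower.algebraMap_apply]

theorem adF_diagE (a b : Fin m) : adF c (diagE n a b)
    = (if lo c = a then diagE n (hi c) b else 0) - (if hi c = b then diagE n a (lo c) else 0) :=
  diagE_comm _ _ _ _ _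

/-- The right ideal generated by the nilradical of the parabolic subalgebra opposite to `c`. -/
def nilLeft (n : ℕ) (c : Fin (m - 1)) : AddSubgroup (AlgA m n) :=
  AddSubgroup.closure {X | ∃ (a b : Fin m) (Y : AlgA m n),
    a < b ∧ ¬ (a = lo c ∧ b = hi c) ∧ X = diagE n b a * Y}

theorem mem_nilLeft {a b : Fin m} (hab : a < b) (hne : ¬ (a = lo c ∧ b = hi c))
    (Y : AlgA m n) : diagE n b a * Y ∈ nilLeft n c :=
  AddSubgroup.subset_closure ⟨a, b, Y, hab, hne, rfl⟩

/-- F normalises the span of the other negative root vectors: a bracket of F with one of them is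
zero or, up to sign, another one, never F. -/
theorem adF_mem_nilLeft {X : AlgA m n} (hX : X ∈ nilLeft n c) : adF c X ∈ nilLeft n c := by
  induction hX using AddSubgroup.closure_induction with
  | mem X hX =>
    obtain ⟨a, b, Y, hab, hne, rfl⟩ := hX
    rw [adF_mul, adF_diagE, sub_mul]
    refine add_mem (sub_mem ?_ ?_) (mem_nilLeft c hab hne _)
    · split_ifs with h
      · subst h
        exact mem_nilLeft c (hab.trans (lo_lt_hi c)) (fun e => hab.ne e.1) _
      · rw [zero_mul]; exact zero_mem _
    · split_ifs with h
      · subst h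
        exact mem_nilLeft c ((lo_lt_hi c).trans hab) (fun e => hab.ne e.2.symm) _
      · rw [zero_mul]; exact zero_mem _
  | zero => rw [adF, mul_zero, zero_mul, sub_zero]; exact zero_mem _
  | add x y _ _ hx hy =>
    have : adF c (x + y) = adF c x + adF c y := by simp only [adF, mul_add, add_mul]; abel
    rw [this]; exact add_mem hx hy
  | neg x _ hx =>
    have : adF c (-x) = -adF c x := by simp only [adF, mul_neg, neg_mul]; abel
    rw [this]; exact neg_mem hx

theorem lt_lo_of_lt_hi {a : Fin m} (h : a < hi c) (hne : a ≠ lo c) : a < lo c := by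
  simp only [lo, hi, Fin.lt_def, ne_eq, Fin.ext_iff] at *
  omega

theorem hi_lt_of_lo_lt {b : Fin m} (h : lo c < b) (hne : b ≠ hi c) : hi c < b := by
  simp only [lo, hi, Fin.lt_def, ne_eq, Fin.ext_iff] at *
  omega

/-- E also normalises that span. Subtracting a simple root from a different positive root never
leaves the positive roots, so commuting E to the right produces only admissible terms. -/
theorem E_mul_mem_nilLeft {X : AlgA m n} (hX : X ∈ nilLeft n c) :
    diagE n (lo c) (hi c) * X ∈ nilLeft n c := by
  induction hX using AddSubgroup.closure_induction with
  | mem X hX =>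
    obtain ⟨a, b, Y, hab, hne, rfl⟩ := hX
    have h : diagE n (lo c) (hi c) * (diagE n b a * Y) = diagE n b a * (diagE n (lo c) (hi c) * Y)
        + ((if hi c = b then diagE n (lo c) a else 0)
          - (if lo c = a then diagE n b (hi c) else 0)) * Y := by
      rw [← diagE_comm]; simp only [sub_mul, mul_assoc]; abel
    rw [h, sub_mul]
    refine add_mem (mem_nilLeft c hab hne _) (sub_mem ?_ ?_)
    · split_ifs with h
      · subst h
        have ha : a ≠ lo c := fun e => hne ⟨e, rfl⟩
        exact mem_nilLeft c (lt_lo_of_lt_hi c hab ha) (fun e => ha e.1) _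
      · rw [zero_mul]; exact zero_mem _
    · split_ifs with h
      · subst h
        have hb : b ≠ hi c := fun e => hne ⟨rfl, e⟩
        exact mem_nilLeft c (hi_lt_of_lo_lt c hab hb) (fun e => hb e.2) _
      · rw [zero_mul]; exact zero_mem _
  | zero => rw [mul_zero]; exact zero_mem _
  | add x y _ _ hx hy => rw [mul_add]; exact add_mem hx hy
  | neg x _ hx => rw [mul_neg]; exact neg_mem hx

theorem nilLeft_le_idealJ {X : AlgA m n} (hX : X ∈ nilLeft n c) : X ∈ idealJ m n := by
  induction hX using AddSubgroup.closure_induction with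
  | mem X hX =>
    obtain ⟨a, b, Y, hab, -, rfl⟩ := hX
    exact mul_mem_idealJ hab Y
  | zero => exact zero_mem _
  | add x y _ _ hx hy => exact add_mem hx hy
  | neg x _ hx => exact neg_mem hx

theorem simpleRefl_lo : simpleRefl c (lo c) = hi c := Equiv.swap_apply_left _ _

theorem simpleRefl_hi : simpleRefl c (hi c) = lo c := Equiv.swap_apply_right _ _

theorem simpleRefl_symm : (simpleRefl c).symm = simpleRefl c := Equiv.symm_swap _ _

theorem simpleRefl_simpleRefl (a : Fin m) : simpleRefl c (simpleRefl c a) = a :=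
  Equiv.swap_apply_self _ _ _

theorem simpleRefl_of_ne {a : Fin m} (h1 : a ≠ lo c) (h2 : a ≠ hi c) : simpleRefl c a = a :=
  Equiv.swap_apply_of_ne_of_ne h1 h2

/-- A simple reflection permutes the positive roots other than the simple one. -/
theorem simpleRefl_lt {a b : Fin m} (hab : a < b) (hne : ¬ (a = lo c ∧ b = hi c)) :
    simpleRefl c a < simpleRefl c b ∧ ¬ (simpleRefl c a = lo c ∧ simpleRefl c b = hi c) := by
  have h1 := lo_lt_hi c
  refine ⟨?_, ?_⟩
  · simp only [simpleRefl, Equiv.swap_apply_def]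
    simp only [lo, hi, Fin.lt_def, Fin.ext_iff] at *
    split_ifs <;> simp_all <;> omega
  · rintro ⟨e1, e2⟩
    have e1 := congrArg (simpleRefl c) e1
    have e2 := congrArg (simpleRefl c) e2
    rw [simpleRefl_simpleRefl, simpleRefl_lo] at e1
    rw [simpleRefl_simpleRefl, simpleRefl_hi] at e2
    subst e1 e2
    exact absurd hab (not_lt.2 h1.le)

variable {P : Submodule (UhBar m) (ABar m n)} (hP : idealJBar m n ≤ P)

/-- After σ_c the generator F becomes E, handled by `series_E`, and every other generator stays in
`nilLeft`, handled by `series_eq_zero`. -/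
theorem series_permA_idealJ {X : AlgA m n} (hX : X ∈ idealJ m n) :
    (rankOne c P hP).series (permA n (simpleRefl c) X) = 0 := by
  -- A free right factor Y turns the induction over the right ideal into an induction over its
  -- generators.
  suffices ∀ Y, (rankOne c P hP).series (permA n (simpleRefl c) (X * Y)) = 0 by
    simpa using this 1
  induction hX using Submodule.span_induction with
  | mem X hX =>
    obtain ⟨a, b, hab, rfl⟩ := hX
    intro Y
    rw [permA_mul, permA_diagE]
    by_cases hne : a = lo c ∧ b = hi c
    · obtain ⟨rfl, rfl⟩ := hne
      rw [simpleRefl_lo, simpleRefl_hi]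
      exact RankOne.series_E (rankOne_nil c P hP) _
    · obtain ⟨h1, h2⟩ := simpleRefl_lt c hab hne
      exact RankOne.series_eq_zero (D := rankOne c P hP) (K := nilLeft n c)
        (fun Y hY => adF_mem_nilLeft c hY) (fun Y hY => E_mul_mem_nilLeft c hY)
        (fun Y hY => projBar_eq_zero hP (nilLeft_le_idealJ c hY)) (mem_nilLeft c h1 h2 _)
  | zero =>
    intro Y
    rw [zero_mul, map_zero]
    simpa using RankOne.series_E (rankOne_nil c P hP) 0
  | add x y _ _ hx hy =>
    intro Y
    rw [add_mul, map_add, RankOne.series_add (rankOne_nil c P hP), hx, hy, add_zero]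
  | smul z x _ hx =>
    intro Y
    have : z • x = x * z.unop := rfl
    rw [this, mul_assoc]
    exact hx _

/-- Each Cartan generator passes through the series with the shift e of `series_left`, here the
label of ε_c; this is the shift built into `twist`. -/
theorem series_smul (p : Uh m) (Y : AlgA m n) :
    (rankOne c P hP).series (p • Y)
      = algebraMap (Uh m) (UhBar m) (shiftUh c p) • (rankOne c P hP).series Y := by
  have hnil := rankOne_nil c P hP
  induction p using MvPolynomial.induction_on generalizing Y with
  | C z =>
    have h := RankOne.series_left hnil (G := algebraMap ℂ (AlgA m n) z) (e := 0)
      (g := algebraMap ℂ (UhBar m) z)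
      (by rw [Algebra.commutes, sub_self, zero_smul]) (by rw [Algebra.commutes, sub_self, zero_smul])
      (fun Y => by rw [← Algebra.smul_def]; exact projBar_smul_complex P z Y) Y
    rw [Int.cast_zero, add_zero] at h
    rw [← MvPolynomial.algebraMap_eq, algebraMap_smul, Algebra.smul_def, h, AlgHom.commutes,
      ← IsScalarTower.algebraMap_apply]
  | add p q hp hq =>
    rw [add_smul, RankOne.series_add hnil, hp, hq, map_add, map_add, add_smul]
  | mul_X p a hp =>
    have h := RankOne.series_left hnil (diagE_E_comm c a) (diagE_F_comm c a)
      (fun Y => projBar_diagE P a Y) Y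
    rw [mul_smul, hp, uh_smul_def (MvPolynomial.X a), cartanHom_X, h, smul_smul, map_mul, map_mul]
    congr 2
    rw [shiftUh, MvPolynomial.aeval_X, map_add, map_intCast, map_intCast]

theorem permA_smul (σ : Equiv.Perm (Fin m)) (p : Uh m) (Y : AlgA m n) :
    permA n σ (p • Y) = permUh σ p • permA n σ Y := by
  rw [uh_smul_def, permA_mul, permA_cartanHom, uh_smul_def]

theorem twist_algebraMap (p : Uh m) :
    twist c (algebraMap (Uh m) (UhBar m) p)
      = algebraMap (Uh m) (UhBar m) (shiftUh c (permUh (simpleRefl c) p)) := by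
  rw [twist, RingHom.comp_apply, IsLocalization.map_eq, IsLocalization.map_eq]
  rfl

theorem twist_algebraMap_complex (z : ℂ) :
    twist c (algebraMap ℂ (UhBar m) z) = algebraMap ℂ (UhBar m) z := by
  rw [IsScalarTower.algebraMap_apply ℂ (Uh m) (UhBar m), twist_algebraMap, AlgHom.commutes,
    AlgHom.commutes]

/-- Only the values on A are prescribed. Twisted linearity over U(h) extends them to fractions, and
vanishing on J lets the extension pass to the quotient. -/
theorem existsUnique_zhelobenko :
    ∃! f : JBarQuot m n →ₛₗ[twist c] JBarQuot m n, IsZhelobenko n c f := by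
  have hnil := rankOne_nil c (idealJBar m n) le_rfl
  let g : AlgA m n →+ JBarQuot m n :=
    { toFun := fun Y => (rankOne c (idealJBar m n) le_rfl).series (permA n (simpleRefl c) Y)
      map_zero' := series_permA_idealJ c le_rfl (zero_mem _)
      map_add' := fun X Y => by rw [map_add, RankOne.series_add hnil] }
  have hg : ∀ Y, g Y = (idealJBar m n).mkQ (xi c (permA n (simpleRefl c) Y)) := fun Y =>
    (mkQ_xi c _ le_rfl _).symm
  obtain ⟨f, hf, hfu⟩ := existsUnique_localizedModule_lift (denoms m) (twist c) g (fun p Y => by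
    change (rankOne c (idealJBar m n) le_rfl).series (permA n (simpleRefl c) (p • Y)) = _
    rw [permA_smul, series_smul, twist_algebraMap]
    rfl)
  have hker : idealJBar m n ≤ LinearMap.ker f := by
    refine Submodule.span_le.2 ?_
    rintro _ ⟨Y, hY, rfl⟩
    exact (hf Y).trans (series_permA_idealJ c le_rfl hY)
  refine ⟨(idealJBar m n).liftQ f hker, fun Y => ?_, fun f' hf' => ?_⟩
  · rw [← hg, ← hf]
    exact Submodule.liftQ_apply _ _ _
  · have h1 := hfu (f'.comp (idealJBar m n).mkQ) fun Y => (hf' Y).trans (hg Y).symm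
    refine LinearMap.ext fun y => ?_
    obtain ⟨y, rfl⟩ := (idealJBar m n).mkQ_surjective y
    refine (LinearMap.congr_fun h1 y).trans ?_
    exact (Submodule.liftQ_apply _ _ _).symm

/-! ### Descent of the operators to the double quotients -/

/-- The generators of `I_κ` which do not depend on `κ`, with `E_{c,c+1}` removed. -/
def nilRight (n : ℕ) (c : Fin (m - 1)) : Submodule (AlgA m n) (AlgA m n) :=
  Submodule.span (AlgA m n)
    ({Y | ∃ a b : Fin m, a < b ∧ ¬ (a = lo c ∧ b = hi c) ∧ Y = diagE n a b} ∪
      {Y | ∃ (b : Fin m) (k : Fin n), Y = tmulA 1 (opD b k)})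

theorem nilRight_le_idealI (κ : Fin m → ℂ) : nilRight n c ≤ idealI n κ := by
  refine Submodule.span_mono ?_
  rintro _ (⟨a, b, hab, -, rfl⟩ | h)
  · exact Or.inl (Or.inl ⟨a, b, hab, rfl⟩)
  · exact Or.inr h

/-- Bracketing a positive root vector other than E with F gives, up to sign, zero or another such
vector, and bracketing ∂ with γ(F) gives zero or a ∂ up to sign. Removing E is essential, since [F,
E] is a Cartan element. -/
theorem adF_mem_nilRight {X : AlgA m n} (hX : X ∈ nilRight n c) : adF c X ∈ nilRight n c := by
  induction hX using Submodule.span_induction with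
  | mem X hX =>
    rcases hX with ⟨a, b, hab, hne, rfl⟩ | ⟨b, k, rfl⟩
    · rw [adF_diagE]
      refine sub_mem ?_ ?_
      · split_ifs with h
        · subst h
          have hb : b ≠ hi c := fun e => hne ⟨rfl, e⟩
          exact Submodule.subset_span (Or.inl ⟨_, _, hi_lt_of_lo_lt c hab hb,
            fun e => hb e.2, rfl⟩)
        · exact zero_mem _
      · split_ifs with h
        · subst h
          have ha : a ≠ lo c := fun e => hne ⟨e, rfl⟩
          exact Submodule.subset_span (Or.inl ⟨_, _, lt_lo_of_lt_hi c hab ha,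
            fun e => ha e.1, rfl⟩)
        · exact zero_mem _
    · rw [← inclGD_apply, adF_inclGD, gammaE_comm_opD]
      split_ifs with h
      · rw [map_neg]
        exact neg_mem (Submodule.subset_span (Or.inr ⟨_, _, rfl⟩))
      · rw [map_zero]; exact zero_mem _
  | zero => rw [adF, mul_zero, zero_mul, sub_zero]; exact zero_mem _
  | add x y _ _ hx hy =>
    have : adF c (x + y) = adF c x + adF c y := by simp only [adF, mul_add, add_mul]; abel
    rw [this]; exact add_mem hx hy
  | smul z x hx' hx =>
    rw [smul_eq_mul, adF_mul]
    exact add_mem (Submodule.smul_mem _ _ hx') (Submodule.smul_mem _ _ hx)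

theorem dot_simpleRefl (κ : Fin m → ℂ) (a : Fin m) :
    dot (simpleRefl c) κ (simpleRefl c a) + (simpleRoot c (simpleRefl c a) : ℂ) = κ a := by
  rw [dot, Equiv.symm_apply_apply]
  by_cases h1 : a = lo c
  · subst h1
    rw [simpleRefl_lo, simpleRoot_hi, rhoWt, rhoWt, lo, hi]
    push_cast; ring
  by_cases h2 : a = hi c
  · subst h2
    rw [simpleRefl_hi, simpleRoot_lo, rhoWt, rhoWt, lo, hi]
    push_cast; ring
  · rw [simpleRefl_of_ne c h1 h2]
    simp [simpleRoot, h1, h2]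

theorem projBar_idealI {κ : Fin m → ℂ} (hI : idealIBar n κ ≤ P) {Y : AlgA m n}
    (hY : Y ∈ idealI n κ) : projBar P Y = 0 :=
  (Submodule.Quotient.mk_eq_zero P).2 (hI (Submodule.subset_span ⟨Y, hY, rfl⟩))

/-- Under σ_c the generator E becomes F on the right, killed by `series_mul_F`; the other positive
root vectors and all ∂ stay in `nilRight`; the Cartan generators are treated by `series_right`. -/
theorem series_permA_idealI {κ : Fin m → ℂ} (hI : idealIBar n (dot (simpleRefl c) κ) ≤ P)
    {X : AlgA m n} (hX : X ∈ idealI n κ) :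
    (rankOne c P hP).series (permA n (simpleRefl c) X) = 0 := by
  have hnil := rankOne_nil c P hP
  have hzero : (rankOne c P hP).series 0 = 0 := by
    simpa using RankOne.series_E hnil 0
  have hright : ∀ Y ∈ nilRight n c, (rankOne c P hP).series Y = 0 := fun Y hY =>
    RankOne.series_eq_zero (D := rankOne c P hP) (K := nilRight n c)
      (fun Y hY => adF_mem_nilRight c hY) (fun Y hY => Submodule.smul_mem _ _ hY)
      (fun Y hY => projBar_idealI hI (nilRight_le_idealI c _ hY)) hY
  suffices ∀ Y, (rankOne c P hP).series (permA n (simpleRefl c) (Y * X)) = 0 by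
    simpa using this 1
  induction hX using Submodule.span_induction with
  | mem X hX =>
    intro Y
    rw [permA_mul]
    rcases hX with (⟨a, b, hab, rfl⟩ | ⟨a, rfl⟩) | ⟨b, k, rfl⟩
    · rw [permA_diagE]
      by_cases hne : a = lo c ∧ b = hi c
      · obtain ⟨rfl, rfl⟩ := hne
        rw [simpleRefl_lo, simpleRefl_hi]
        exact RankOne.series_mul_F hnil _
      · obtain ⟨h1, h2⟩ := simpleRefl_lt c hab hne
        exact hright _ (Submodule.smul_mem _ _ (Submodule.subset_span (Or.inl ⟨_, _, h1, h2, rfl⟩)))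
    · rw [map_sub, permA_diagE, permA_algebraMap, mul_sub, sub_eq_add_neg,
        RankOne.series_add hnil, ← mul_neg, ← map_neg]
      set Z := permA n (simpleRefl c) Y
      set a' := simpleRefl c a with ha'
      -- Modulo Ī for σ_c ∘ κ, right multiplication by E_a'a' is a scalar. The series adds the label
      -- of ε_c to it, which by `dot_simpleRefl` restores κ_a and cancels the constant term computed
      -- next.
      have h1 := RankOne.series_right hnil (diagE_F_comm c a')
        (k := algebraMap ℂ (UhBar m) (dot (simpleRefl c) κ a')) (fun Y => by
          change projBar P _ = _ • projBar P _
          rw [← projBar_smul_complex, ← sub_eq_zero, ← map_sub, Algebra.smul_def,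
            Algebra.commutes, ← mul_sub]
          exact projBar_idealI hI (Submodule.smul_mem _ _
            (Submodule.subset_span (Or.inl (Or.inr ⟨a', rfl⟩))))) Z
      have h2 := RankOne.series_right hnil (G := algebraMap ℂ (AlgA m n) (-κ a)) (e := 0)
        (k := algebraMap ℂ (UhBar m) (-κ a))
        (by rw [← Algebra.commutes, sub_self, zero_smul])
        (fun Y => by
          rw [← Algebra.commutes, ← Algebra.smul_def]; exact projBar_smul_complex P _ Y) Z
      rw [h1, h2, ← add_smul, ← dot_simpleRefl c κ a, ← ha', map_neg, map_add, map_intCast,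
        Int.cast_zero, add_zero, add_neg_cancel, zero_smul]
    · rw [permA_tmulA, map_one, permGD_opD]
      exact hright _ (Submodule.smul_mem _ _ (Submodule.subset_span (Or.inr ⟨_, _, rfl⟩)))
  | zero =>
    intro Y
    rw [mul_zero, map_zero]
    exact hzero
  | add x y _ _ hx hy =>
    intro Y
    rw [mul_add, map_add, RankOne.series_add hnil, hx, hy, add_zero]
  | smul z x _ hx =>
    intro Y
    rw [smul_eq_mul, ← mul_assoc]
    exact hx _

theorem toDouble_mkQ (κ : Fin m → ℂ) (y : ABar m n) :
    toDouble n κ ((idealJBar m n).mkQ y) = (idealJBar m n ⊔ idealIBar n κ).mkQ y := rfl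

/-- The Zhelobenko operator descends to the double quotients. -/
theorem IsZhelobenko.toDouble_eq_zero {f : JBarQuot m n →ₛₗ[twist c] JBarQuot m n}
    (hf : IsZhelobenko n c f) (κ : Fin m → ℂ) {y : JBarQuot m n} (hy : toDouble n κ y = 0) :
    toDouble n (dot (simpleRefl c) κ) (f y) = 0 := by
  obtain ⟨y, rfl⟩ := (idealJBar m n).mkQ_surjective y
  set κ' := dot (simpleRefl c) κ
  rw [toDouble_mkQ] at hy
  have hy' : y ∈ idealJBar m n ⊔ idealIBar n κ := (Submodule.Quotient.mk_eq_zero _).1 hy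
  -- As a twisted linear map F has a kernel that is a submodule over the fractions, so it suffices
  -- to check F on the images of J and I_κ.
  let F : ABar m n →ₛₗ[twist c] DoubleQuot n κ' :=
    ((toDouble n κ').comp f).comp (idealJBar m n).mkQ
  have hF : ∀ Y, F (toBar Y)
      = (rankOne c _ (le_sup_left : _ ≤ idealJBar m n ⊔ idealIBar n κ')).series
        (permA n (simpleRefl c) Y) := fun Y => by
    change toDouble n κ' (f ((idealJBar m n).mkQ (toBar Y))) = _
    rw [hf, toDouble_mkQ, mkQ_xi]
  have hle : idealJBar m n ⊔ idealIBar n κ ≤ LinearMap.ker F := by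
    refine sup_le (Submodule.span_le.2 ?_) (Submodule.span_le.2 ?_)
    · rintro _ ⟨Y, hY, rfl⟩
      exact (hF Y).trans (series_permA_idealJ c _ hY)
    · rintro _ ⟨Y, hY, rfl⟩
      exact (hF Y).trans (series_permA_idealI c _ le_sup_right hY)
  exact hle hy'

end

section

variable {m n : ℕ}

/-! ## The cyclic generator of `M_κ ⊗ Λ` -/

theorem act_tmulA (κ : Fin m → ℂ) (u : Ugl m) (T : GD m n) (v : Verma κ) (w : Grass m n) :
    act n κ (tmulA u T) (v ⊗ₜ[ℂ] w) = (u • v) ⊗ₜ[ℂ] T w := rfl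

/-- The map `Y ↦ Y (1_κ ⊗ 1)`. -/
def actOne (n : ℕ) (κ : Fin m → ℂ) : AlgA m n →ₗ[ℂ] VermaGrass n κ :=
  LinearMap.applyₗ (hwTensor κ 1) ∘ₗ (act n κ).toLinearMap

theorem actOne_apply (κ : Fin m → ℂ) (Y : AlgA m n) :
    actOne n κ Y = act n κ Y (hwTensor κ 1) := rfl

theorem actOne_mul (κ : Fin m → ℂ) (X Y : AlgA m n) :
    actOne n κ (X * Y) = act n κ X (actOne n κ Y) := by
  rw [actOne_apply, map_mul]; rfl

theorem actOne_tmulA (κ : Fin m → ℂ) (u : Ugl m) (T : GD m n) :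
    actOne n κ (tmulA u T) = (vermaIdeal κ).mkQ u ⊗ₜ[ℂ] T 1 := by
  rw [actOne_apply, hwTensor, act_tmulA, ← map_smul, smul_eq_mul, mul_one]

theorem actOne_eq_map (κ : Fin m → ℂ) :
    (actOne n κ : Ugl m ⊗[ℂ] GD m n →ₗ[ℂ] VermaGrass n κ)
      = TensorProduct.map ((vermaIdeal κ).mkQ.restrictScalars ℂ)
        (LinearMap.applyₗ (1 : Grass m n)) :=
  TensorProduct.ext' fun u T => actOne_tmulA κ u T

theorem applyₗ_one_surjective :
    Function.Surjective (LinearMap.applyₗ (R := ℂ) (1 : Grass m n) : GD m n →ₗ[ℂ] Grass m n) :=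
  fun w => ⟨LinearMap.mulLeft ℂ w, mul_one w⟩

theorem actOne_surjective (κ : Fin m → ℂ) : Function.Surjective (actOne n κ) := by
  have := TensorProduct.map_surjective
    (g := (vermaIdeal κ).mkQ.restrictScalars ℂ) (vermaIdeal κ).mkQ_surjective
    (applyₗ_one_surjective (m := m) (n := n))
  rwa [← actOne_eq_map] at this

theorem inclGD_opD_mem_idealI (κ : Fin m → ℂ) (b : Fin m) (k : Fin n) :
    inclGD m n (opD b k) ∈ idealI n κ := Submodule.subset_span (Or.inr ⟨b, k, rfl⟩)

theorem inclGD_gammaE_mem_idealI (κ : Fin m → ℂ) (a b : Fin m) :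
    inclGD m n (gammaE n a b) ∈ idealI n κ := by
  rw [gammaE, map_sum]
  refine sum_mem fun k _ => ?_
  rw [map_mul]
  exact (idealI n κ).smul_mem _ (inclGD_opD_mem_idealI κ b k)

/-- E_ab ⊗ 1 is the diagonal E_ab minus 1 ⊗ γ(E_ab), and γ(E_ab) ends in derivations, so it lies in
I_κ. -/
theorem inclU_mem_idealI {κ : Fin m → ℂ} {u : Ugl m} (hu : u ∈ vermaIdeal κ) :
    inclU m n u ∈ idealI n κ := by
  induction hu using Submodule.span_induction with
  | mem u hu =>
    rcases hu with ⟨a, b, hab, rfl⟩ | ⟨a, rfl⟩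
    · rw [← add_sub_cancel_right (inclU m n (unitU a b)) (inclGD m n (gammaE n a b)), ← diagE_eq]
      exact sub_mem (Submodule.subset_span (Or.inl (Or.inl ⟨a, b, hab, rfl⟩)))
        (inclGD_gammaE_mem_idealI κ a b)
    · have h : inclU m n (unitU a a - algebraMap ℂ (Ugl m) (κ a))
          = (diagE n a a - algebraMap ℂ (AlgA m n) (κ a)) - inclGD m n (gammaE n a a) := by
        rw [map_sub, AlgHom.commutes, diagE_eq]; abel
      rw [h]
      exact sub_mem (Submodule.subset_span (Or.inl (Or.inr ⟨a, rfl⟩)))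
        (inclGD_gammaE_mem_idealI κ a a)
  | zero => rw [map_zero]; exact zero_mem _
  | add x y _ _ hx hy => rw [map_add]; exact add_mem hx hy
  | smul z x _ hx => rw [smul_eq_mul, map_mul]; exact (idealI n κ).smul_mem _ hx

theorem inclGD_mem_idealI (κ : Fin m → ℂ) {T : GD m n} (hT : T 1 = 0) :
    inclGD m n T ∈ idealI n κ := by
  obtain ⟨S, rfl⟩ := exists_eq_sum_mul_opD hT
  rw [map_sum]
  refine sum_mem fun p _ => ?_
  rw [map_mul]
  exact (idealI n κ).smul_mem _ (inclGD_opD_mem_idealI κ _ _)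

/-- The annihilator of `1_κ ⊗ 1` in `A` is contained in `I_κ`. -/
theorem mem_idealI_of_actOne_eq_zero {κ : Fin m → ℂ} {Y : AlgA m n} (hY : actOne n κ Y = 0) :
    Y ∈ idealI n κ := by
  -- `actOne` is the tensor product of two surjections, so its kernel is the sum of the
  -- contributions of the Verma ideal and of the annihilator of 1 in `GD`. Each lies in I_κ.
  have h := TensorProduct.map_ker
    (f := ((vermaIdeal κ).restrictScalars ℂ).subtype)
    (g := (vermaIdeal κ).mkQ.restrictScalars ℂ)
    (f' := (LinearMap.ker (LinearMap.applyₗ (R := ℂ) (1 : Grass m n) :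
      GD m n →ₗ[ℂ] Grass m n)).subtype)
    (g' := LinearMap.applyₗ (R := ℂ) (1 : Grass m n))
    (LinearMap.exact_iff.2 (by
      rw [Submodule.range_subtype]
      ext u
      exact Submodule.Quotient.mk_eq_zero _)) (vermaIdeal κ).mkQ_surjective
    (LinearMap.exact_subtype_ker_map _) applyₗ_one_surjective
  rw [← actOne_eq_map] at h
  have hmem : ∀ Z : Ugl m ⊗[ℂ] GD m n, actOne n κ Z = 0 → Z ∈ _ ⊔ _ := fun Z hZ => by
    rw [← h]; exact hZ
  obtain ⟨Y₁, ⟨Z₁, rfl⟩, Y₂, ⟨Z₂, rfl⟩, rfl⟩ := Submodule.mem_sup.1 (hmem Y hY)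
  clear hmem hY
  refine (idealI n κ).add_mem ?_ ?_
  · induction Z₁ using TensorProduct.induction_on with
    | zero => rw [map_zero]; exact (idealI n κ).zero_mem
    | tmul u T =>
      have : tmulA u (T : GD m n) ∈ idealI n κ := by
        rw [tmulA_eq]
        exact (idealI n κ).smul_mem _ (inclGD_mem_idealI κ T.2)
      exact this
    | add X Y hX hY => rw [map_add]; exact (idealI n κ).add_mem hX hY
  · induction Z₂ using TensorProduct.induction_on with
    | zero => rw [map_zero]; exact (idealI n κ).zero_mem
    | tmul u T =>
      have : tmulA (u : Ugl m) T ∈ idealI n κ := by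
        rw [tmulA_eq, inclU_commute_inclGD]
        exact (idealI n κ).smul_mem _ (inclU_mem_idealI u.2)
      exact this
    | add X Y hX hY => rw [map_add]; exact (idealI n κ).add_mem hX hY

theorem act_unitU_hw (κ : Fin m → ℂ) {a b : Fin m} (hab : a < b) (w : Grass m n) :
    act n κ (diagE n a b) (hwTensor κ w) = hwTensor κ (gammaE n a b w) := by
  have h : (unitU a b : Ugl m) • (vermaIdeal κ).mkQ 1 = 0 := by
    rw [← map_smul, smul_eq_mul, mul_one]
    exact (Submodule.Quotient.mk_eq_zero _).2 (Submodule.subset_span (Or.inl ⟨a, b, hab, rfl⟩))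
  rw [diagE, map_add, LinearMap.add_apply, hwTensor, act_tmulA, act_tmulA, h, one_smul,
    TensorProduct.zero_tmul, zero_add, hwTensor]

theorem act_diagE_self_hw (κ : Fin m → ℂ) (a : Fin m) (w : Grass m n) :
    act n κ (diagE n a a) (hwTensor κ w) = κ a • hwTensor κ w + hwTensor κ (gammaE n a a w) := by
  have h : (unitU a a : Ugl m) • (vermaIdeal κ).mkQ 1 = κ a • (vermaIdeal κ).mkQ 1 := by
    rw [← sub_eq_zero, ← algebraMap_smul (Ugl m) (κ a), ← sub_smul, ← map_smul, smul_eq_mul,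
      mul_one]
    exact (Submodule.Quotient.mk_eq_zero _).2 (Submodule.subset_span (Or.inr ⟨a, rfl⟩))
  rw [diagE, map_add, LinearMap.add_apply, hwTensor, act_tmulA, act_tmulA, h, one_smul,
    TensorProduct.smul_tmul', hwTensor]
  rfl

theorem actOne_mem_idealI (κ : Fin m → ℂ) {Y : AlgA m n} (hY : Y ∈ idealI n κ) :
    actOne n κ Y = 0 := by
  induction hY using Submodule.span_induction with
  | mem Y hY =>
    rw [actOne_apply]
    rcases hY with (⟨a, b, hab, rfl⟩ | ⟨a, rfl⟩) | ⟨b, k, rfl⟩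
    · rw [act_unitU_hw κ hab, gammaE_one, hwTensor, TensorProduct.tmul_zero]
    · rw [map_sub, LinearMap.sub_apply, act_diagE_self_hw, gammaE_one, AlgHom.commutes, hwTensor,
        hwTensor, TensorProduct.tmul_zero, add_zero]
      exact sub_self _
    · rw [hwTensor, act_tmulA, opD_one, TensorProduct.tmul_zero]
  | zero => exact map_zero _
  | add x y _ _ hx hy => rw [map_add, hx, hy, add_zero]
  | smul z x _ hx => rw [smul_eq_mul, actOne_mul, hx, map_zero]

theorem act_mem_nSub (κ : Fin m → ℂ) {Y : AlgA m n} (hY : Y ∈ idealJ m n) (w : VermaGrass n κ) :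
    act n κ Y w ∈ nSub n κ := by
  induction hY using Submodule.span_induction generalizing w with
  | mem Y hY =>
    obtain ⟨a, b, hab, rfl⟩ := hY
    exact Submodule.subset_span ⟨a, b, w, hab, rfl⟩
  | zero => rw [map_zero]; exact zero_mem _
  | add x y _ _ hx hy => rw [map_add]; exact add_mem (hx w) (hy w)
  | smul z x _ hx =>
    have : z • x = x * z.unop := rfl
    rw [this, map_mul]
    exact hx _

/-- Surjectivity of `actOne` lets each generator F w of n·(M ⊗ Λ) be written as the image of F Y. -/
theorem exists_mem_idealJ {κ : Fin m → ℂ} {v : VermaGrass n κ} (hv : v ∈ nSub n κ) :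
    ∃ Y ∈ idealJ m n, actOne n κ Y = v := by
  induction hv using Submodule.span_induction with
  | mem v hv =>
    obtain ⟨a, b, w, hab, rfl⟩ := hv
    obtain ⟨Y, rfl⟩ := actOne_surjective κ w
    exact ⟨_, mul_mem_idealJ hab Y, actOne_mul κ _ _⟩
  | zero => exact ⟨0, zero_mem _, map_zero _⟩
  | add x y _ _ hx hy =>
    obtain ⟨X, hX, rfl⟩ := hx
    obtain ⟨Y, hY, rfl⟩ := hy
    exact ⟨X + Y, add_mem hX hY, map_add _ _ _⟩
  | smul z x _ hx =>
    obtain ⟨X, hX, rfl⟩ := hx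
    refine ⟨z • X, ?_, map_smul _ _ _⟩
    have : z • X = MulOpposite.op (algebraMap ℂ (AlgA m n) z) • X := by
      change _ = X * algebraMap ℂ (AlgA m n) z
      rw [← Algebra.commutes, Algebra.smul_def]
    rw [this]
    exact Submodule.smul_mem _ _ hX

/-! ## The action of `U(h)` on the coinvariants -/

theorem nSub_le_comap_cartanHom (κ : Fin m → ℂ) (p : Uh m) :
    nSub n κ ≤ (nSub n κ).comap (act n κ (cartanHom m n p)) := by
  induction p using MvPolynomial.induction_on with
  | C z =>
    intro v hv
    rw [← MvPolynomial.algebraMap_eq, AlgHom.commutes, Submodule.mem_comap, AlgHom.commutes]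
    exact Submodule.smul_mem _ z hv
  | add p q hp hq =>
    intro v hv
    rw [map_add, map_add, Submodule.mem_comap, LinearMap.add_apply]
    exact add_mem (hp hv) (hq hv)
  | mul_X p a hp =>
    intro v hv
    rw [map_mul, map_mul, cartanHom_X]
    exact hp (nSub_le_comap n κ a hv)

/-- The action of `U(h)` on the coinvariants. -/
def cartanCoinv (n : ℕ) (κ : Fin m → ℂ) : Uh m →+* Module.End ℂ (Coinv n κ) where
  toFun p := (nSub n κ).mapQ (nSub n κ) (act n κ (cartanHom m n p)) (nSub_le_comap_cartanHom κ p)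
  map_one' := by
    refine Submodule.linearMap_qext _ (LinearMap.ext fun v => ?_)
    simp only [map_one]
    rfl
  map_mul' p q := by
    refine Submodule.linearMap_qext _ (LinearMap.ext fun v => ?_)
    simp only [map_mul]
    rfl
  map_zero' := by
    refine Submodule.linearMap_qext _ (LinearMap.ext fun v => ?_)
    simp only [map_zero]
    rfl
  map_add' p q := by
    refine Submodule.linearMap_qext _ (LinearMap.ext fun v => ?_)
    simp only [map_add]
    rfl

theorem cartanCoinv_mkQ (κ : Fin m → ℂ) (p : Uh m) (v : VermaGrass n κ) :
    cartanCoinv n κ p ((nSub n κ).mkQ v) = (nSub n κ).mkQ (act n κ (cartanHom m n p) v) := rfl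

theorem cartanCoinv_X (κ : Fin m → ℂ) (a : Fin m) :
    cartanCoinv n κ (MvPolynomial.X a) = cartanAct n κ a := by
  refine Submodule.linearMap_qext _ (LinearMap.ext fun v => ?_)
  simp only [LinearMap.comp_apply, cartanCoinv_mkQ, cartanHom_X]
  rfl

theorem cartanCoinv_C (κ : Fin m → ℂ) (z : ℂ) (v : Coinv n κ) :
    cartanCoinv n κ (MvPolynomial.C z) v = z • v := by
  obtain ⟨v, rfl⟩ := (nSub n κ).mkQ_surjective v
  rw [cartanCoinv_mkQ, ← MvPolynomial.algebraMap_eq, AlgHom.commutes, AlgHom.commutes]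
  rfl

/-- The coinvariants as a module over `U(h)`. -/
@[reducible] def coinvModule (n : ℕ) (κ : Fin m → ℂ) : Module (Uh m) (Coinv n κ) :=
  Module.compHom (Coinv n κ) (cartanCoinv n κ)

attribute [local instance] coinvModule

theorem uh_smul_coinv (κ : Fin m → ℂ) (p : Uh m) (v : Coinv n κ) :
    p • v = cartanCoinv n κ p v := rfl

/-- The sum of the eigenspaces with eigenvalues in `z + ℤ`. -/
def intEigen {V : Type*} [AddCommGroup V] [Module ℂ V] (D : Module.End ℂ V) (z : ℂ) :
    Submodule ℂ V := ⨆ k : ℤ, Module.End.eigenspace D (z + k)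

theorem apply_mem_intEigen {V : Type*} [AddCommGroup V] [Module ℂ V] {D T : Module.End ℂ V}
    {z : ℂ} {j : ℤ} (h : D * T - T * D = j • T) {v : V} (hv : v ∈ intEigen D z) :
    T v ∈ intEigen D z := by
  have hle : intEigen D z ≤ (intEigen D z).comap T := by
    refine iSup_le fun k v hv => ?_
    refine Submodule.mem_iSup_of_mem (k + j) (Module.End.mem_eigenspace_iff.2 ?_)
    have h1 := LinearMap.congr_fun h v
    rw [LinearMap.sub_apply, sub_eq_iff_eq_add] at h1
    change D (T v) = _ at h1
    rw [h1, Module.End.mul_apply, Module.End.mem_eigenspace_iff.1 hv, map_smul,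
      LinearMap.smul_apply]
    push_cast
    module
  exact hle hv

/-- The cyclic vector is an eigenvector with eigenvalue κ_a - κ_b, and the E_cd ⊗ 1 and x_ck, which
generate everything from it, shift the eigenvalue by integers. -/
theorem intEigen_act_eq_top (κ : Fin m → ℂ) (a b : Fin m) :
    intEigen (act n κ (diagE n a a - diagE n b b)) (κ a - κ b) = ⊤ := by
  set D := act n κ (diagE n a a - diagE n b b) with hD
  set W := intEigen D (κ a - κ b) with hW
  have h1 : hwTensor κ 1 ∈ W := by
    refine Submodule.mem_iSup_of_mem 0 (Module.End.mem_eigenspace_iff.2 ?_)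
    rw [hD, map_sub, LinearMap.sub_apply, act_diagE_self_hw, act_diagE_self_hw, gammaE_one,
      gammaE_one, hwTensor, hwTensor, TensorProduct.tmul_zero]
    push_cast
    module
  have hcomm : ∀ (X : AlgA m n) (j : ℤ),
      (diagE n a a - diagE n b b) * X - X * (diagE n a a - diagE n b b) = j • X →
      ∀ v ∈ W, act n κ X v ∈ W := fun X j h v hv => by
    refine apply_mem_intEigen (j := j) ?_ hv
    rw [hD, ← map_mul, ← map_mul]
    exact (map_sub (act n κ) _ _).symm.trans (by rw [h, map_zsmul])
  have hU : ∀ (u : Ugl m), ∀ v ∈ W, act n κ (inclU m n u) v ∈ W := fun u => by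
    refine ugl_induction (P := fun u => ∀ v ∈ W, act n κ (inclU m n u) v ∈ W) ?_ ?_ ?_ ?_ u
    · intro c d
      refine hcomm _ ((if a = c then 1 else 0) - (if a = d then 1 else 0)
        - ((if b = c then 1 else 0) - (if b = d then 1 else 0))) ?_
      have h2 : ∀ a : Fin m, diagE n a a * inclU m n (unitU c d)
          - inclU m n (unitU c d) * diagE n a a
          = ((if a = c then 1 else 0) - (if a = d then 1 else 0) : ℤ)
            • inclU m n (unitU c d) := fun a => by
        rw [diagE_eq, add_mul, mul_add, ← inclU_commute_inclGD, add_sub_add_right_eq_sub,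
          ← map_mul, ← map_mul, ← map_sub, unitU_comm, sub_smul, map_sub]
        congr 1
        · split_ifs with e
          · subst e; rw [one_smul]
          · rw [zero_smul, map_zero]
        · split_ifs with e
          · subst e; rw [one_smul]
          · rw [zero_smul, map_zero]
      rw [sub_smul _ _ (inclU m n (unitU c d)), ← h2, ← h2]
      simp only [sub_mul, mul_sub]
      abel
    · intro z v hv
      rw [AlgHom.commutes, AlgHom.commutes]
      exact W.smul_mem z hv
    · intro u u' hu hu' v hv
      rw [map_add, map_add]
      exact add_mem (hu v hv) (hu' v hv)
    · intro u u' hu hu' v hv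
      rw [map_mul, map_mul]
      exact hu _ (hu' v hv)
  have hX : ∀ (c : Fin m) (k : Fin n), ∀ v ∈ W, act n κ (inclGD m n (opX c k)) v ∈ W := by
    intro c k
    refine hcomm _ ((if a = c then 1 else 0) - (if b = c then 1 else 0)) ?_
    have h2 : ∀ a : Fin m, diagE n a a * inclGD m n (opX c k) - inclGD m n (opX c k) * diagE n a a
        = (if a = c then 1 else 0 : ℤ) • inclGD m n (opX c k) := fun a => by
      rw [diagE_eq, add_mul, mul_add, inclU_commute_inclGD, add_sub_add_left_eq_sub,
        ← map_mul, ← map_mul, ← map_sub, gammaE_comm_opX]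
      split_ifs with e
      · subst e; rw [one_smul]
      · rw [zero_smul, map_zero]
    rw [sub_smul _ _ (inclGD m n (opX c k)), ← h2, ← h2]
    simp only [sub_mul, mul_sub]
    abel
  have hw : ∀ w : Grass m n, hwTensor κ w ∈ W := fun w => by
    refine grass_induction (P := fun w => hwTensor κ w ∈ W) ?_ h1 ?_ ?_ ?_ w
    · rw [hwTensor, TensorProduct.tmul_zero]; exact zero_mem _
    · intro v w hv hw
      rw [hwTensor, TensorProduct.tmul_add]; exact add_mem hv hw
    · intro z v hv
      rw [hwTensor, TensorProduct.tmul_smul]; exact W.smul_mem z hv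
    · intro c k v hv
      have := hX c k _ hv
      rwa [inclGD_apply, hwTensor, act_tmulA, one_smul] at this
  refine eq_top_iff.2 fun v _ => ?_
  induction v using TensorProduct.induction_on with
  | zero => exact zero_mem _
  | tmul v w =>
    obtain ⟨u, rfl⟩ := (vermaIdeal κ).mkQ_surjective v
    have := hU u _ (hw w)
    rwa [inclU_apply, hwTensor, act_tmulA, ← map_smul, smul_eq_mul, mul_one] at this
  | add x y hx hy => exact add_mem (hx trivial) (hy trivial)

/-- On coinvariants E_aa - E_bb is diagonalisable with eigenvalues in κ_a - κ_b + ℤ, so by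
genericity -z is not an eigenvalue and the denominator is bijective. -/
theorem isUnit_denom_smul {κ : Fin m → ℂ} (hκ : IsGeneric κ) (s : denoms m) :
    IsUnit (algebraMap (Uh m) (Module.End (Uh m) (Coinv n κ)) s) := by
  obtain ⟨s, hs⟩ := s
  induction hs using Submonoid.closure_induction with
  | one => simp
  | mul x y _ _ hx hy => simp only [map_mul]; exact hx.mul hy
  | mem s hs =>
    obtain ⟨a, b, z, hab, rfl⟩ := hs
    set D := cartanCoinv n κ (MvPolynomial.X a - MvPolynomial.X b) with hD
    have htop : intEigen D (κ a - κ b) = ⊤ := by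
      refine eq_top_iff.2 fun v _ => ?_
      obtain ⟨v, rfl⟩ := (nSub n κ).mkQ_surjective v
      have hle : intEigen (act n κ (diagE n a a - diagE n b b)) (κ a - κ b)
          ≤ (intEigen D (κ a - κ b)).comap (nSub n κ).mkQ := by
        refine iSup_le fun k v hv => ?_
        refine Submodule.mem_iSup_of_mem k (Module.End.mem_eigenspace_iff.2 ?_)
        rw [hD, cartanCoinv_mkQ, map_sub, cartanHom_X, cartanHom_X,
          Module.End.mem_eigenspace_iff.1 hv, map_smul]
      rw [intEigen_act_eq_top] at hle
      exact hle trivial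
    have hne : ∀ k : ℤ, κ a - κ b + k + z ≠ 0 := fun k h => hκ a b hab (-(k + z)) (by
      push_cast; linear_combination h)
    have hs : ∀ v : Coinv n κ, (MvPolynomial.X a - MvPolynomial.X b
        + MvPolynomial.C (z : ℂ) : Uh m) • v = D v + (z : ℂ) • v := fun v => by
      rw [uh_smul_coinv, map_add, LinearMap.add_apply, cartanCoinv_C]
    rw [Module.End.isUnit_iff]
    constructor
    · rw [injective_iff_map_eq_zero]
      intro v hv
      change (MvPolynomial.X a - MvPolynomial.X b + MvPolynomial.C (z : ℂ) : Uh m) • v = 0 at hv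
      rw [hs] at hv
      have hv' : v ∈ Module.End.eigenspace D (-z) := Module.End.mem_eigenspace_iff.2 (by
        rw [neg_smul]; exact eq_neg_of_add_eq_zero_left hv)
      -- A vector killed by the denominator is an eigenvector for -z, but the eigenspaces for other
      -- eigenvalues already span, so independence forces it to be zero.
      have hdis := D.eigenspaces_iSupIndep (-z : ℂ)
      have hle : (⊤ : Submodule ℂ (Coinv n κ)) ≤ ⨆ j, ⨆ _ : j ≠ (-z : ℂ), D.eigenspace j := by
        rw [← htop]
        refine iSup_le fun k => le_iSup₂_of_le (κ a - κ b + k) (fun h => hne k ?_) le_rfl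
        rw [h, neg_add_cancel]
      exact (Submodule.disjoint_def.1 hdis) v hv' (hle trivial)
    · intro v
      have hv : v ∈ intEigen D (κ a - κ b) := by rw [htop]; trivial
      -- Surjectivity is checked on each eigenspace by dividing by its nonzero eigenvalue.
      have hle : intEigen D (κ a - κ b) ≤ LinearMap.range (D + (z : ℂ) • LinearMap.id) := by
        refine iSup_le fun k v hv => ?_
        refine ⟨(κ a - κ b + k + z)⁻¹ • v, ?_⟩
        rw [map_smul, LinearMap.add_apply, Module.End.mem_eigenspace_iff.1 hv,
          LinearMap.smul_apply, LinearMap.id_apply, ← add_smul, smul_smul,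
          inv_mul_cancel₀ (hne k), one_smul]
      obtain ⟨w, rfl⟩ := hle hv
      exact ⟨w, hs w⟩

/-! ## The identification of the double quotient -/

/-- The map from the fractions of `A` to the coinvariants. -/
def barToCoinv (n : ℕ) {κ : Fin m → ℂ} (hκ : IsGeneric κ) : ABar m n →ₗ[Uh m] Coinv n κ :=
  LocalizedModule.lift (denoms m)
    { toFun := fun Y => (nSub n κ).mkQ (actOne n κ Y)
      map_add' := fun X Y => by rw [map_add, map_add]
      map_smul' := fun p Y => by
        rw [uh_smul_def, actOne_mul, RingHom.id_apply, uh_smul_coinv, cartanCoinv_mkQ] }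
    (isUnit_denom_smul hκ)

theorem barToCoinv_toBar {κ : Fin m → ℂ} (hκ : IsGeneric κ) (Y : AlgA m n) :
    barToCoinv n hκ (toBar Y) = (nSub n κ).mkQ (actOne n κ Y) :=
  LocalizedModule.lift_mk_one _ _ _ _

theorem denom_smul_coinv_inj {κ : Fin m → ℂ} (hκ : IsGeneric κ) (s : denoms m) {v : Coinv n κ}
    (h : (s : Uh m) • v = 0) : v = 0 :=
  (injective_iff_map_eq_zero _).1 ((Module.End.isUnit_iff _).1 (isUnit_denom_smul hκ s)).1 v h

/-- The lift is linear only over U(h). Stability of its kernel under fractions follows since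
denominators act injectively on coinvariants. -/
theorem barToCoinv_smul_eq_zero {κ : Fin m → ℂ} (hκ : IsGeneric κ) (z : UhBar m) {y : ABar m n}
    (hy : barToCoinv n hκ y = 0) : barToCoinv n hκ (z • y) = 0 := by
  induction z using Localization.induction_on with
  | H p =>
    obtain ⟨p, s⟩ := p
    refine denom_smul_coinv_inj hκ s ?_
    have h : (s : Uh m) • (Localization.mk p s : UhBar m) • y = p • y := by
      rw [← algebraMap_smul (UhBar m) (s : Uh m), ← algebraMap_smul (UhBar m) p, smul_smul,
        ← Localization.mk_one_eq_algebraMap, ← Localization.mk_one_eq_algebraMap,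
        Localization.mk_mul]
      congr 1
      rw [Localization.mk_eq_mk_iff, Localization.r_iff_exists]
      exact ⟨1, by simp⟩
    rw [← map_smul, h, map_smul, hy, smul_zero]

/-- If Y/s maps to zero, then Y(1_κ ⊗ 1) lies in n·(M ⊗ Λ) and equals X(1_κ ⊗ 1) for some X in J. So
Y - X annihilates the cyclic vector and lies in I_κ. -/
theorem barToCoinv_eq_zero {κ : Fin m → ℂ} (hκ : IsGeneric κ) {y : ABar m n} :
    barToCoinv n hκ y = 0 ↔ y ∈ idealJBar m n ⊔ idealIBar n κ := by
  constructor
  · intro h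
    induction y using LocalizedModule.induction_on with
    | h Y s =>
      have hs : (s : Uh m) • LocalizedModule.mk Y s = (toBar Y : ABar m n) := by
        rw [LocalizedModule.smul'_mk]; exact LocalizedModule.mk_cancel s Y
      have hmk : (LocalizedModule.mk Y s : ABar m n) = (Localization.mk 1 s : UhBar m) • toBar Y := by
        rw [toBar, LocalizedModule.mk_smul_mk, one_smul, mul_one]
      have h1 : (nSub n κ).mkQ (actOne n κ Y) = 0 := by
        rw [← barToCoinv_toBar hκ, ← hs, map_smul, h, smul_zero]
      obtain ⟨X, hX, hXY⟩ := exists_mem_idealJ ((Submodule.Quotient.mk_eq_zero _).1 h1)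
      have h2 : Y - X ∈ idealI n κ := mem_idealI_of_actOne_eq_zero (by
        rw [map_sub, hXY, sub_self])
      have h3 : (toBar Y : ABar m n) = toBar X + toBar (Y - X) := by
        rw [toBar, toBar, toBar, ← LocalizedModule.mkLinearMap_apply,
          ← LocalizedModule.mkLinearMap_apply, ← LocalizedModule.mkLinearMap_apply, ← map_add,
          add_sub_cancel]
      rw [hmk, h3]
      exact Submodule.smul_mem _ _ (Submodule.add_mem_sup (Submodule.subset_span ⟨X, hX, rfl⟩)
        (Submodule.subset_span ⟨_, h2, rfl⟩))
  · intro h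
    let K : Submodule (UhBar m) (ABar m n) :=
      { carrier := {y | barToCoinv n hκ y = 0}
        zero_mem' := map_zero _
        add_mem' := fun {x y} hx hy => by
          change barToCoinv n hκ (x + y) = 0
          rw [map_add, show barToCoinv n hκ x = 0 from hx, show barToCoinv n hκ y = 0 from hy,
            add_zero]
        smul_mem' := fun z y hy => barToCoinv_smul_eq_zero hκ z hy }
    have hle : idealJBar m n ⊔ idealIBar n κ ≤ K := by
      refine sup_le (Submodule.span_le.2 ?_) (Submodule.span_le.2 ?_)
      · rintro _ ⟨Y, hY, rfl⟩
        exact (barToCoinv_toBar hκ Y).trans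
          ((Submodule.Quotient.mk_eq_zero _).2 (act_mem_nSub κ hY _))
      · rintro _ ⟨Y, hY, rfl⟩
        refine (barToCoinv_toBar hκ Y).trans ?_
        rw [actOne_mem_idealI κ hY, map_zero]
    exact hle h

theorem barToCoinv_complex_smul {κ : Fin m → ℂ} (hκ : IsGeneric κ) (z : ℂ) (y : ABar m n) :
    barToCoinv n hκ (z • y) = z • barToCoinv n hκ y := by
  rw [← algebraMap_smul (Uh m) z y, map_smul, uh_smul_coinv, MvPolynomial.algebraMap_eq,
    cartanCoinv_C]

/-- The identification of the double quotient with the coinvariants. -/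
def identification (n : ℕ) {κ : Fin m → ℂ} (hκ : IsGeneric κ) : DoubleQuot n κ ≃ₗ[ℂ] Coinv n κ :=
  let P := idealJBar m n ⊔ idealIBar n κ
  let f : ABar m n →ₗ[ℂ] Coinv n κ :=
    { toFun := barToCoinv n hκ
      map_add' := map_add _
      map_smul' := barToCoinv_complex_smul hκ }
  (Submodule.Quotient.restrictScalarsEquiv ℂ P).symm ≪≫ₗ
    LinearEquiv.ofBijective
      ((P.restrictScalars ℂ).liftQ f fun _ hy => (barToCoinv_eq_zero hκ).2 hy) (by
        constructor
        · refine LinearMap.ker_eq_bot.1 (Submodule.ker_liftQ_eq_bot _ _ _ fun y hy => ?_)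
          exact (barToCoinv_eq_zero hκ).1 hy
        · intro v
          obtain ⟨v, rfl⟩ := (nSub n κ).mkQ_surjective v
          obtain ⟨Y, rfl⟩ := actOne_surjective κ v
          exact ⟨Submodule.Quotient.mk (toBar Y), barToCoinv_toBar hκ Y⟩)

theorem identification_mkQ {κ : Fin m → ℂ} (hκ : IsGeneric κ) (y : ABar m n) :
    identification n hκ ((idealJBar m n ⊔ idealIBar n κ).mkQ y) = barToCoinv n hκ y := rfl

theorem isIdentification_identification {κ : Fin m → ℂ} (hκ : IsGeneric κ) :
    IsIdentification n κ (identification n hκ) := fun Y => by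
  rw [identification_mkQ, barToCoinv_toBar, actOne_apply]

/-- The prescription fixes the inverses, because every coinvariant is the class of some Y(1_κ ⊗ 1).
-/
theorem IsIdentification.eq {κ : Fin m → ℂ} {Φ Ψ : DoubleQuot n κ ≃ₗ[ℂ] Coinv n κ}
    (hΦ : IsIdentification n κ Φ) (hΨ : IsIdentification n κ Ψ) : Φ = Ψ := by
  have h : Φ.symm = Ψ.symm := by
    refine LinearEquiv.ext fun v => ?_
    obtain ⟨v, rfl⟩ := (nSub n κ).mkQ_surjective v
    obtain ⟨Y, rfl⟩ := actOne_surjective κ v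
    rw [LinearEquiv.symm_apply_eq, actOne_apply, ← hΨ, LinearEquiv.symm_apply_apply, hΦ, hΨ]
  rw [← LinearEquiv.symm_symm Φ, h, LinearEquiv.symm_symm]

theorem existsUnique_identification {κ : Fin m → ℂ} (hκ : IsGeneric κ) :
    ∃! Φ : DoubleQuot n κ ≃ₗ[ℂ] Coinv n κ, IsIdentification n κ Φ :=
  ⟨identification n hκ, isIdentification_identification hκ,
    fun _ hΦ => hΦ.eq (isIdentification_identification hκ)⟩

end

section

variable {m n : ℕ}

/-! ## The Yangian -/

/-- The matrix with the entries `E_{ba}`. -/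
def genMat (m : ℕ) : Matrix (Fin m) (Fin m) (Ugl m) := fun a b => unitU b a

theorem genMat_pow_succ (s : ℕ) (c d : Fin m) :
    (genMat m ^ (s + 1)) c d = ∑ e, (genMat m ^ s) c e * unitU d e := by
  rw [pow_succ, Matrix.mul_apply]; rfl

theorem genMat_pow_add (r s : ℕ) (c d : Fin m) :
    (genMat m ^ (r + s)) c d = ∑ e, (genMat m ^ r) c e * (genMat m ^ s) e d := by
  rw [pow_add, Matrix.mul_apply]

/-- The entries of every power of the generator matrix transform under ad `gl_m` like the entries of
the matrix itself. -/
theorem unitU_comm_genMat_pow (s : ℕ) (a b c d : Fin m) :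
    unitU a b * (genMat m ^ s) c d - (genMat m ^ s) c d * unitU a b
      = (if b = d then (genMat m ^ s) c a else 0) - (if a = c then (genMat m ^ s) b d else 0) := by
  induction s generalizing c d with
  | zero =>
    simp only [pow_zero, Matrix.one_apply, mul_ite, ite_mul, mul_one, one_mul, mul_zero, zero_mul,
      sub_self]
    by_cases h1 : b = d <;> by_cases h2 : a = c <;> simp [h1, h2, eq_comm]
  | succ s ih =>
    have h : ∀ e, unitU a b * ((genMat m ^ s) c e * unitU d e)
        - (genMat m ^ s) c e * unitU d e * unitU a b
        = ((if b = e then (genMat m ^ s) c a * unitU d e else 0)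
          - (if a = c then (genMat m ^ s) b e * unitU d e else 0))
          + ((if b = d then (genMat m ^ s) c e * unitU a e else 0)
          - (if a = e then (genMat m ^ s) c e * unitU d b else 0)) := fun e => by
      have h1 := congrArg (· * unitU d e) (ih c e)
      have h2 := congrArg ((genMat m ^ s) c e * ·) (unitU_comm a b d e)
      simp only [sub_mul, mul_sub, ite_mul, mul_ite, zero_mul, mul_zero] at h1 h2
      rw [← h1, ← h2]
      simp only [mul_assoc]
      abel
    simp only [genMat_pow_succ, Finset.mul_sum, Finset.sum_mul]
    rw [← Finset.sum_sub_distrib, Finset.sum_congr rfl fun e _ => h e]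
    simp only [Finset.sum_add_distrib, Finset.sum_sub_distrib, Finset.sum_ite_eq,
      Finset.mem_univ, if_true]
    have e1 : ∑ e, (if a = c then (genMat m ^ s) b e * unitU d e else 0)
        = if a = c then ∑ e, (genMat m ^ s) b e * unitU d e else 0 := by
      split_ifs <;> simp
    have e2 : ∑ e, (if b = d then (genMat m ^ s) c e * unitU a e else 0)
        = if b = d then ∑ e, (genMat m ^ s) c e * unitU a e else 0 := by
      split_ifs <;> simp
    rw [e1, e2]
    abel

theorem genMat_comm_succ (r s : ℕ) (a b c d : Fin m) :
    (genMat m ^ r) a b * (genMat m ^ (s + 1)) c d - (genMat m ^ (s + 1)) c d * (genMat m ^ r) a b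
      = ∑ e, ((genMat m ^ r) a b * (genMat m ^ s) c e - (genMat m ^ s) c e * (genMat m ^ r) a b)
          * unitU d e
        + ((if a = d then (genMat m ^ (s + r)) c b else 0)
          - (genMat m ^ s) c b * (genMat m ^ r) a d) := by
  have h : ∀ e, (genMat m ^ r) a b * ((genMat m ^ s) c e * unitU d e)
      - (genMat m ^ s) c e * unitU d e * (genMat m ^ r) a b
      = ((genMat m ^ r) a b * (genMat m ^ s) c e - (genMat m ^ s) c e * (genMat m ^ r) a b)
          * unitU d e
        + ((if a = d then (genMat m ^ s) c e * (genMat m ^ r) e b else 0)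
          - (if e = b then (genMat m ^ s) c e * (genMat m ^ r) a d else 0)) := fun e => by
    have h1 := congrArg ((genMat m ^ s) c e * ·) (unitU_comm_genMat_pow r d e a b)
    simp only [mul_sub, mul_ite, mul_zero] at h1
    simp only [eq_comm (a := a) (b := d)]
    refine Eq.trans ?_ (congrArg (_ + ·) ((congrArg Neg.neg h1).trans (neg_sub _ _)))
    simp only [sub_mul, mul_assoc]
    abel
  simp only [genMat_pow_succ, Finset.mul_sum, Finset.sum_mul]
  rw [← Finset.sum_sub_distrib, Finset.sum_congr rfl fun e _ => h e]
  simp only [Finset.sum_add_distrib, Finset.sum_sub_distrib, Finset.sum_ite_eq', Finset.mem_univ,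
    if_true]
  congr 2
  rw [genMat_pow_add]
  split_ifs <;> simp

/-- The coefficient form of the RTT relation for the powers of the generator matrix. Induction on s
peels one factor off the second power; the peeled factor is the same throughout and the remaining
contractions telescope. -/
theorem genMat_relation (r s : ℕ) (a b c d : Fin m) :
    ((genMat m ^ (r + 1)) a b * (genMat m ^ s) c d - (genMat m ^ s) c d * (genMat m ^ (r + 1)) a b)
      - ((genMat m ^ r) a b * (genMat m ^ (s + 1)) c d
        - (genMat m ^ (s + 1)) c d * (genMat m ^ r) a b)
      = (genMat m ^ s) c b * (genMat m ^ r) a d - (genMat m ^ r) c b * (genMat m ^ s) a d := by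
  induction s generalizing c d with
  | zero =>
    rw [genMat_comm_succ]
    simp only [pow_zero, Matrix.one_apply, mul_ite, ite_mul, mul_one, one_mul, mul_zero, zero_mul,
      sub_self, Finset.sum_const_zero, zero_add]
    abel
  | succ s ih =>
    rw [genMat_comm_succ (r + 1) s, genMat_comm_succ r (s + 1), add_sub_add_comm,
      ← Finset.sum_sub_distrib]
    simp only [← sub_mul, ih]
    -- With the exponents matched, the two Kronecker delta terms cancel.
    have e : s + (r + 1) = s + 1 + r := by omega
    simp only [sub_mul, Finset.sum_sub_distrib, mul_assoc, ← Finset.mul_sum, ← genMat_pow_succ, e]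
    abel

/-- A sum over index paths is a matrix power with the endpoints kept free. The arbitrary additive
maps allow the other tensor factor to depend on these endpoints. -/
theorem sum_ofFn_genMat {B : Type*} [AddCommMonoid B] (s : ℕ) (φ : Fin m → Fin m → Ugl m →+ B) :
    ∑ c : Fin (s + 1) → Fin m, φ (c 0) (c (Fin.last s))
        (List.ofFn fun t : Fin s => unitU (c t.succ) (c t.castSucc)).prod
      = ∑ a, ∑ b, φ a b ((genMat m ^ s) a b) := by
  induction s generalizing φ with
  | zero =>
    rw [← (Equiv.funUnique (Fin 1) (Fin m)).symm.sum_comp]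
    refine Finset.sum_congr rfl fun a _ => ?_
    rw [Finset.sum_eq_single a]
    · simp
    · intro b _ hb
      simp [hb.symm]
    · simp
  | succ s ih =>
    have h := ih fun e b => ∑ a, (φ a b).comp (AddMonoidHom.mulLeft (unitU e a))
    simp only [AddMonoidHom.finsetSum_apply, AddMonoidHom.comp_apply,
      AddMonoidHom.coe_mulLeft] at h
    rw [← (Fin.consEquiv fun _ : Fin (s + 2) => Fin m).sum_comp, Fintype.sum_prod_type,
      Finset.sum_comm]
    refine Eq.trans (Finset.sum_congr rfl fun c _ => Finset.sum_congr rfl fun a _ => ?_)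
      (h.trans ?_)
    · simp only [Fin.consEquiv_apply]
      rw [List.ofFn_succ, List.prod_cons]
      simp only [← Fin.succ_castSucc, Fin.cons_succ, Fin.castSucc_zero, Fin.cons_zero,
        ← Fin.succ_last]
    · rw [Finset.sum_congr rfl fun e _ => Finset.sum_comm, Finset.sum_comm]
      refine Finset.sum_congr rfl fun a _ => ?_
      rw [Finset.sum_comm]
      refine Finset.sum_congr rfl fun b _ => ?_
      rw [pow_succ', Matrix.mul_apply, map_sum]
      rfl

theorem yangElt_eq (s : ℕ) (i j : Fin n) :
    yangElt m s i j = ∑ a, ∑ b, tmulA ((genMat m ^ s) a b) (opX a i * opD b j) :=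
  sum_ofFn_genMat s fun a b =>
    { toFun := fun u => tmulA u (opX a i * opD b j)
      map_zero' := TensorProduct.zero_tmul _ _
      map_add' := fun u v => tmulA_add_left u v _ }

theorem diagE_mul_tmulA (a b : Fin m) (u : Ugl m) (T : GD m n) :
    diagE n a b * tmulA u T - tmulA u T * diagE n a b
      = tmulA (unitU a b * u - u * unitU a b) T + tmulA u (gammaE n a b * T - T * gammaE n a b) := by
  have h1 : tmulA (unitU a b * u - u * unitU a b) T
      = tmulA (unitU a b * u) T - tmulA (u * unitU a b) T := TensorProduct.sub_tmul _ _ _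
  have h2 : tmulA u (gammaE n a b * T - T * gammaE n a b)
      = tmulA u (gammaE n a b * T) - tmulA u (T * gammaE n a b) := TensorProduct.tmul_sub _ _ _
  rw [h1, h2, diagE, add_mul, mul_add]
  simp only [tmulA_mul, one_mul, mul_one]
  abel

theorem tmulA_zero_right (u : Ugl m) : tmulA u (0 : GD m n) = 0 := TensorProduct.tmul_zero _ _

theorem tmulA_zero_left (T : GD m n) : tmulA (0 : Ugl m) T = 0 := TensorProduct.zero_tmul _ _

theorem tmulA_sub_left (u u' : Ugl m) (T : GD m n) :
    tmulA (u - u') T = tmulA u T - tmulA u' T := TensorProduct.sub_tmul _ _ _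

theorem tmulA_sub_right (u : Ugl m) (T T' : GD m n) :
    tmulA u (T - T') = tmulA u T - tmulA u T' := TensorProduct.tmul_sub _ _ _

theorem tmulA_ite_left (p : Prop) [Decidable p] (u : Ugl m) (T : GD m n) :
    tmulA (if p then u else 0) T = if p then tmulA u T else 0 := by
  split_ifs
  · rfl
  · exact tmulA_zero_left T

theorem tmulA_ite_right (p : Prop) [Decidable p] (u : Ugl m) (T : GD m n) :
    tmulA u (if p then T else 0) = if p then tmulA u T else 0 := by
  split_ifs
  · rfl
  · exact tmulA_zero_right u

theorem gammaE_comm_opX_opD (a b c d : Fin m) (i j : Fin n) :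
    gammaE n a b * (opX c i * opD d j) - (opX c i * opD d j) * gammaE n a b
      = (if b = c then opX a i * opD d j else 0) - (if a = d then opX c i * opD b j else 0) := by
  have h1 := congrArg (· * opD d j) (gammaE_comm_opX (n := n) a b c i)
  have h2 := congrArg (opX c i * ·) (gammaE_comm_opD (n := n) a b d j)
  simp only [sub_mul, mul_sub, ite_mul, mul_ite, zero_mul, mul_zero, mul_neg] at h1 h2
  have h3 : (if a = d then -(opX c i * opD b j) else 0)
      = - (if a = d then (opX c i * opD b j : GD m n) else 0) := by split_ifs <;> simp
  rw [h3] at h2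
  refine Eq.trans ?_ ((congrArg₂ (· + ·) h1 h2).trans (sub_eq_add_neg _ _).symm)
  simp only [mul_assoc]
  abel

/-- The power entry and x_ai ∂_bj transform contragrediently under `gl_m`, and their contraction
over a, b is invariant. -/
theorem diagE_comm_yangElt (s : ℕ) (i j : Fin n) (a b : Fin m) :
    diagE n a b * yangElt m s i j = yangElt m s i j * diagE n a b := by
  rw [← sub_eq_zero, yangElt_eq]
  simp only [Finset.mul_sum, Finset.sum_mul]
  simp only [← Finset.sum_sub_distrib, diagE_mul_tmulA, unitU_comm_genMat_pow, gammaE_comm_opX_opD,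
    tmulA_sub_left, tmulA_sub_right, tmulA_ite_left, tmulA_ite_right, Finset.sum_add_distrib]
  simp only [Finset.sum_sub_distrib]
  have e : ∀ (p : Prop) [Decidable p] (f : Fin m → AlgA m n),
      ∑ x, (if p then f x else 0) = if p then ∑ x, f x else 0 := fun p _ f => by
    split_ifs <;> simp
  simp only [e, Finset.sum_ite_eq, Finset.mem_univ, if_true]
  abel

/-! ### Normally ordered products and the Yangian relations -/

/-- The sum of `f a b c d ⊗ x_{ck} x_{ai} ∂_{bj} ∂_{dl}`. -/
def quadSum (n : ℕ) (f : Fin m → Fin m → Fin m → Fin m → Ugl m) (i j k l : Fin n) : AlgA m n :=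
  ∑ a, ∑ b, ∑ c, ∑ d, tmulA (f a b c d) (opX c k * opX a i * (opD b j * opD d l))

theorem quadSum_sub (f g : Fin m → Fin m → Fin m → Fin m → Ugl m) (i j k l : Fin n) :
    quadSum n (fun a b c d => f a b c d - g a b c d) i j k l
      = quadSum n f i j k l - quadSum n g i j k l := by
  simp only [quadSum, tmulA_sub_left, Finset.sum_sub_distrib]

theorem quadSum_swap (f : Fin m → Fin m → Fin m → Fin m → Ugl m) (i j k l : Fin n) :
    quadSum n f k l i j = quadSum n (fun a b c d => f c d a b) i j k l := by
  have h : ∀ (a b c d : Fin m), (opX c i * opX a k * (opD b l * opD d j) : GD m n)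
      = opX a k * opX c i * (opD d j * opD b l) := fun a b c d => by
    rw [opX_mul_opX c a, opD_mul_opD b d, neg_mul_neg]
  simp only [quadSum, h]
  rw [Finset.sum_congr rfl fun a _ => Finset.sum_comm, Finset.sum_comm]
  refine Finset.sum_congr rfl fun c _ => ?_
  rw [Finset.sum_congr rfl fun a _ => Finset.sum_comm, Finset.sum_comm]

/-- Only the two x's are exchanged, hence the sign; in `quadSum_swap` the ∂'s are exchanged too and
the signs cancel. -/
theorem quadSum_swap_left (f : Fin m → Fin m → Fin m → Fin m → Ugl m) (i j k l : Fin n) :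
    quadSum n f k j i l = - quadSum n (fun a b c d => f c b a d) i j k l := by
  have h : ∀ (a b c d : Fin m) (u : Ugl m),
      tmulA u (opX c i * opX a k * (opD b j * opD d l) : GD m n)
      = - tmulA u (opX a k * opX c i * (opD b j * opD d l)) := fun a b c d u => by
    rw [opX_mul_opX c a, neg_mul]
    exact TensorProduct.tmul_neg _ _
  simp only [quadSum, h, Finset.sum_neg_distrib]
  congr 1
  rw [Finset.sum_congr rfl fun a _ => Finset.sum_comm, Finset.sum_comm]
  refine Finset.sum_congr rfl fun c _ => ?_
  rw [Finset.sum_comm]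

/-- Normal ordering: moving ∂ past x gives a contraction, which multiplies the matrix powers, plus a
quartic term. -/
theorem yangElt_mul (r s : ℕ) (i j k l : Fin n) :
    yangElt m r i j * yangElt m s k l
      = (if j = k then yangElt m (r + s) i l else 0)
        + quadSum n (fun a b c d => (genMat m ^ r) a b * (genMat m ^ s) c d) i j k l := by
  have h : ∀ a b c d : Fin m, tmulA ((genMat m ^ r) a b) (opX a i * opD b j)
        * tmulA ((genMat m ^ s) c d) (opX c k * opD d l)
      = (if b = c then if j = k then
          tmulA ((genMat m ^ r) a b * (genMat m ^ s) b d) (opX a i * opD d l) else 0 else 0)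
        + tmulA ((genMat m ^ r) a b * (genMat m ^ s) c d)
          (opX c k * opX a i * (opD b j * opD d l) : GD m n) := fun a b c d => by
    have e : (opX a i * opD b j) * (opX c k * opD d l)
        = (if c = b ∧ k = j then opX a i * opD d l else 0)
          + (opX c k * opX a i * (opD b j * opD d l) : GD m n) := by
      have e1 : (opX a i * opD b j) * (opX c k * opD d l)
          = opX a i * (opD b j * opX c k) * (opD d l : GD m n) := by simp only [mul_assoc]
      rw [e1, eq_sub_of_add_eq (opD_mul_opX c b k j), opX_mul_opX c a, mul_sub, sub_mul, mul_ite,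
        ite_mul, mul_one, mul_zero, zero_mul, neg_mul, sub_eq_add_neg]
      simp only [mul_assoc]
    rw [tmulA_mul, e, tmulA_add_right, tmulA_ite_right]
    congr 1
    by_cases h1 : b = c
    · subst h1
      by_cases h2 : j = k
      · subst h2; simp
      · simp [h2, Ne.symm h2]
    · simp [h1, Ne.symm h1]
  rw [yangElt_eq, yangElt_eq]
  simp only [Finset.sum_mul]
  simp only [Finset.mul_sum, h, Finset.sum_add_distrib]
  have e : ∀ (p : Prop) [Decidable p] (f : Fin m → AlgA m n),
      ∑ x, (if p then f x else 0) = if p then ∑ x, f x else 0 := fun p _ f => by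
    split_ifs <;> simp
  simp only [e, Finset.sum_ite_eq, Finset.mem_univ, if_true]
  congr 1
  rw [yangElt_eq]
  split_ifs
  · refine Finset.sum_congr rfl fun a _ => ?_
    rw [Finset.sum_comm]
    refine Finset.sum_congr rfl fun d _ => ?_
    rw [genMat_pow_add]
    exact (TensorProduct.sum_tmul _ _ _).symm
  · rfl

/-- The images of the generators of the Yangian in `A`. -/
def yangGen (m : ℕ) {n : ℕ} (r : ℕ) (i j : Fin n) : AlgA m n :=
  match r with
  | 0 => if i = j then 1 else 0
  | s + 1 => yangElt m s i j

theorem yangElt_comm (r s : ℕ) (i j k l : Fin n) :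
    yangElt m r i j * yangElt m s k l - yangElt m s k l * yangElt m r i j
      = (if j = k then yangElt m (r + s) i l else 0) - (if l = i then yangElt m (r + s) k j else 0)
        + quadSum n (fun a b c d => (genMat m ^ r) a b * (genMat m ^ s) c d
          - (genMat m ^ s) c d * (genMat m ^ r) a b) i j k l := by
  rw [yangElt_mul, yangElt_mul, quadSum_sub, quadSum_swap _ i j k l, add_comm s r]
  abel

theorem yangElt_comm_zero (r : ℕ) (i j k l : Fin n) :
    yangElt m r i j * yangElt m 0 k l - yangElt m 0 k l * yangElt m r i j
      = (if j = k then yangElt m r i l else 0) - (if l = i then yangElt m r k j else 0) := by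
  have h : ∀ a b c d : Fin m, (genMat m ^ r) a b * (genMat m ^ 0) c d
      - (genMat m ^ 0) c d * (genMat m ^ r) a b = 0 := fun a b c d => by
    rw [pow_zero, Matrix.one_apply]; split_ifs <;> simp
  rw [yangElt_comm]
  simp only [h, quadSum, tmulA_zero_left, Finset.sum_const_zero, add_zero]

/-- For positive indices the contractions depend only on the sum of the exponents and cancel on each
side, leaving `genMat_relation` under `quadSum`. The cases with T^(0) = δ are treated separately. -/
theorem yangGen_relation (r s : ℕ) (i j k l : Fin n) :
    (yangGen m (r + 1) i j * yangGen m s k l - yangGen m s k l * yangGen m (r + 1) i j)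
        - (yangGen m r i j * yangGen m (s + 1) k l - yangGen m (s + 1) k l * yangGen m r i j)
      = yangGen m r k j * yangGen m s i l - yangGen m s k j * yangGen m r i l := by
  have hd : ∀ (p : Prop) [Decidable p] (X : AlgA m n),
      (if p then 1 else 0) * X = if p then X else 0 := fun p _ X => by split_ifs <;> simp
  have hd' : ∀ (p : Prop) [Decidable p] (X : AlgA m n),
      X * (if p then 1 else 0) = if p then X else 0 := fun p _ X => by split_ifs <;> simp
  rcases r with _ | r <;> rcases s with _ | s
  · simp only [yangGen, hd, hd']
    by_cases h1 : i = j <;> by_cases h2 : k = l <;> by_cases h3 : k = j <;> by_cases h4 : i = l <;>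
      simp [h1, h2, h3, h4]
  · simp only [yangGen, hd, hd', sub_self, sub_zero]
    rw [← neg_sub, yangElt_comm_zero, neg_sub]
    simp only [eq_comm (a := j) (b := k), eq_comm (a := l) (b := i)]
  · simp only [yangGen, hd, hd', sub_self, zero_sub]
    rw [yangElt_comm_zero, neg_sub]
    simp only [eq_comm (a := j) (b := k), eq_comm (a := i) (b := l)]
  · simp only [yangGen]
    rw [yangElt_comm, yangElt_comm, yangElt_mul, yangElt_mul, quadSum_swap_left _ i j k l,
      quadSum_swap_left _ i j k l]
    have e1 : r + 1 + s = r + (s + 1) := by omega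
    have h := congrArg (fun f => quadSum n f i j k l) (funext fun a => funext fun b =>
      funext fun c => funext fun d => genMat_relation (m := m) r s a b c d)
    simp only [quadSum_sub] at h ⊢
    rw [e1, add_comm s r]
    rw [add_sub_add_left_eq_sub, h]
    abel

/-- The homomorphism from the Yangian to `A`. -/
def yangHom (m n : ℕ) : Yangian n →ₐ[ℂ] AlgA m n :=
  RingQuot.liftAlgHom ℂ ⟨FreeAlgebra.lift ℂ fun p : ℕ × Fin n × Fin n => yangElt m p.1 p.2.1 p.2.2,
    fun {x y} h => by
      have hT : ∀ (r : ℕ) (i j : Fin n), FreeAlgebra.lift ℂ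
          (fun p : ℕ × Fin n × Fin n => yangElt m p.1 p.2.1 p.2.2) (freeT r i j)
          = yangGen m r i j := fun r i j => by
        rcases r with _ | r
        · simp only [freeT, yangGen]
          split_ifs
          · exact map_one _
          · exact map_zero _
        · simp only [freeT, yangGen, FreeAlgebra.lift_ι_apply]
      obtain ⟨r, s, i, j, k, l⟩ := h
      simp only [map_sub, map_mul, hT]
      exact yangGen_relation r s i j k l⟩

theorem yangHom_yangT (s : ℕ) (i j : Fin n) :
    yangHom m n (yangT (s + 1) i j) = yangElt m s i j := by
  rw [yangHom, yangT, RingQuot.liftAlgHom_mkAlgHom_apply, freeT, FreeAlgebra.lift_ι_apply]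

theorem yangian_induction {P : Yangian n → Prop} (scalar : ∀ z : ℂ, P (algebraMap ℂ _ z))
    (gen : ∀ s i j, P (yangT (s + 1) i j)) (add : ∀ x y, P x → P y → P (x + y))
    (mul : ∀ x y, P x → P y → P (x * y)) (y : Yangian n) : P y := by
  obtain ⟨x, rfl⟩ := RingQuot.mkAlgHom_surjective ℂ (YangRel n) y
  induction x using FreeAlgebra.induction with
  | grade0 z => rw [AlgHom.commutes]; exact scalar z
  | grade1 p => exact gen p.1 p.2.1 p.2.2
  | mul x y hx hy => rw [map_mul]; exact mul _ _ hx hy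
  | add x y hx hy => rw [map_add]; exact add _ _ hx hy

theorem diagE_comm_yangHom (y : Yangian n) (a b : Fin m) :
    diagE n a b * yangHom m n y = yangHom m n y * diagE n a b := by
  refine yangian_induction
    (P := fun y => diagE n a b * yangHom m n y = yangHom m n y * diagE n a b) ?_ ?_ ?_ ?_ y
  · intro z
    rw [AlgHom.commutes, Algebra.commutes]
  · intro s i j
    rw [yangHom_yangT, diagE_comm_yangElt]
  · intro x y hx hy
    rw [map_add, mul_add, add_mul, hx, hy]
  · intro x y hx hy
    rw [map_mul, ← mul_assoc, hx, mul_assoc, hy, mul_assoc]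

theorem permU_genMat_pow (σ : Equiv.Perm (Fin m)) (s : ℕ) (a b : Fin m) :
    permU σ ((genMat m ^ s) a b) = (genMat m ^ s) (σ a) (σ b) := by
  induction s generalizing a b with
  | zero =>
    simp only [pow_zero, Matrix.one_apply, EmbeddingLike.apply_eq_iff_eq]
    split_ifs
    · exact map_one _
    · exact map_zero _
  | succ s ih =>
    rw [genMat_pow_succ, genMat_pow_succ, map_sum,
      ← Equiv.sum_comp σ fun e => (genMat m ^ s) (σ a) e * unitU (σ b) e]
    exact Finset.sum_congr rfl fun e _ => by rw [map_mul, ih, permU_unitU]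

/-- A permutation only relabels the contracted indices. -/
theorem permA_yangElt (σ : Equiv.Perm (Fin m)) (s : ℕ) (i j : Fin n) :
    permA n σ (yangElt m s i j) = yangElt m s i j := by
  rw [yangElt_eq]
  simp only [map_sum, permA_tmulA, permU_genMat_pow, permGD_mul, permGD_opX, permGD_opD]
  rw [← Equiv.sum_comp σ (fun a => ∑ b, tmulA ((genMat m ^ s) a b) (opX a i * opD b j))]
  refine Finset.sum_congr rfl fun a _ => ?_
  exact Equiv.sum_comp σ fun b => tmulA ((genMat m ^ s) (σ a) b) (opX (σ a) i * opD b j)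

theorem permA_yangHom (σ : Equiv.Perm (Fin m)) (y : Yangian n) :
    permA n σ (yangHom m n y) = yangHom m n y := by
  refine yangian_induction (P := fun y => permA n σ (yangHom m n y) = yangHom m n y) ?_ ?_ ?_ ?_ y
  · intro z
    rw [AlgHom.commutes, permA_algebraMap]
  · intro s i j
    rw [yangHom_yangT, permA_yangElt]
  · intro x y hx hy
    rw [map_add, map_add, hx, hy]
  · intro x y hx hy
    rw [map_mul, permA_mul, hx, hy]

theorem nSub_le_comap_yangHom (κ : Fin m → ℂ) (y : Yangian n) :
    nSub n κ ≤ (nSub n κ).comap (act n κ (yangHom m n y)) := by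
  refine Submodule.span_le.2 ?_
  rintro _ ⟨a, b, w, hab, rfl⟩
  refine Submodule.subset_span ⟨a, b, act n κ (yangHom m n y) w, hab, ?_⟩
  rw [← Module.End.mul_apply, ← Module.End.mul_apply, ← map_mul, ← map_mul, diagE_comm_yangHom]

/-- The action of the Yangian on the coinvariants. -/
def yangAct (n : ℕ) (κ : Fin m → ℂ) : Yangian n →ₐ[ℂ] Module.End ℂ (Coinv n κ) where
  toFun y := (nSub n κ).mapQ (nSub n κ) (act n κ (yangHom m n y)) (nSub_le_comap_yangHom κ y)
  map_one' := by
    refine Submodule.linearMap_qext _ (LinearMap.ext fun v => ?_)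
    simp only [map_one]
    rfl
  map_mul' p q := by
    refine Submodule.linearMap_qext _ (LinearMap.ext fun v => ?_)
    simp only [map_mul]
    rfl
  map_zero' := by
    refine Submodule.linearMap_qext _ (LinearMap.ext fun v => ?_)
    simp only [map_zero]
    rfl
  map_add' p q := by
    refine Submodule.linearMap_qext _ (LinearMap.ext fun v => ?_)
    simp only [map_add]
    rfl
  commutes' z := by
    refine Submodule.linearMap_qext _ (LinearMap.ext fun v => ?_)
    simp only [AlgHom.commutes]
    rfl

theorem yangAct_mkQ (κ : Fin m → ℂ) (y : Yangian n) (w : VermaGrass n κ) :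
    yangAct n κ y ((nSub n κ).mkQ w) = (nSub n κ).mkQ (act n κ (yangHom m n y) w) := rfl

theorem isYangianAction_yangAct (κ : Fin m → ℂ) : IsYangianAction n κ (yangAct n κ) :=
  fun s i j w => by rw [yangAct_mkQ, yangHom_yangT]

theorem IsYangianAction.eq_yangAct {κ : Fin m → ℂ}
    {ρ : Yangian n →ₐ[ℂ] Module.End ℂ (Coinv n κ)} (h : IsYangianAction n κ ρ) :
    ρ = yangAct n κ := by
  refine AlgHom.ext fun y => ?_
  refine yangian_induction (P := fun y => ρ y = yangAct n κ y) ?_ ?_ ?_ ?_ y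
  · intro z
    rw [AlgHom.commutes, AlgHom.commutes]
  · intro s i j
    refine Submodule.linearMap_qext _ (LinearMap.ext fun v => ?_)
    exact (h s i j v).trans (isYangianAction_yangAct κ s i j v).symm
  · intro x y hx hy
    rw [map_add, map_add, hx, hy]
  · intro x y hx hy
    rw [map_mul, map_mul, hx, hy]

theorem cartanAct_comm_yangAct (κ : Fin m → ℂ) (a : Fin m) (y : Yangian n) (v : Coinv n κ) :
    cartanAct n κ a (yangAct n κ y v) = yangAct n κ y (cartanAct n κ a v) := by
  obtain ⟨v, rfl⟩ := (nSub n κ).mkQ_surjective v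
  change (nSub n κ).mkQ (act n κ (diagE n a a) (act n κ (yangHom m n y) v))
    = (nSub n κ).mkQ (act n κ (yangHom m n y) (act n κ (diagE n a a) v))
  rw [← Module.End.mul_apply, ← Module.End.mul_apply, ← map_mul, ← map_mul, diagE_comm_yangHom]

theorem mem_weightSub {κ lam : Fin m → ℂ} {v : Coinv n κ} :
    v ∈ weightSub n κ lam ↔ ∀ a, cartanAct n κ a v = lam a • v := by
  simp only [weightSub, Submodule.mem_iInf, Module.End.mem_eigenspace_iff]

theorem yangAct_mem_weightSub {κ lam : Fin m → ℂ} (y : Yangian n) {v : Coinv n κ}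
    (hv : v ∈ weightSub n κ lam) : yangAct n κ y v ∈ weightSub n κ lam := by
  rw [mem_weightSub] at hv ⊢
  intro a
  rw [cartanAct_comm_yangAct, hv, map_smul]

end

section

attribute [local instance] coinvModule

variable {m n : ℕ}

/-! ## The operators on the coinvariants -/

theorem IsGeneric.dot {κ : Fin m → ℂ} (hκ : IsGeneric κ) (σ : Equiv.Perm (Fin m)) :
    IsGeneric (dot σ κ) := by
  intro a b hab z h
  refine hκ (σ.symm a) (σ.symm b) (fun e => hab (σ.symm.injective e))
    (z + (σ.symm a : ℕ) - (σ.symm b : ℕ) - (a : ℕ) + (b : ℕ)) ?_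
  simp only [KNYang.dot, rhoWt] at h
  push_cast
  linear_combination h

theorem dot_mul (σ τ : Equiv.Perm (Fin m)) (κ : Fin m → ℂ) :
    dot (σ * τ) κ = dot σ (dot τ κ) := by
  ext a
  have : (σ * τ).symm a = τ.symm (σ.symm a) := rfl
  simp only [dot, this]
  ring

theorem dot_one (κ : Fin m → ℂ) : dot 1 κ = κ := by
  ext a
  have : (1 : Equiv.Perm (Fin m)).symm a = a := rfl
  simp only [dot, this]
  ring

/-- The projection of `J̄ \ Ā` onto the coinvariants. -/
def quotToCoinv (n : ℕ) {κ : Fin m → ℂ} (hκ : IsGeneric κ) : JBarQuot m n →ₗ[ℂ] Coinv n κ :=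
  (identification n hκ).toLinearMap ∘ₗ (toDouble n κ).restrictScalars ℂ

theorem quotToCoinv_apply {κ : Fin m → ℂ} (hκ : IsGeneric κ) (y : JBarQuot m n) :
    quotToCoinv n hκ y = identification n hκ (toDouble n κ y) := rfl

theorem quotToCoinv_mkQ {κ : Fin m → ℂ} (hκ : IsGeneric κ) (y : ABar m n) :
    quotToCoinv n hκ ((idealJBar m n).mkQ y) = barToCoinv n hκ y := rfl

theorem quotToCoinv_toBar {κ : Fin m → ℂ} (hκ : IsGeneric κ) (Y : AlgA m n) :
    quotToCoinv n hκ ((idealJBar m n).mkQ (toBar Y)) = (nSub n κ).mkQ (actOne n κ Y) :=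
  barToCoinv_toBar hκ Y

theorem exists_quotToCoinv_toBar {κ : Fin m → ℂ} (hκ : IsGeneric κ) (v : Coinv n κ) :
    ∃ Y : AlgA m n, quotToCoinv n hκ ((idealJBar m n).mkQ (toBar Y)) = v := by
  obtain ⟨v, rfl⟩ := (nSub n κ).mkQ_surjective v
  obtain ⟨Y, rfl⟩ := actOne_surjective κ v
  exact ⟨Y, quotToCoinv_toBar hκ Y⟩

theorem quotToCoinv_surjective {κ : Fin m → ℂ} (hκ : IsGeneric κ) :
    Function.Surjective (quotToCoinv n hκ) := fun v =>
  let ⟨_, hY⟩ := exists_quotToCoinv_toBar hκ v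
  ⟨_, hY⟩

theorem quotToCoinv_X_smul {κ : Fin m → ℂ} (hκ : IsGeneric κ) (a : Fin m) (y : JBarQuot m n) :
    quotToCoinv n hκ (algebraMap (Uh m) (UhBar m) (MvPolynomial.X a) • y)
      = cartanAct n κ a (quotToCoinv n hκ y) := by
  obtain ⟨y, rfl⟩ := (idealJBar m n).mkQ_surjective y
  rw [← map_smul (idealJBar m n).mkQ, quotToCoinv_mkQ, quotToCoinv_mkQ,
    algebraMap_smul (UhBar m) (MvPolynomial.X a : Uh m) y, map_smul, uh_smul_coinv, cartanCoinv_X]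

theorem exists_linearMap_of_ker_le {V W U : Type*} [AddCommGroup V] [Module ℂ V] [AddCommGroup W]
    [Module ℂ W] [AddCommGroup U] [Module ℂ U] (T : V →ₗ[ℂ] W) (S : V →ₗ[ℂ] U)
    (hT : Function.Surjective T) (h : ∀ v, T v = 0 → S v = 0) :
    ∃ I : W →ₗ[ℂ] U, ∀ v, I (T v) = S v := by
  refine ⟨(LinearMap.ker T).liftQ S h ∘ₗ (T.quotKerEquivOfSurjective hT).symm.toLinearMap,
    fun v => ?_⟩
  have h2 : (T.quotKerEquivOfSurjective hT).symm (T v) = Submodule.Quotient.mk v := by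
    rw [LinearEquiv.symm_apply_eq]; rfl
  rw [LinearMap.comp_apply, LinearEquiv.coe_coe, h2]; rfl

/-- A map induced on the coinvariants by an operator on `J̄ \ Ā`. -/
theorem isInducedBy_iff {μ κ : Fin m → ℂ} (hμ : IsGeneric μ) (hκ : IsGeneric κ)
    (g : JBarQuot m n → JBarQuot m n) (I : Coinv n μ →ₗ[ℂ] Coinv n κ) :
    IsInducedBy g (identification n hμ) (identification n hκ) I
      ↔ ∀ y, I (quotToCoinv n hμ y) = quotToCoinv n hκ (g y) := Iff.rfl

section Step

variable {c : Fin (m - 1)} {ξ : JBarQuot m n →ₛₗ[twist c] JBarQuot m n}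
  {κ : Fin m → ℂ} (hκ : IsGeneric κ)

/-- The twist fixes complex constants, so the twisted operator is ℂ-linear, and it kills the kernel
of the projection by `IsZhelobenko.toDouble_eq_zero`. -/
theorem exists_isInducedBy_zhelobenko (hξ : IsZhelobenko n c ξ) :
    ∃ I : Coinv n κ →ₗ[ℂ] Coinv n (dot (simpleRefl c) κ),
      IsInducedBy ξ (identification n hκ) (identification n (hκ.dot (simpleRefl c))) I := by
  let S : JBarQuot m n →ₗ[ℂ] Coinv n (dot (simpleRefl c) κ) :=
    { toFun := fun y => quotToCoinv n (hκ.dot (simpleRefl c)) (ξ y)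
      map_add' := fun x y => by rw [map_add, map_add]
      map_smul' := fun z y => by
        rw [← algebraMap_smul (UhBar m) z y, map_smulₛₗ ξ, twist_algebraMap_complex,
          algebraMap_smul, map_smul (quotToCoinv n (hκ.dot (simpleRefl c))), RingHom.id_apply] }
  refine exists_linearMap_of_ker_le (quotToCoinv n hκ) S (quotToCoinv_surjective hκ) fun y hy => ?_
  rw [quotToCoinv_apply] at hy
  have h1 : toDouble n κ y = 0 := (identification n hκ).injective (hy.trans (map_zero _).symm)
  change quotToCoinv n (hκ.dot (simpleRefl c)) (ξ y) = 0
  rw [quotToCoinv_apply, hξ.toDouble_eq_zero c κ h1, map_zero]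

variable {I : Coinv n κ →ₗ[ℂ] Coinv n (dot (simpleRefl c) κ)}

/-- Twisted linearity of ξ̌_c applied to a Cartan variable; combined with `dot_simpleRefl` it yields
the change of weight λ ↦ σ_c ∘ λ. -/
theorem step_cartanAct
    (hI : IsInducedBy ξ (identification n hκ) (identification n (hκ.dot (simpleRefl c))) I)
    (a : Fin m) (v : Coinv n κ) :
    I (cartanAct n κ a v) = cartanAct n _ (simpleRefl c a) (I v)
      + (simpleRoot c (simpleRefl c a) : ℂ) • I v := by
  obtain ⟨y, rfl⟩ := quotToCoinv_surjective hκ v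
  rw [isInducedBy_iff] at hI
  rw [← quotToCoinv_X_smul, hI, hI, ← quotToCoinv_X_smul,
    ← map_smul (quotToCoinv n (hκ.dot (simpleRefl c))), ← map_add, map_smulₛₗ ξ, twist_algebraMap,
    permUh, MvPolynomial.rename_X, shiftUh, MvPolynomial.aeval_X, map_add,
    add_smul]
  congr 2
  rw [← MvPolynomial.algebraMap_eq, ← IsScalarTower.algebraMap_apply, algebraMap_smul]

theorem step_mem_weightSub
    (hI : IsInducedBy ξ (identification n hκ) (identification n (hκ.dot (simpleRefl c))) I)
    {lam : Fin m → ℂ} {v : Coinv n κ} (hv : v ∈ weightSub n κ lam) :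
    I v ∈ weightSub n (dot (simpleRefl c) κ) (dot (simpleRefl c) lam) := by
  rw [mem_weightSub] at hv ⊢
  intro b
  obtain ⟨a, rfl⟩ := (simpleRefl c).surjective b
  have h := step_cartanAct hκ hI a v
  rw [hv, map_smul, ← dot_simpleRefl c lam a, add_smul] at h
  exact (add_right_cancel h).symm

theorem cartanCoinv_comm_yangAct (κ : Fin m → ℂ) (p : Uh m) (y : Yangian n) (v : Coinv n κ) :
    p • yangAct n κ y v = yangAct n κ y (p • v) := by
  rw [uh_smul_coinv, uh_smul_coinv]
  induction p using MvPolynomial.induction_on generalizing v with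
  | C z => rw [cartanCoinv_C, cartanCoinv_C, map_smul]
  | add p q hp hq => rw [map_add, LinearMap.add_apply, LinearMap.add_apply, map_add, hp, hq]
  | mul_X p a hp =>
    rw [map_mul, Module.End.mul_apply, Module.End.mul_apply, cartanCoinv_X, cartanAct_comm_yangAct,
      hp]

theorem smul_barToCoinv_mk {κ : Fin m → ℂ} (hκ : IsGeneric κ) (Y : AlgA m n) (s : denoms m) :
    (s : Uh m) • barToCoinv n hκ (LocalizedModule.mk Y s) = (nSub n κ).mkQ (actOne n κ Y) := by
  rw [← barToCoinv_toBar hκ, ← map_smul, LocalizedModule.smul'_mk]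
  exact congrArg _ (LocalizedModule.mk_cancel s Y)

/-- The Yangian commutes with U(h), so the identity may be checked after clearing the denominator.
-/
theorem yangAct_barToCoinv {κ : Fin m → ℂ} (hκ : IsGeneric κ) (y : Yangian n) (Y : AlgA m n)
    (s : denoms m) : yangAct n κ y (barToCoinv n hκ (LocalizedModule.mk Y s))
      = barToCoinv n hκ (LocalizedModule.mk (yangHom m n y * Y) s) := by
  rw [← sub_eq_zero]
  refine denom_smul_coinv_inj hκ s ?_
  rw [smul_sub, cartanCoinv_comm_yangAct, smul_barToCoinv_mk, smul_barToCoinv_mk, yangAct_mkQ,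
    actOne_mul, sub_self]

theorem xi_eq_sum (c : Fin (m - 1)) {Y : AlgA m n} {N : ℕ} (hN : (adF c)^[N] Y = 0) :
    xi c Y = ∑ s ∈ Finset.range N, LocalizedModule.mk
      (((s.factorial : ℂ)⁻¹) • (diagE n (lo c) (hi c) ^ s * (adF c)^[s] Y)) (fallH c s) := by
  refine finsum_eq_sum_of_support_subset _ fun s hs => ?_
  simp only [Finset.coe_range, Set.mem_Iio]
  by_contra hle
  refine hs ?_
  have h0 : (adF c)^[s] Y = 0 :=
    RankOne.iterate_δ_eq_zero (D := rankOne (n := n) c _ le_rfl) hN (not_lt.1 hle)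
  change LocalizedModule.mk _ _ = _
  rw [h0, mul_zero, smul_zero, LocalizedModule.zero_mk]

/-- The image of the Yangian is fixed by σ_c and commutes with E and F, so it factors out on the
left of every term of ξ_c. -/
theorem step_yangAct (hξ : IsZhelobenko n c ξ)
    (hI : IsInducedBy ξ (identification n hκ) (identification n (hκ.dot (simpleRefl c))) I)
    (y : Yangian n) (v : Coinv n κ) : I (yangAct n κ y v) = yangAct n _ y (I v) := by
  obtain ⟨Y, rfl⟩ := exists_quotToCoinv_toBar hκ v
  set Z := yangHom m n y with hZ
  have h1 : yangAct n κ y (quotToCoinv n hκ ((idealJBar m n).mkQ (toBar Y)))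
      = quotToCoinv n hκ ((idealJBar m n).mkQ (toBar (Z * Y))) := by
    rw [quotToCoinv_toBar, quotToCoinv_toBar, yangAct_mkQ, actOne_mul]
  rw [isInducedBy_iff] at hI
  rw [h1, hI, hI, hξ, hξ, permA_mul, hZ, permA_yangHom]
  set X := permA n (simpleRefl c) Y
  have h2 : ∀ s, (adF c)^[s] (yangHom m n y * X) = yangHom m n y * (adF c)^[s] X := fun s => by
    induction s with
    | zero => rfl
    | succ s ih =>
      rw [Function.iterate_succ_apply', ih, adF_mul, adF, diagE_comm_yangHom, sub_self, zero_mul,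
        zero_add, ← Function.iterate_succ_apply' (adF c)]
  have h3 : ∀ s, diagE n (lo c) (hi c) ^ s * yangHom m n y
      = yangHom m n y * diagE n (lo c) (hi c) ^ s := fun s =>
    (show Commute (diagE n (lo c) (hi c)) (yangHom m n y) from
      diagE_comm_yangHom y _ _).pow_left s
  obtain ⟨N, hN⟩ := exists_iterate_adF c X
  rw [xi_eq_sum c hN, xi_eq_sum (N := N) c (by rw [h2, hN, mul_zero])]
  rw [quotToCoinv_mkQ, quotToCoinv_mkQ, map_sum, map_sum, map_sum]
  refine Finset.sum_congr rfl fun s _ => ?_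
  rw [yangAct_barToCoinv, h2, ← mul_assoc, h3, mul_assoc, mul_smul_comm]

end Step

/-! ## The vectors `v_μ^λ` -/

theorem vVec_mem_weightSub (κ lam : Fin m → ℂ) (ν : Fin m → Fin (n + 1))
    (h : ∀ a, lam a = κ a + ((ν a : ℕ) : ℂ)) : vVec κ ν ∈ weightSub n κ lam := by
  rw [mem_weightSub]
  intro a
  change (nSub n κ).mkQ (act n κ (diagE n a a) (hwTensor κ (wVec ν))) = _
  rw [act_diagE_self_hw, gammaE_wVec_self, h, add_smul, map_add]
  congr 1
  rw [hwTensor, TensorProduct.tmul_smul, map_smul]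
  rfl

/-- Left multiplication by an element of the Grassmann algebra, as an element of `A`. -/
def grassA (w : Grass m n) : AlgA m n := inclGD m n (LinearMap.mulLeft ℂ w)

theorem actOne_grassA (κ : Fin m → ℂ) (w : Grass m n) :
    actOne n κ (grassA w) = hwTensor κ w := by
  rw [grassA, inclGD_apply, actOne_tmulA, LinearMap.mulLeft_apply, mul_one, hwTensor]

theorem grassA_smul (z : ℂ) (w : Grass m n) : grassA (z • w) = z • grassA w := by
  rw [grassA, grassA, ← map_smul]
  congr 1
  exact LinearMap.ext fun v => smul_mul_assoc _ _ _

theorem permA_grassA (σ : Equiv.Perm (Fin m)) (w : Grass m n) :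
    permA n σ (grassA w) = grassA (permGrass n σ w) := by
  rw [grassA, inclGD_apply, permA_tmulA, map_one, permGD_mulLeft]; rfl

theorem iterate_adF_grassA (c : Fin (m - 1)) (s : ℕ) (w : Grass m n) :
    (adF c)^[s] (grassA w) = grassA ((gammaE n (hi c) (lo c) ^ s) w) := by
  induction s with
  | zero => rfl
  | succ s ih =>
    rw [Function.iterate_succ_apply', ih, grassA, adF_inclGD, gammaE_comm_mulLeft, pow_succ']
    rfl

theorem actOne_pow_grassA (κ : Fin m → ℂ) {a b : Fin m} (hab : a < b) (s : ℕ) (w : Grass m n) :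
    actOne n κ (diagE n a b ^ s * grassA w) = hwTensor κ ((gammaE n a b ^ s) w) := by
  induction s with
  | zero => rw [pow_zero, one_mul, actOne_grassA]; rfl
  | succ s ih => rw [pow_succ', mul_assoc, actOne_mul, ih, act_unitU_hw κ hab, pow_succ']; rfl

/-- The action of `e^s f^s` on a highest weight vector. -/
theorem pow_mul_pow_highest {V : Type*} [AddCommGroup V] [Module ℂ V] {e f h : Module.End ℂ V}
    (hef : e * f - f * e = h) (hhf : h * f - f * h = (-2 : ℂ) • f) {w : V} {d : ℂ}
    (he : e w = 0) (hw : h w = d • w) (s : ℕ) :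
    (e ^ s) ((f ^ s) w) = (∏ r ∈ Finset.range s, ((r : ℂ) + 1) * (d - r)) • w := by
  have h1 : ∀ s : ℕ, h ((f ^ s) w) = (d - 2 * s) • (f ^ s) w := fun s => by
    induction s with
    | zero => simpa using hw
    | succ s ih =>
      have := LinearMap.congr_fun hhf ((f ^ s) w)
      simp only [LinearMap.sub_apply, Module.End.mul_apply, LinearMap.smul_apply, ih,
        map_smul] at this
      rw [pow_succ', Module.End.mul_apply]
      push_cast
      rw [sub_eq_iff_eq_add.1 this]
      module
  have h2 : ∀ s : ℕ, e ((f ^ (s + 1)) w) = (((s : ℂ) + 1) * (d - s)) • (f ^ s) w := fun s => by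
    have h3 : ∀ s : ℕ, e (f ((f ^ s) w)) = (d - 2 * s) • (f ^ s) w + f (e ((f ^ s) w)) := fun s => by
      rw [← h1, ← hef]
      simp
    induction s with
    | zero => simpa [he] using h3 0
    | succ s ih =>
      rw [pow_succ', Module.End.mul_apply, h3, ih, map_smul, pow_succ', Module.End.mul_apply]
      push_cast
      module
  induction s with
  | zero => simp
  | succ s ih =>
    rw [pow_succ, Module.End.mul_apply, h2, map_smul, ih, Finset.prod_range_succ, smul_smul,
      mul_comm]

end

section

attribute [local instance] coinvModule

variable {m n : ℕ}

/-! ## The action of `ξ_c` on the vectors `v_μ^λ` -/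

/-- Transfers computations in M_κ ⊗ Λ to the double quotient, where the rank one calculus takes
place. -/
theorem projBar_eq_smul_of_actOne {κ : Fin m → ℂ} (hκ : IsGeneric κ) {Y Z : AlgA m n} {z : ℂ}
    (h : actOne n κ Z = z • actOne n κ Y) :
    projBar (idealJBar m n ⊔ idealIBar n κ) Z
      = z • projBar (idealJBar m n ⊔ idealIBar n κ) Y := by
  refine (identification n hκ).injective ?_
  rw [map_smul]
  change barToCoinv n hκ (toBar Z) = z • barToCoinv n hκ (toBar Y)
  rw [barToCoinv_toBar, barToCoinv_toBar, h, map_smul]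

theorem algebraMap_weightProd {R : Type*} [CommRing R] [Algebra ℂ R] (d s : ℕ) :
    algebraMap ℂ R (∏ r ∈ Finset.range s, ((r : ℂ) + 1) * ((d : ℂ) - r))
      = RankOne.weightProd R d s := by
  rw [map_prod]
  exact Finset.prod_congr rfl fun r _ => by simp

/-- Here γ(F) kills w_ν, so only the zeroth term of the series is left. -/
theorem barToCoinv_xi_of_le {κ : Fin m → ℂ} (hκ : IsGeneric κ) (c : Fin (m - 1))
    {ν : Fin m → Fin (n + 1)} (hν : ν (lo c) ≤ ν (hi c)) :
    barToCoinv n hκ (xi c (grassA (wVec ν))) = vVec κ ν := by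
  have h0 : (adF c)^[1] (grassA (wVec ν)) = 0 := by
    rw [iterate_adF_grassA, pow_one, gammaE_wVec_eq_zero (lo_ne_hi c).symm hν]
    simpa using grassA_smul 0 (0 : Grass m n)
  rw [xi_eq_sum c h0, Finset.sum_range_one, fallH, Finset.prod_range_zero, pow_zero, one_mul,
    Nat.factorial_zero, Nat.cast_one, inv_one, one_smul]
  change barToCoinv n hκ (toBar (grassA (wVec ν))) = _
  rw [barToCoinv_toBar, actOne_grassA]
  rfl

/-- Here w_ν is a highest weight vector for γ of weight d = ν_c - ν_(c+1), so `series_highest`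
applies, with h acting on the class by the total weight z. The denominator is cleared to avoid
inverses. -/
theorem barToCoinv_xi_of_ge {κ : Fin m → ℂ} (hκ : IsGeneric κ) (c : Fin (m - 1))
    {ν : Fin m → Fin (n + 1)} (hν : ν (hi c) ≤ ν (lo c)) :
    (κ (lo c) - κ (hi c) + 1) • barToCoinv n hκ (xi c (grassA (wVec ν)))
      = (κ (lo c) + ((ν (lo c) : ℕ) : ℂ) - (κ (hi c) + ((ν (hi c) : ℕ) : ℂ)) + 1) • vVec κ ν := by
  set P := idealJBar m n ⊔ idealIBar n κ with hP
  set D := rankOne (n := n) c P le_sup_left with hD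
  set Y : AlgA m n := grassA (wVec ν) with hY
  obtain ⟨d, hd⟩ := Nat.exists_eq_add_of_le (show (ν (hi c) : ℕ) ≤ ν (lo c) from hν)
  set z : ℂ := κ (lo c) + ((ν (lo c) : ℕ) : ℂ) - (κ (hi c) + ((ν (hi c) : ℕ) : ℂ)) with hz
  have hz1 : κ (lo c) - κ (hi c) + 1 = z + 1 - d := by rw [hz, hd]; push_cast; ring
  have hH : D.h • D.π Y = z • D.π Y := by
    rw [← D.π_H]
    refine projBar_eq_smul_of_actOne hκ ?_
    change actOne n κ ((diagE n (lo c) (lo c) - diagE n (hi c) (hi c)) * Y) = _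
    rw [actOne_mul, map_sub, LinearMap.sub_apply, hY, actOne_grassA, act_diagE_self_hw,
      act_diagE_self_hw, gammaE_wVec_self, gammaE_wVec_self, hz]
    simp only [hwTensor, TensorProduct.tmul_smul]
    module
  -- E annihilates 1_κ in the Verma factor, so both E^s and (ad F)^s act through γ alone and the
  -- finite-dimensional formula `pow_mul_pow_highest` applies.
  have hhw : ∀ s, D.π (D.E ^ s * D.δ^[s] Y) = RankOne.weightProd (UhBar m) d s • D.π Y := by
    intro s
    rw [← algebraMap_weightProd, algebraMap_smul]
    refine projBar_eq_smul_of_actOne hκ ?_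
    change actOne n κ (diagE n (lo c) (hi c) ^ s * (adF c)^[s] Y) = _
    rw [hY, iterate_adF_grassA, actOne_pow_grassA κ (lo_lt_hi c), actOne_grassA,
      pow_mul_pow_highest (d := (d : ℂ)) (h := gammaE n (lo c) (lo c) - gammaE n (hi c) (hi c))]
    · simp only [hwTensor, TensorProduct.tmul_smul]
    · rw [gammaE_comm, if_pos rfl, if_pos rfl]
    · have h1 := gammaE_comm n (lo c) (lo c) (hi c) (lo c)
      have h2 := gammaE_comm n (hi c) (hi c) (hi c) (lo c)
      rw [if_neg (lo_ne_hi c), if_pos rfl] at h1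
      rw [if_pos rfl, if_neg (lo_ne_hi c).symm] at h2
      have h3 := congrArg₂ (· - ·) h1 h2
      rw [sub_mul, mul_sub]
      refine Eq.trans (by abel) (h3.trans ?_)
      module
    · exact gammaE_wVec_eq_zero (lo_ne_hi c) hν
    · rw [LinearMap.sub_apply, gammaE_wVec_self, gammaE_wVec_self, hd]
      push_cast
      module
  obtain ⟨r, hr1, hr2⟩ := D.series_highest (rankOne_nil c P le_sup_left) d hhw
  have key : (z + 1 - d) • D.series Y = (z + 1) • D.π Y := by
    have h1 : ∀ x : ℂ, (D.h + algebraMap ℂ (UhBar m) x) • D.π Y = (z + x) • D.π Y := fun x => by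
      rw [add_smul, hH, algebraMap_smul, add_smul]
    have h2 : (D.h + 1) • D.π Y = (z + 1) • D.π Y := by simpa using h1 1
    have h3 : (D.h + 1 - d) • D.π Y = (z + 1 - d) • D.π Y := by
      have := h1 (1 - d)
      simp only [map_sub, map_one, map_natCast] at this
      rw [add_sub_assoc, this, add_sub_assoc]
    rw [← h2, ← hr2, mul_comm, mul_smul, h3, hr1, smul_comm]
  rw [hz1]
  have h4 := congrArg (identification n hκ) key
  rw [map_smul, map_smul, ← mkQ_xi] at h4
  refine h4.trans ?_
  congr 1
  change barToCoinv n hκ (toBar (grassA (wVec ν))) = _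
  rw [barToCoinv_toBar, actOne_grassA]
  rfl

/-- The factor of `isimProd` at the pair `(a, b)`. -/
def isimFactor (μ lam : Fin m → ℂ) (ν : Fin m → Fin (n + 1)) (a b : Fin m) : ℂ :=
  (-1 : ℂ) ^ ((ν a : ℕ) * (ν b : ℕ)) *
    (if ν a < ν b then
      (lam a - lam b - ((a : ℕ) : ℂ) + ((b : ℕ) : ℂ)) /
        (μ a - μ b - ((a : ℕ) : ℂ) + ((b : ℕ) : ℂ))
    else 1)

/-- The series is evaluated after reflection, at the weight σ_c ∘ κ and the labels σ_c ν. So the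
nontrivial case ν_(c+1) ≤ ν_c of `barToCoinv_xi_of_ge` appears as ν_c < ν_(c+1) before reflection.
-/
theorem step_vVec {c : Fin (m - 1)} {ξ : JBarQuot m n →ₛₗ[twist c] JBarQuot m n}
    {κ : Fin m → ℂ} (hκ : IsGeneric κ) (hξ : IsZhelobenko n c ξ)
    {I : Coinv n κ →ₗ[ℂ] Coinv n (dot (simpleRefl c) κ)}
    (hI : IsInducedBy ξ (identification n hκ) (identification n (hκ.dot (simpleRefl c))) I)
    {lam : Fin m → ℂ} {ν : Fin m → Fin (n + 1)} (h : ∀ a, lam a = κ a + ((ν a : ℕ) : ℂ)) :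
    I (vVec κ ν) = isimFactor κ lam ν (lo c) (hi c)
      • vVec (dot (simpleRefl c) κ) (fun a => ν ((simpleRefl c).symm a)) := by
  have hκ' := hκ.dot (simpleRefl c)
  set ν' : Fin m → Fin (n + 1) := fun a => ν ((simpleRefl c).symm a) with hν'
  have hlo : ν' (lo c) = ν (hi c) := by
    simp only [hν', simpleRefl_symm, simpleRefl_lo]
  have hhi : ν' (hi c) = ν (lo c) := by
    simp only [hν', simpleRefl_symm, simpleRefl_hi]
  have hv : vVec κ ν = quotToCoinv n hκ ((idealJBar m n).mkQ (toBar (grassA (wVec ν)))) := by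
    rw [quotToCoinv_toBar, actOne_grassA]; rfl
  have hsmul : ∀ (z : ℂ) (Y : AlgA m n), barToCoinv n hκ' (xi c (z • Y))
      = z • barToCoinv n hκ' (xi c Y) := fun z Y => by
    obtain ⟨N, hN⟩ := exists_iterate_adF c Y
    have hz : ∀ s, (adF c)^[s] (z • Y) = z • (adF c)^[s] Y := fun s => by
      induction s with
      | zero => rfl
      | succ s ih =>
        rw [Function.iterate_succ_apply', ih, adF, mul_smul_comm, smul_mul_assoc, ← smul_sub,
          ← adF, ← Function.iterate_succ_apply' (adF c)]
    rw [xi_eq_sum c hN, xi_eq_sum (N := N) c (by rw [hz, hN, smul_zero]), map_sum, map_sum,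
      Finset.smul_sum]
    refine Finset.sum_congr rfl fun s _ => ?_
    rw [← barToCoinv_complex_smul, LocalizedModule.smul'_mk, hz, mul_smul_comm, smul_comm]
  rw [isInducedBy_iff] at hI
  rw [hv, hI, hξ, permA_grassA, permGrass_wVec, grassA_smul, quotToCoinv_mkQ, hsmul, isimFactor,
    mul_smul]
  congr 1
  have h1 := dot_simpleRefl c κ (lo c)
  have h2 := dot_simpleRefl c κ (hi c)
  rw [simpleRefl_lo, simpleRoot_hi] at h1
  rw [simpleRefl_hi, simpleRoot_lo] at h2
  push_cast at h1 h2
  have hlh : ((hi c : ℕ) : ℂ) = ((lo c : ℕ) : ℂ) + 1 := by simp [lo, hi]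
  split_ifs with hlt
  · have h3 := barToCoinv_xi_of_ge hκ' c (ν := ν') (by rw [hlo, hhi]; exact hlt.le)
    have hne : κ (lo c) - κ (hi c) + 1 ≠ 0 := fun e =>
      hκ _ _ (lo_ne_hi c) (-1) (by push_cast; linear_combination e)
    rw [hlo, hhi] at h3
    -- Reflection negates both the numerator and the denominator, and the two signs cancel.
    have e1 : dot (simpleRefl c) κ (lo c) - dot (simpleRefl c) κ (hi c) + 1
        = -(κ (lo c) - κ (hi c) + 1) := by linear_combination h2 - h1
    have e2 : dot (simpleRefl c) κ (lo c) + ((ν (hi c) : ℕ) : ℂ)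
        - (dot (simpleRefl c) κ (hi c) + ((ν (lo c) : ℕ) : ℂ)) + 1
        = -(lam (lo c) - lam (hi c) + 1) := by rw [h, h]; linear_combination h2 - h1
    rw [e1, e2, neg_smul, neg_smul, neg_inj] at h3
    have e3 : lam (lo c) - lam (hi c) - ((lo c : ℕ) : ℂ) + ((hi c : ℕ) : ℂ)
        = lam (lo c) - lam (hi c) + 1 := by rw [hlh]; ring
    have e4 : κ (lo c) - κ (hi c) - ((lo c : ℕ) : ℂ) + ((hi c : ℕ) : ℂ)
        = κ (lo c) - κ (hi c) + 1 := by rw [hlh]; ring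
    rw [e3, e4, div_eq_inv_mul, mul_smul, ← h3, inv_smul_smul₀ hne]
  · rw [one_smul]
    exact barToCoinv_xi_of_le hκ' c (ν := ν') (by rw [hlo, hhi]; exact not_lt.1 hlt)

/-! ## The product over the inversions -/

theorem isimProd_one (μ lam : Fin m → ℂ) (ν : Fin m → Fin (n + 1)) :
    isimProd 1 μ lam ν = 1 := by
  rw [isimProd, Finset.filter_false_of_mem, Finset.prod_empty]
  rintro p - ⟨h1, h2⟩
  exact lt_asymm h1 h2

theorem simpleRefl_lt_iff (c : Fin (m - 1)) {x y : Fin m} (hxy : x ≠ y)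
    (h1 : ¬ (x = lo c ∧ y = hi c)) (h2 : ¬ (x = hi c ∧ y = lo c)) :
    simpleRefl c y < simpleRefl c x ↔ y < x := by
  rcases lt_or_gt_of_ne hxy with h | h
  · exact iff_of_false (not_lt.2 (simpleRefl_lt c h h1).1.le) (not_lt.2 h.le)
  · exact iff_of_true (simpleRefl_lt c h fun e => h2 ⟨e.2, e.1⟩).1 h

/-- Left multiplication by σ_c changes only the relative order of the values c and c + 1, so the
single new inversion is the pair of their preimages under τ. -/
theorem isimProd_simpleRefl_mul (c : Fin (m - 1)) (τ : Equiv.Perm (Fin m))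
    (hτ : τ.symm (lo c) < τ.symm (hi c)) (μ lam : Fin m → ℂ) (ν : Fin m → Fin (n + 1)) :
    isimProd (simpleRefl c * τ) μ lam ν
      = isimFactor μ lam ν (τ.symm (lo c)) (τ.symm (hi c)) * isimProd τ μ lam ν := by
  have hset : (Finset.univ : Finset (Fin m × Fin m)).filter
      (fun p => p.1 < p.2 ∧ (simpleRefl c * τ) p.2 < (simpleRefl c * τ) p.1)
      = insert (τ.symm (lo c), τ.symm (hi c)) ((Finset.univ : Finset (Fin m × Fin m)).filter
        (fun p => p.1 < p.2 ∧ τ p.2 < τ p.1)) := by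
    ext ⟨a, b⟩
    rw [Finset.mem_insert, Finset.mem_filter, Finset.mem_filter]
    simp only [Finset.mem_univ, true_and, Prod.mk.injEq,
      Equiv.Perm.mul_apply, Equiv.eq_symm_apply]
    by_cases h1 : τ a = lo c ∧ τ b = hi c
    · obtain ⟨ha, hb⟩ := h1
      obtain rfl := τ.eq_symm_apply.2 ha
      obtain rfl := τ.eq_symm_apply.2 hb
      simp only [Equiv.apply_symm_apply, simpleRefl_lo, simpleRefl_hi, hτ, lo_lt_hi, and_self,
        true_or]
    · by_cases h2 : τ a = hi c ∧ τ b = lo c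
      · obtain ⟨ha, hb⟩ := h2
        obtain rfl := τ.eq_symm_apply.2 ha
        obtain rfl := τ.eq_symm_apply.2 hb
        have := not_lt.2 hτ.le
        simp only [this, Equiv.apply_symm_apply, (lo_ne_hi c).symm, false_and, or_self]
      · simp only [h1, false_or]
        refine and_congr_right fun hab => ?_
        exact simpleRefl_lt_iff c (fun e => hab.ne (τ.injective e)) h1 h2
  rw [isimProd, hset, Finset.prod_insert]
  · rfl
  · simp only [Finset.mem_filter, Equiv.apply_symm_apply, not_and, not_lt]
    exact fun _ _ => (lo_lt_hi c).le

/-- The fraction depends on the weights only through differences of labels of κ + ρ, and these are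
merely permuted by the shifted action. -/
theorem isimFactor_dot (τ : Equiv.Perm (Fin m)) (μ lam : Fin m → ℂ) (ν : Fin m → Fin (n + 1))
    (a b : Fin m) :
    isimFactor (dot τ μ) (dot τ lam) (fun a => ν (τ.symm a)) a b
      = isimFactor μ lam ν (τ.symm a) (τ.symm b) := by
  have h : ∀ κ : Fin m → ℂ, dot τ κ a - dot τ κ b - ((a : ℕ) : ℂ) + ((b : ℕ) : ℂ)
      = κ (τ.symm a) - κ (τ.symm b) - ((τ.symm a : ℕ) : ℂ) + ((τ.symm b : ℕ) : ℂ) := fun κ => by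
    simp only [dot, rhoWt]; ring
  rw [isimFactor, isimFactor, h, h]

/-! ## Compositions along reduced words -/

/-- All properties are carried through one induction on the word. The target weight is a variable
with an equation, because its type-level forms for σ_c τ and for σ_c after τ are equal but not
identical. -/
theorem exists_isInducedBy_zhelWord
    {ξ : (c : Fin (m - 1)) → (JBarQuot m n →ₛₗ[twist c] JBarQuot m n)}
    (hξ : ∀ c, IsZhelobenko n c (ξ c)) {μ : Fin m → ℂ} (hμ : IsGeneric μ)
    (w : List (Fin (m - 1))) : ∀ (κ : Fin m → ℂ) (hκ : IsGeneric κ) (σ : Equiv.Perm (Fin m)),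
      IsReducedWord w σ → κ = dot σ μ →
    ∃ I : Coinv n μ →ₗ[ℂ] Coinv n κ,
      IsInducedBy (zhelWord ξ w) (identification n hμ) (identification n hκ) I ∧
      (∀ lam : Fin m → ℂ, ∀ v ∈ weightSub n μ lam, I v ∈ weightSub n κ (dot σ lam)) ∧
      (∀ (y : Yangian n) (v : Coinv n μ), I (yangAct n μ y v) = yangAct n κ y (I v)) ∧
      ∀ (lam : Fin m → ℂ) (ν : Fin m → Fin (n + 1)), (∀ a, lam a = μ a + ((ν a : ℕ) : ℂ)) →
        I (vVec μ ν) = isimProd σ μ lam ν • vVec κ (fun a => ν (σ.symm a)) := by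
  induction w with
  | nil =>
    rintro κ hκ σ hσ rfl
    obtain rfl : 1 = σ := hσ.1
    have e : dot 1 μ = μ := dot_one μ
    generalize dot 1 μ = κ at *
    subst e
    refine ⟨LinearMap.id, fun y => rfl, fun lam v hv => ?_, fun y v => rfl, fun lam ν _ => ?_⟩
    · rwa [dot_one]
    · rw [isimProd_one, one_smul]; rfl
  | cons c w ih =>
    rintro κ hκ σ hσ rfl
    set τ := (w.map simpleRefl).prod with hτ
    obtain rfl : simpleRefl c * τ = σ := hσ.1
    obtain ⟨I, hI, hIw, hIy, hIv⟩ := ih _ (hμ.dot τ) τ hσ.tail rfl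
    -- Replaces the weight (σ_c τ) ∘ μ by σ_c ∘ (τ ∘ μ) in all the types, so that the one-step map K
    -- has the right codomain.
    have e := dot_mul (simpleRefl c) τ μ
    generalize dot (simpleRefl c * τ) μ = κ at *
    subst e
    obtain ⟨K, hK⟩ := exists_isInducedBy_zhelobenko (hμ.dot τ) (hξ c)
    refine ⟨K ∘ₗ I, fun y => ?_, fun lam v hv => ?_, fun y v => ?_, fun lam ν h => ?_⟩
    · rw [LinearMap.comp_apply, hI y]
      exact hK _
    · rw [dot_mul]
      exact step_mem_weightSub _ hK (hIw lam v hv)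
    · rw [LinearMap.comp_apply, hIy, step_yangAct _ (hξ c) hK, LinearMap.comp_apply]
    · have h' : ∀ a, dot τ lam a = dot τ μ a + ((ν (τ.symm a) : ℕ) : ℂ) := fun a => by
        simp only [dot, h]; ring
      rw [LinearMap.comp_apply, hIv lam ν h, map_smul, step_vVec _ (hξ c) hK h', smul_smul,
        isimFactor_dot, isimProd_simpleRefl_mul c τ hσ.symm_lo_lt, mul_comm]
      rfl

theorem IsInducedBy.eq {μ κ : Fin m → ℂ} {g : JBarQuot m n → JBarQuot m n}
    {Φ : DoubleQuot n μ ≃ₗ[ℂ] Coinv n μ} {Ψ : DoubleQuot n κ ≃ₗ[ℂ] Coinv n κ}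
    {I K : Coinv n μ →ₗ[ℂ] Coinv n κ} (hI : IsInducedBy g Φ Ψ I) (hK : IsInducedBy g Φ Ψ K) :
    I = K := by
  refine LinearMap.ext fun v => ?_
  obtain ⟨y, rfl⟩ := Φ.surjective v
  obtain ⟨y, rfl⟩ := Submodule.mkQ_surjective _ y
  exact (hI ((idealJBar m n).mkQ y)).trans (hK _).symm

end

end

end KNYang

/-! ### Assembly of the proposition -/

open KNYang in
theorem proposition3p7 (m n : ℕ) (μ : Fin m → ℂ) (hμ : IsGeneric μ) (σ : Equiv.Perm (Fin m)) :
    (∀ c : Fin (m - 1), ∃! f : JBarQuot m n →ₛₗ[twist c] JBarQuot m n, IsZhelobenko n c f) ∧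
    (∀ κ : Fin m → ℂ, IsGeneric κ →
      ∃! Φ : DoubleQuot n κ ≃ₗ[ℂ] Coinv n κ, IsIdentification n κ Φ) ∧
    (∀ κ : Fin m → ℂ,
      (∃! ρ : Yangian n →ₐ[ℂ] Module.End ℂ (Coinv n κ), IsYangianAction n κ ρ) ∧
      ∀ ρ : Yangian n →ₐ[ℂ] Module.End ℂ (Coinv n κ), IsYangianAction n κ ρ →
        ∀ (lam : Fin m → ℂ) (y : Yangian n), ∀ v ∈ weightSub n κ lam,
          ρ y v ∈ weightSub n κ lam) ∧
    IsGeneric (dot σ μ) ∧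
    ∀ (ξ : (c : Fin (m - 1)) → (JBarQuot m n →ₛₗ[twist c] JBarQuot m n))
      (Φ : DoubleQuot n μ ≃ₗ[ℂ] Coinv n μ)
      (Ψ : DoubleQuot n (dot σ μ) ≃ₗ[ℂ] Coinv n (dot σ μ))
      (ρ : Yangian n →ₐ[ℂ] Module.End ℂ (Coinv n μ))
      (ρ' : Yangian n →ₐ[ℂ] Module.End ℂ (Coinv n (dot σ μ))),
      (∀ c, IsZhelobenko n c (ξ c)) →
      IsIdentification n μ Φ → IsIdentification n (dot σ μ) Ψ →
      IsYangianAction n μ ρ → IsYangianAction n (dot σ μ) ρ' →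
      ∀ w : List (Fin (m - 1)), IsReducedWord w σ →
        (∃! I : Coinv n μ →ₗ[ℂ] Coinv n (dot σ μ), IsInducedBy (zhelWord ξ w) Φ Ψ I) ∧
        ∀ I : Coinv n μ →ₗ[ℂ] Coinv n (dot σ μ), IsInducedBy (zhelWord ξ w) Φ Ψ I →
          (∀ lam : Fin m → ℂ, ∀ v ∈ weightSub n μ lam,
            I v ∈ weightSub n (dot σ μ) (dot σ lam)) ∧
          (∀ (y : Yangian n) (v : Coinv n μ), I (ρ y v) = ρ' y (I v)) ∧
          (∀ (lam : Fin m → ℂ) (ν : Fin m → Fin (n + 1)),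
            (∀ a, lam a = μ a + ((ν a : ℕ) : ℂ)) →
            vVec μ ν ∈ weightSub n μ lam ∧
            I (vVec μ ν) = isimProd σ μ lam ν • vVec (dot σ μ) (fun a => ν (σ.symm a))) := by
  refine ⟨existsUnique_zhelobenko, fun κ hκ => existsUnique_identification hκ,
    fun κ => ⟨⟨yangAct n κ, isYangianAction_yangAct κ, fun ρ hρ => hρ.eq_yangAct⟩,
      fun ρ hρ lam y v hv => ?_⟩, hμ.dot σ, ?_⟩
  · rw [hρ.eq_yangAct]
    exact yangAct_mem_weightSub y hv
  intro ξ Φ Ψ ρ ρ' hξ hΦ hΨ hρ hρ' w hw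
  obtain rfl := hΦ.eq (isIdentification_identification hμ)
  obtain rfl := hΨ.eq (isIdentification_identification (hμ.dot σ))
  obtain rfl := hρ.eq_yangAct
  obtain rfl := hρ'.eq_yangAct
  obtain ⟨K, hK, hKw, hKy, hKv⟩ := exists_isInducedBy_zhelWord hξ hμ w _ (hμ.dot σ) σ hw rfl
  refine ⟨⟨K, hK, fun I hI => hI.eq hK⟩, fun I hI => ?_⟩
  obtain rfl := hI.eq hK
  exact ⟨hKw, hKy, fun lam ν h => ⟨vVec_mem_weightSub μ lam ν h, hKv lam ν h⟩⟩
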